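/- Let $E:\mathbb R\to\mathbb R^n$ be locally integrable with $E(t+1)=E(t)$ for a.e. $t$, and put $E_0=\int_0^1E(t)\,dt$. Let $V\in C^\infty(\mathbb R\times\mathbb R^n;\mathbb R)$ satisfy $V(t+1,x)=V(t,x)$ and, for some $\delta>0$ and all $k\in\mathbb N$, $\alpha\in\mathbb N^n$, $|\partial_t^k\partial_x^\alpha V(t,x)|\le C_{k,\alpha}(1+|x|^2)^{-(\delta+|\alpha|)/2}$ on $\mathbb R\times\mathbb R^n$. Assume $\delta>1$ if $E_0=0$; $\delta>\frac12$ if $E_0\ne0$ and $n\ge3$; $\delta>\frac34$ if $E_0\neq0$ and $n=2$. Let $p=-i\partial_x$, $H_0(t)=\frac12p^2-E(t)\cdot x$ and $H(t)=H_0(t)+V(t,x)$ on $L^2(\mathbb R^n)$, and let $U_0(t,s)$, $U(t,s)$ be their unitary propagators, i.e. the strongly continuous families of unitary operators with $U(t,s)U(s,r)=U(t,r)$ that leave the Schwartz space $\mathcal S(\mathbb R^n)$ invariant and satisfy, for $\varphi\in\mathcal S(\mathbb R^n)$, $$U(t,s)\varphi=\varphi-i\int_s^tH(\tau)U(\tau,s)\varphi\,d\tau=\varphi+i\int_t^sU(t,\sigma)H(\sigma)\varphi\,d\sigma$$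 (Bochner integrals in $L^2$), and likewise for $U_0$, $H_0$. Let $\omega\in\mathbb R^n$ with $|\omega|=1$ and $\omega\cdot E_0=0$. Then for every $s\in\mathbb R$ the wave operators $W^\pm(s)=\operatorname{s-lim}_{t\to\pm\infty}U(s,t)U_0(t,s)$ exist, and the scattering operator $S(s)=W^{+}(s)^*W^-(s)$ has the following property. Let $\Phi,\Psi$ be Fourier transforms of functions in $C_0^\infty(\mathbb R^n)$ and put $\Phi_{\lambda,\omega}=e^{i\sqrt\lambda\,x\cdot\omega}\Phi$, $\Psi_{\lambda,\omega}=e^{i\sqrt\lambda\,x\cdot\omega}\Psi$. Then for every component $j=1,\dots,n$, as $\lambda\to+\infty$, $$\langle[S(s),p_j]\Phi_{\lambda,\omega},\Psi_{\lambda,\omega}\rangle=\lambda^{-1/2}\Big\langle\Big(\int_{-\infty}^{+\infty}\partial_{x_j}V(s,x+t\omega)\,dt\Big)\Phi,\Psi\Big\rangle+o(\lambda^{-1/2}),$$ where $\langle f,g\rangle=\int f\,\overline g\,dx$, the left side means $\langle S(s)p_j\Phi_{\lambda,\omega},\Psi_{\lambda,\omega}\rangle-\langle S(s)\Phi_{\lambda,\omega},p_j\Psi_{\lambda,\omega}\rangle$,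 and the integrals on the right converge absolutely. -/

import Mathlib

open MeasureTheory Filter Topology
open scoped SchwartzMap FourierTransform LineDeriv Laplacian

noncomputable section

namespace StarkScattering

/-- Configuration space `ℝⁿ`. -/
abbrev Space (n : ℕ) : Type := EuclideanSpace ℝ (Fin n)

/-- The Hilbert space `L²(ℝⁿ)`. -/
abbrev L2 (n : ℕ) : Type := Lp ℂ 2 (volume : Measure (Space n))

/-- A Schwartz function regarded as an element of `L²(ℝⁿ)`. -/
abbrev toL2 {n : ℕ} (φ : 𝓢(Space n, ℂ)) : L2 n := φ.toLp 2 volume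

/-- The Japanese bracket `⟨x⟩ = (1 + |x|²)^{1/2}`. -/
def bracket {n : ℕ} (x : Space n) : ℝ := Real.sqrt (1 + ‖x‖ ^ 2)

/-- The external field: locally integrable in time and periodic with period `1`. -/
structure IsPeriodicField {n : ℕ} (E : ℝ → Space n) : Prop where
  locallyIntegrable : LocallyIntegrable E volume
  periodic : ∀ᵐ t : ℝ, E (t + 1) = E t

/-- The mean `E₀` of the external field over one period. -/
def meanField {n : ℕ} (E : ℝ → Space n) : Space n := ∫ t in (0 : ℝ)..1, E t

/-- The potential: real, smooth in `(t, x)`, periodic in time with period `1`, and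
`|∂_t^k ∂_x^α V(t,x)| ≤ C_{k,α} ⟨x⟩^{-δ-|α|}`. The derivatives of order `m` in `x` are collected
in the `m`-th iterated Fréchet derivative. -/
structure IsPotential {n : ℕ} (δ : ℝ) (V : ℝ → Space n → ℝ) : Prop where
  smooth : ContDiff ℝ ((⊤ : ℕ∞) : WithTop ℕ∞) (fun q : ℝ × Space n => V q.1 q.2)
  periodic : ∀ t x, V (t + 1) x = V t x
  decay : ∀ k m : ℕ, ∃ C : ℝ, ∀ (t : ℝ) (x : Space n),
    ‖iteratedFDeriv ℝ m (fun y => iteratedDeriv k (fun τ => V τ y) t) x‖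
      ≤ C * bracket x ^ (-δ - (m : ℝ))

/-- The Hamiltonian `H(t) = ½ p² - E(t)·x + V(t,x)`, with `p = -i∂_x`, on Schwartz functions.
The multiplications are those of Mathlib, for multipliers of temperate growth; see
`hamiltonian_apply` for the pointwise formula. -/
def hamiltonian {n : ℕ} (E : ℝ → Space n) (V : ℝ → Space n → ℝ) (t : ℝ)
    (φ : 𝓢(Space n, ℂ)) : 𝓢(Space n, ℂ) :=
  -((1 / 2 : ℂ) • Δ φ)
    - SchwartzMap.smulLeftCLM ℂ (fun x : Space n => ((inner ℝ (E t) x : ℝ) : ℂ)) φ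
    + SchwartzMap.smulLeftCLM ℂ (fun x : Space n => ((V t x : ℝ) : ℂ)) φ

/-- The free Hamiltonian `H₀(t) = ½ p² - E(t)·x` on Schwartz functions. -/
def freeHamiltonian {n : ℕ} (E : ℝ → Space n) (t : ℝ) (φ : 𝓢(Space n, ℂ)) : 𝓢(Space n, ℂ) :=
  -((1 / 2 : ℂ) • Δ φ)
    - SchwartzMap.smulLeftCLM ℂ (fun x : Space n => ((inner ℝ (E t) x : ℝ) : ℂ)) φ

theorem IsPotential.hasTemperateGrowth {n : ℕ} {δ : ℝ} {V : ℝ → Space n → ℝ} (hδ : 0 < δ)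
    (hV : IsPotential δ V) (t : ℝ) :
    Function.HasTemperateGrowth (fun x : Space n => ((V t x : ℝ) : ℂ)) := by
  have h1 : Function.HasTemperateGrowth (V t) := by
    refine ⟨hV.smooth.comp (contDiff_const.prodMk contDiff_id), fun m => ?_⟩
    obtain ⟨C, hC⟩ := hV.decay 0 m
    refine ⟨0, |C|, fun x => ?_⟩
    have h := hC t x
    simp only [iteratedDeriv_zero] at h
    have hb : 1 ≤ bracket x := by
      rw [bracket, Real.one_le_sqrt]
      nlinarith [sq_nonneg ‖x‖]
    have hb0 : (0 : ℝ) ≤ bracket x ^ (-δ - (m : ℝ)) := Real.rpow_nonneg (by linarith) _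
    have hb1 : bracket x ^ (-δ - (m : ℝ)) ≤ 1 :=
      Real.rpow_le_one_of_one_le_of_nonpos hb (by
        have : (0 : ℝ) ≤ m := Nat.cast_nonneg m
        linarith)
    calc _ ≤ C * bracket x ^ (-δ - (m : ℝ)) := h
      _ ≤ |C| * bracket x ^ (-δ - (m : ℝ)) := by gcongr; exact le_abs_self C
      _ ≤ |C| * 1 := by gcongr
      _ = _ := by simp
  exact Function.HasTemperateGrowth.comp (g := fun r : ℝ => (r : ℂ)) (by fun_prop) h1

theorem hamiltonian_apply {n : ℕ} {δ : ℝ} {V : ℝ → Space n → ℝ} (hδ : 0 < δ)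
    (hV : IsPotential δ V) (E : ℝ → Space n) (t : ℝ) (φ : 𝓢(Space n, ℂ)) (x : Space n) :
    hamiltonian E V t φ x = -(1 / 2) * Laplacian.laplacian (φ : Space n → ℂ) x
      - ((inner ℝ (E t) x : ℝ) : ℂ) * φ x + ((V t x : ℝ) : ℂ) * φ x := by
  have h1 := hV.hasTemperateGrowth hδ t
  have h2 : Function.HasTemperateGrowth (fun x : Space n => ((inner ℝ (E t) x : ℝ) : ℂ)) := by
    fun_prop
  simp [hamiltonian, SchwartzMap.smulLeftCLM_apply_apply, h1, h2, SchwartzMap.laplacian_apply]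

/-- The (unitary) propagator of a family of operators `H(t)` on Schwartz functions: strongly
continuous, `U(t,s) U(s,r) = U(t,r)`, leaving the Schwartz space invariant, and such that
`i ∂_t U(t,s) φ = H(t) U(t,s) φ` and `i ∂_s U(t,s) φ = -U(t,s) H(s) φ` for Schwartz `φ`.
As `H(t)` is only locally integrable in `t`, both equations are meant in the Carathéodory sense:
they are written in integrated form, with Bochner integrals in `L²(ℝⁿ)`. -/
structure IsPropagator {n : ℕ} (H : ℝ → 𝓢(Space n, ℂ) → 𝓢(Space n, ℂ))
    (U : ℝ → ℝ → (L2 n ≃ₗᵢ[ℂ] L2 n)) : Prop where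
  continuous : ∀ f : L2 n, Continuous (fun q : ℝ × ℝ => U q.1 q.2 f)
  cocycle : ∀ (t s r : ℝ) (f : L2 n), U t s (U s r f) = U t r f
  invariant : ∀ (t s : ℝ) (φ : 𝓢(Space n, ℂ)), ∃ ψ : 𝓢(Space n, ℂ), U t s (toL2 φ) = toL2 ψ
  forward : ∀ (s : ℝ) (φ : 𝓢(Space n, ℂ)) (u : ℝ → 𝓢(Space n, ℂ)),
    (∀ t, U t s (toL2 φ) = toL2 (u t)) →
      (∀ a b : ℝ, IntervalIntegrable (fun τ => toL2 (H τ (u τ))) volume a b) ∧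
      ∀ t : ℝ, U t s (toL2 φ) = toL2 φ - Complex.I • ∫ τ in s..t, toL2 (H τ (u τ))
  backward : ∀ (t : ℝ) (φ : 𝓢(Space n, ℂ)),
    (∀ a b : ℝ, IntervalIntegrable (fun σ => U t σ (toL2 (H σ φ))) volume a b) ∧
    ∀ s : ℝ, U t s (toL2 φ) = toL2 φ + Complex.I • ∫ σ in t..s, U t σ (toL2 (H σ φ))

/-- `W` is the strong limit of `U(s,t) U₀(t,s)` as `t` tends to `+∞` (`l = atTop`) or to `-∞`
(`l = atBot`). -/
def IsWaveOperator {n : ℕ} (U U₀ : ℝ → ℝ → (L2 n ≃ₗᵢ[ℂ] L2 n)) (s : ℝ) (l : Filter ℝ)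
    (W : L2 n →L[ℂ] L2 n) : Prop :=
  ∀ f : L2 n, Tendsto (fun t => U s t (U₀ t s f)) l (𝓝 (W f))

/-- The scattering operator `S = (W⁺)* W⁻`. -/
def scatteringOperator {n : ℕ} (Wp Wm : L2 n →L[ℂ] L2 n) : L2 n →L[ℂ] L2 n :=
  (ContinuousLinearMap.adjoint Wp).comp Wm

/-- The component `p_j = -i ∂_{x_j}` of the momentum, on Schwartz functions. -/
def momentum {n : ℕ} (j : Fin n) (φ : 𝓢(Space n, ℂ)) : 𝓢(Space n, ℂ) :=
  -Complex.I • ∂_{(EuclideanSpace.single j (1 : ℝ) : Space n)} φ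

/-- The `j`-th component of `⟨[S, p] φ, ψ⟩ = ⟨S p φ, ψ⟩ - ⟨S φ, p ψ⟩`, for the scalar product
`⟨f, g⟩ = ∫ f ḡ` (in Mathlib `inner ℂ g f`). -/
def commutatorForm {n : ℕ} (S : L2 n →L[ℂ] L2 n) (j : Fin n) (φ ψ : 𝓢(Space n, ℂ)) : ℂ :=
  inner ℂ (toL2 ψ) (S (toL2 (momentum j φ))) - inner ℂ (toL2 (momentum j ψ)) (S (toL2 φ))

/-- `Φ` is the Fourier transform of a function in `C_0^∞(ℝⁿ)`. (This class of functions does not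
depend on how the Fourier transform is normalized.) -/
def IsFourierOfTestFunction {n : ℕ} (Φ : 𝓢(Space n, ℂ)) : Prop :=
  ∃ f : 𝓢(Space n, ℂ), HasCompactSupport (f : Space n → ℂ) ∧ Φ = 𝓕 f

/-- The plane wave `x ↦ e^{i √lam x·w}`. -/
def planeWave {n : ℕ} (lam : ℝ) (w : Space n) (x : Space n) : ℂ :=
  Complex.exp (Complex.I * ((Real.sqrt lam * inner ℝ w x : ℝ) : ℂ))

theorem planeWave_hasTemperateGrowth {n : ℕ} (lam : ℝ) (w : Space n) :
    Function.HasTemperateGrowth (planeWave lam w) := by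
  have h1 : Function.HasTemperateGrowth (fun r : ℝ => Complex.exp (Complex.I * (r : ℂ))) := by
    have hd : ∀ m : ℕ, iteratedDeriv m (fun r : ℝ => Complex.exp (Complex.I * (r : ℂ)))
        = fun r : ℝ => Complex.I ^ m * Complex.exp (Complex.I * (r : ℂ)) := by
      intro m
      induction m with
      | zero => simp
      | succ m ih =>
        rw [iteratedDeriv_succ, ih]
        funext r
        have h : HasDerivAt (fun r : ℝ => Complex.exp (Complex.I * (r : ℂ)))
            (Complex.exp (Complex.I * (r : ℂ)) * (Complex.I * 1)) r :=
          ((Complex.ofRealCLM.hasDerivAt (x := r)).const_mul Complex.I).cexp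
        rw [(h.const_mul (Complex.I ^ m)).deriv]
        ring
    refine ⟨?_, fun m => ⟨0, 1, fun r => ?_⟩⟩
    · exact Complex.contDiff_exp.comp (contDiff_const.mul Complex.ofRealCLM.contDiff)
    · rw [norm_iteratedFDeriv_eq_norm_iteratedDeriv, hd]
      simp [mul_comm Complex.I, Complex.norm_exp_ofReal_mul_I]
  have h2 : Function.HasTemperateGrowth (fun x : Space n => Real.sqrt lam * inner ℝ w x) := by
    fun_prop
  exact Function.HasTemperateGrowth.comp
    (g := fun r : ℝ => Complex.exp (Complex.I * (r : ℂ))) h1 h2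

/-- The function `Φ_{lam,w} = e^{i √lam x·w} Φ`. -/
def boost {n : ℕ} (lam : ℝ) (w : Space n) (Φ : 𝓢(Space n, ℂ)) : 𝓢(Space n, ℂ) :=
  SchwartzMap.smulLeftCLM ℂ (planeWave lam w) Φ

theorem boost_apply {n : ℕ} (lam : ℝ) (w : Space n) (Φ : 𝓢(Space n, ℂ)) (x : Space n) :
    boost lam w Φ x = planeWave lam w x * Φ x := by
  simp [boost, SchwartzMap.smulLeftCLM_apply_apply, planeWave_hasTemperateGrowth]

/-- `∂_{x_j} V(s, y)`. -/
def gradComponent {n : ℕ} (V : ℝ → Space n → ℝ) (j : Fin n) (s : ℝ) (y : Space n) : ℝ :=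
  fderiv ℝ (V s) y (EuclideanSpace.single j 1)

/-- `∫_ℝ ∂_{x_j} V(s, x + tw) dt`. -/
def xrayGrad {n : ℕ} (V : ℝ → Space n → ℝ) (j : Fin n) (s : ℝ) (w x : Space n) : ℝ :=
  ∫ t : ℝ, gradComponent V j s (x + t • w)

end StarkScattering

end

open MeasureTheory Filter Topology
open scoped SchwartzMap FourierTransform LineDeriv Laplacian

noncomputable section

namespace StarkScattering

/-! ### Absolutely continuous curves in normed spaces. -/

section AbsolutelyContinuous

variable {X Y H : Type*}

/-! Without potential the dynamics is explicit (Avron–Herbst): if b' = E, y' = b, κ' = |b|²/2 with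
b(s) = η, y(s) = 0, κ(s) = 0, then e^{iη·x} 𝓕⁻f evolves into e^{ib·x} e^{-iκ} e^{-iy·p}
e^{-i(t-s)p²/2} 𝓕⁻f (`IsPropagator.apply_freeSolution`). With η = vw and v = √λ the packet follows
the classical orbit y(t), up to a spreading of order 1 + |t-s|. Periodicity of E gives y(t) =
(t-s)vw + (t-s)²E₀/2 + O(|t-s|), and since w ⟂ E₀ the two main terms cannot cancel: for large v,
both 1 + v|t-s| and (1+|t-s|)^a are O(⟨y⟩), with a = 1 in general and a = 2 also allowed if E₀ ≠ 0
(`exists_isFar_highVelocity`).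

The quantum counterpart is a propagation estimate, `exists_freeEvol_decay`. In the Fourier picture
l·x acts as (i/2π)∂_l plus multiplication by the classical position along l; dividing f twice by
that position, of size at least of order Q on the support, shows that a weight O(⟨x⟩^{-μ}) with 0 ≤
μ ≤ 2 gains Q^{-μ}. Cook's method then yields the wave operators as soon as aδ > 1, which the
hypotheses guarantee: δ > 1 if E₀ = 0, and δ > 1/2 otherwise.

For the asymptotics one expands to first order in V. The remainder is bounded by a product of two
time integrals of the potential acting on free packets (`norm_inner_limit_sub_le`), which may be too
large when V decays slowly. So V(t,y(t)), a function of time alone, is first subtracted from V. This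
costs only the scalar phase exp(i∫V(t,y(t))dt), which tends to 1. On the packet V(t,x) - V(t,y) is
smaller by the factor (1+|t-s|)/⟨y⟩, each integral becomes O(1/v)
(`exists_integral_gauged_potential_le`), and the remainder is O(v⁻²), still after multiplication by
v negligible.

In the commutator with p_j the boost, the zeroth order term and the subtracted function all cancel,
and there remains the time integral of the matrix elements of ∂_jV along the free evolution
(`exists_commutatorForm_first_order`). The substitution t = s + r/v freezes the time at s and turns
the orbit into the line rw. Since ∂_jV decays with an exponent greater than 1, dominated convergence
applies (`tendsto_integral_forceElement`), and Fubini turns the limit into the X-ray transform of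
∂_jV (`integral_forceElement_translation`). -/

theorem absolutelyContinuousOnInterval_of_dist_le_add {Z : Type*} [PseudoMetricSpace X]
    [PseudoMetricSpace Y] [PseudoMetricSpace Z]
    {f : ℝ → X} {g : ℝ → Y} {k : ℝ → Z} {a b C D : ℝ} (hg : AbsolutelyContinuousOnInterval g a b)
    (hk : AbsolutelyContinuousOnInterval k a b)
    (h : ∀ x ∈ Set.uIcc a b, ∀ y ∈ Set.uIcc a b,
      dist (f x) (f y) ≤ C * dist (g x) (g y) + D * dist (k x) (k y)) :
    AbsolutelyContinuousOnInterval f a b := by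
  have h0 : Tendsto (fun E : ℕ × (ℕ → ℝ × ℝ) ↦
      C * ∑ i ∈ Finset.range E.1, dist (g (E.2 i).1) (g (E.2 i).2) +
      D * ∑ i ∈ Finset.range E.1, dist (k (E.2 i).1) (k (E.2 i).2))
      (AbsolutelyContinuousOnInterval.totalLengthFilter ⊓
        𝓟 (AbsolutelyContinuousOnInterval.disjWithin a b)) (𝓝 0) := by
    have h1 := Tendsto.const_mul C hg
    have h2 := Tendsto.const_mul D hk
    have h3 := h1.add h2
    rwa [mul_zero, mul_zero, add_zero] at h3
  refine squeeze_zero' (Eventually.of_forall fun E => Finset.sum_nonneg fun _ _ => dist_nonneg)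
    ?_ h0
  have : ∀ᶠ E : ℕ × (ℕ → ℝ × ℝ) in AbsolutelyContinuousOnInterval.totalLengthFilter ⊓
      𝓟 (AbsolutelyContinuousOnInterval.disjWithin a b),
      E ∈ AbsolutelyContinuousOnInterval.disjWithin a b := eventually_inf_principal.mpr (by simp)
  filter_upwards [this] with E hE
  rw [Finset.mul_sum, Finset.mul_sum, ← Finset.sum_add_distrib]
  refine Finset.sum_le_sum fun i hi => ?_
  have := hE.1 i hi
  exact h _ this.1 _ this.2

theorem absolutelyContinuousOnInterval_of_dist_le [PseudoMetricSpace X] [PseudoMetricSpace Y]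
    {f : ℝ → X} {g : ℝ → Y} {a b C : ℝ} (hg : AbsolutelyContinuousOnInterval g a b)
    (h : ∀ x ∈ Set.uIcc a b, ∀ y ∈ Set.uIcc a b, dist (f x) (f y) ≤ C * dist (g x) (g y)) :
    AbsolutelyContinuousOnInterval f a b :=
  absolutelyContinuousOnInterval_of_dist_le_add (D := 0) hg hg (by simpa using h)

/-- `f` is locally absolutely continuous with almost everywhere derivative `f'`. -/
structure HasACDeriv [NormedAddCommGroup H] [NormedSpace ℝ H] (f f' : ℝ → H) : Prop where
  ac : ∀ a b : ℝ, AbsolutelyContinuousOnInterval f a b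
  deriv : ∀ᵐ t : ℝ, HasDerivAt f (f' t) t

theorem HasACDeriv.continuous [NormedAddCommGroup H] [NormedSpace ℝ H] {f f' : ℝ → H}
    (hf : HasACDeriv f f') : Continuous f := by
  refine continuous_iff_continuousAt.2 fun t => ?_
  refine (hf.ac (t - 1) (t + 1)).continuousOn.continuousAt ?_
  rw [Set.uIcc_of_le (by linarith)]
  exact Icc_mem_nhds (by linarith) (by linarith)

theorem locallyIntegrable_of_intervalIntegrable [NormedAddCommGroup H]
    {f : ℝ → H} (hf : ∀ a b : ℝ, IntervalIntegrable f volume a b) :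
    LocallyIntegrable f volume := by
  intro x
  refine ⟨Set.Ioc (x - 1) (x + 1), ?_, ?_⟩
  · exact Ioc_mem_nhds (by linarith) (by linarith)
  · exact (intervalIntegrable_iff_integrableOn_Ioc_of_le (by linarith)).1 (hf (x - 1) (x + 1))

/-- Increments of `f` are dominated by those of the real primitive of ‖f'‖, which transfers absolute
continuity; the derivative comes from Lebesgue differentiation. -/
theorem hasACDeriv_of_integral [NormedAddCommGroup H] [NormedSpace ℝ H] [CompleteSpace H]
    {f f' : ℝ → H} {c : H} {s : ℝ} (hint : ∀ a b : ℝ, IntervalIntegrable f' volume a b)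
    (h : ∀ t, f t = c + ∫ τ in s..t, f' τ) : HasACDeriv f f' := by
  constructor
  · intro a b
    have hn : ∀ a b : ℝ, IntervalIntegrable (fun τ => ‖f' τ‖) volume a b := fun a b =>
      (hint a b).norm
    have h1 := (hn a b).absolutelyContinuousOnInterval_intervalIntegral
      (c := a) Set.left_mem_uIcc
    refine absolutelyContinuousOnInterval_of_dist_le (C := 1) h1 fun x _ y _ => ?_
    rw [h x, h y, dist_add_left, dist_eq_norm, dist_eq_norm, one_mul,
      intervalIntegral.integral_interval_sub_left (hint _ _) (hint _ _),
      intervalIntegral.integral_interval_sub_left (hn _ _) (hn _ _)]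
    refine (intervalIntegral.norm_integral_le_abs_integral_norm).trans (le_of_eq ?_)
    rw [Real.norm_eq_abs]
  · have := LocallyIntegrable.ae_hasDerivAt_integral (locallyIntegrable_of_intervalIntegrable hint)
    filter_upwards [this] with t ht
    have := (ht s).const_add c
    refine this.congr_of_eventuallyEq (Eventually.of_forall h)

theorem HasACDeriv.sub [NormedAddCommGroup H] [NormedSpace ℝ H] {f f' g g' : ℝ → H}
    (hf : HasACDeriv f f') (hg : HasACDeriv g g') :
    HasACDeriv (fun t => f t - g t) (fun t => f' t - g' t) := by
  refine ⟨fun a b => (hf.ac a b).sub (hg.ac a b), ?_⟩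
  filter_upwards [hf.deriv, hg.deriv] with t h1 h2 using h1.sub h2

/-- This replaces the mean value theorem: since E is only locally integrable, conservation laws can
be differentiated only almost everywhere. -/
theorem HasACDeriv.eq_of_ae_zero [NormedAddCommGroup H] [NormedSpace ℝ H] {f f' : ℝ → H}
    (hf : HasACDeriv f f') (h0 : ∀ᵐ t, f' t = 0) (a b : ℝ) : f a = f b := by
  obtain ⟨C, hC⟩ := (hf.ac a b).const_of_ae_hasDerivAt_zero (by
    filter_upwards [hf.deriv, h0] with t h1 h2 _
    rwa [h2] at h1)
  rw [hC a Set.left_mem_uIcc, hC b Set.right_mem_uIcc]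

theorem HasACDeriv.inner_inner [NormedAddCommGroup H] [InnerProductSpace ℂ H] [NormedSpace ℝ H]
    {f f' g g' : ℝ → H} (hf : HasACDeriv f f') (hg : HasACDeriv g g') :
    HasACDeriv (fun t => inner ℂ (f t) (g t))
      (fun t => inner ℂ (f t) (g' t) + inner ℂ (f' t) (g t)) := by
  constructor
  · intro a b
    obtain ⟨M, hM⟩ := (isCompact_uIcc (a := a) (b := b)).exists_bound_of_continuousOn
      hf.continuous.continuousOn
    obtain ⟨N, hN⟩ := (isCompact_uIcc (a := a) (b := b)).exists_bound_of_continuousOn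
      hg.continuous.continuousOn
    refine absolutelyContinuousOnInterval_of_dist_le_add (C := N) (D := M) (hf.ac a b) (hg.ac a b)
      fun x hx y hy => ?_
    have : inner ℂ (f x) (g x) - inner ℂ (f y) (g y)
        = inner ℂ (f x - f y) (g x) + inner ℂ (f y) (g x - g y) := by
      rw [inner_sub_left, inner_sub_right]; ring
    rw [dist_eq_norm, this, dist_eq_norm, dist_eq_norm]
    refine (norm_add_le _ _).trans ?_
    gcongr
    · refine (norm_inner_le_norm _ _).trans ?_
      rw [mul_comm]
      gcongr
      exact hN x hx
    · refine (norm_inner_le_norm _ _).trans ?_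
      gcongr
      exact hM y hy
  · filter_upwards [hf.deriv, hg.deriv] with t h1 h2 using h1.inner ℂ h2

end AbsolutelyContinuous

/-! ### Multiplication by unimodular phases, and L² bounds from pointwise bounds. -/

section Twist

theorem hasTemperateGrowth_cexp_I_mul {D : Type*} [NormedAddCommGroup D] [NormedSpace ℝ D]
    {a : D → ℝ} (ha : Function.HasTemperateGrowth a) :
    Function.HasTemperateGrowth (fun x => Complex.exp (Complex.I * (a x : ℂ))) := by
  have h1 : Function.HasTemperateGrowth (fun r : ℝ => Complex.exp (Complex.I * (r : ℂ))) := by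
    have hd : ∀ m : ℕ, iteratedDeriv m (fun r : ℝ => Complex.exp (Complex.I * (r : ℂ)))
        = fun r : ℝ => Complex.I ^ m * Complex.exp (Complex.I * (r : ℂ)) := by
      intro m
      induction m with
      | zero => simp
      | succ m ih =>
        rw [iteratedDeriv_succ, ih]
        funext r
        have h : HasDerivAt (fun r : ℝ => Complex.exp (Complex.I * (r : ℂ)))
            (Complex.exp (Complex.I * (r : ℂ)) * (Complex.I * 1)) r :=
          ((Complex.ofRealCLM.hasDerivAt (x := r)).const_mul Complex.I).cexp
        rw [(h.const_mul (Complex.I ^ m)).deriv]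
        ring
    refine ⟨?_, fun m => ⟨0, 1, fun r => ?_⟩⟩
    · exact Complex.contDiff_exp.comp (contDiff_const.mul Complex.ofRealCLM.contDiff)
    · rw [norm_iteratedFDeriv_eq_norm_iteratedDeriv, hd]
      simp [mul_comm Complex.I, Complex.norm_exp_ofReal_mul_I]
  exact Function.HasTemperateGrowth.comp
    (g := fun r : ℝ => Complex.exp (Complex.I * (r : ℂ))) h1 ha

variable {n : ℕ}

/-- Multiplication of a Schwartz function by `e^{i a}`, for `a` of temperate growth. -/
def twist (a : Space n → ℝ) (φ : 𝓢(Space n, ℂ)) : 𝓢(Space n, ℂ) :=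
  SchwartzMap.smulLeftCLM ℂ (fun x => Complex.exp (Complex.I * (a x : ℂ))) φ

theorem twist_apply {a : Space n → ℝ} (ha : Function.HasTemperateGrowth a) (φ : 𝓢(Space n, ℂ))
    (x : Space n) : twist a φ x = Complex.exp (Complex.I * (a x : ℂ)) * φ x := by
  rw [twist, SchwartzMap.smulLeftCLM_apply_apply (hasTemperateGrowth_cexp_I_mul ha), smul_eq_mul]

theorem norm_twist_apply {a : Space n → ℝ} (ha : Function.HasTemperateGrowth a)
    (φ : 𝓢(Space n, ℂ)) (x : Space n) : ‖twist a φ x‖ = ‖φ x‖ := by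
  rw [twist_apply ha, norm_mul, mul_comm Complex.I, Complex.norm_exp_ofReal_mul_I, one_mul]

theorem toL2_add (φ ψ : 𝓢(Space n, ℂ)) : toL2 (φ + ψ) = toL2 φ + toL2 ψ := rfl

theorem toL2_smul (c : ℂ) (φ : 𝓢(Space n, ℂ)) : toL2 (c • φ) = c • toL2 φ := rfl

theorem toL2_sub (φ ψ : 𝓢(Space n, ℂ)) : toL2 (φ - ψ) = toL2 φ - toL2 ψ := 
  map_sub (SchwartzMap.toLpCLM ℂ ℂ 2 (volume : Measure (Space n))) φ ψ

theorem toL2_neg (φ : 𝓢(Space n, ℂ)) : toL2 (-φ) = - toL2 φ := 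
  map_neg (SchwartzMap.toLpCLM ℂ ℂ 2 (volume : Measure (Space n))) φ

/-- Monotonicity of the L² norm and Minkowski. All operator estimates below are proved pointwise and
pass through this lemma. -/
theorem norm_toL2_le_sum {ι : Type*} (s : Finset ι) (c : ι → ℝ)
    (φ : 𝓢(Space n, ℂ)) (χ : ι → 𝓢(Space n, ℂ)) (hc : ∀ i ∈ s, 0 ≤ c i)
    (h : ∀ x, ‖φ x‖ ≤ ∑ i ∈ s, c i * ‖χ i x‖) :
    ‖toL2 φ‖ ≤ ∑ i ∈ s, c i * ‖toL2 (χ i)‖ := by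
  have hm : ∀ i ∈ s, MemLp (fun x => c i * ‖χ i x‖) 2 (volume : Measure (Space n)) :=
    fun i _ => ((χ i).memLp 2 volume).norm.const_mul (c i)
  have h1 : eLpNorm φ 2 (volume : Measure (Space n))
      ≤ ∑ i ∈ s, eLpNorm (fun x => c i * ‖χ i x‖) 2 (volume : Measure (Space n)) := by
    have h2 := eLpNorm_sum_le (f := fun i x => c i * ‖χ i x‖) (s := s) (p := 2)
      (μ := (volume : Measure (Space n))) (fun i hi => (hm i hi).aestronglyMeasurable) (by norm_num)
    refine le_trans (eLpNorm_mono_real fun x => ?_) h2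
    simpa using h x
  have h3 : ∀ i ∈ s, eLpNorm (fun x => c i * ‖χ i x‖) 2 (volume : Measure (Space n))
      = ENNReal.ofReal (c i * ‖toL2 (χ i)‖) := by
    intro i hi
    have h4 : (fun x => c i * ‖χ i x‖) = c i • (fun x => ‖χ i x‖) := rfl
    rw [h4, eLpNorm_const_smul, eLpNorm_norm, ENNReal.ofReal_mul (hc i hi), SchwartzMap.norm_toLp,
      ENNReal.ofReal_toReal ((χ i).memLp 2 volume).eLpNorm_ne_top, Real.enorm_eq_ofReal (hc i hi)]
  rw [SchwartzMap.norm_toLp]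
  refine ENNReal.toReal_le_of_le_ofReal
    (Finset.sum_nonneg fun i hi => mul_nonneg (hc i hi) (norm_nonneg _)) ?_
  rw [ENNReal.ofReal_sum_of_nonneg fun i hi => mul_nonneg (hc i hi) (norm_nonneg _)]
  exact h1.trans (le_of_eq (Finset.sum_congr rfl h3))

theorem norm_toL2_le (φ χ : 𝓢(Space n, ℂ)) (c : ℝ) (hc : 0 ≤ c)
    (h : ∀ x, ‖φ x‖ ≤ c * ‖χ x‖) : ‖toL2 φ‖ ≤ c * ‖toL2 χ‖ := by
  simpa using norm_toL2_le_sum (Finset.univ : Finset (Fin 1)) (fun _ => c) φ (fun _ => χ)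
    (by simpa using hc) (by simpa using h)

theorem norm_toL2_le_add (φ χ ψ : 𝓢(Space n, ℂ)) (c d : ℝ) (hc : 0 ≤ c) (hd : 0 ≤ d)
    (h : ∀ x, ‖φ x‖ ≤ c * ‖χ x‖ + d * ‖ψ x‖) :
    ‖toL2 φ‖ ≤ c * ‖toL2 χ‖ + d * ‖toL2 ψ‖ := by
  have := norm_toL2_le_sum (Finset.univ : Finset (Fin 2)) ![c, d] φ ![χ, ψ]
    (by intro i _; fin_cases i <;> simpa) (by simpa [Fin.sum_univ_two] using h)
  simpa [Fin.sum_univ_two] using this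

theorem norm_toL2_le_of_support (φ : 𝓢(Space n, ℂ)) {K : Set (Space n)} (hK : IsCompact K)
    (M : ℝ) (hM : 0 ≤ M) (h : ∀ x, ‖φ x‖ ≤ M) (h0 : ∀ x ∉ K, φ x = 0) :
    ‖toL2 φ‖ ≤ M * (volume.real K) ^ (1 / 2 : ℝ) := by
  have hi : ∫ x, ‖φ x‖ ^ (2 : ℝ) ≤ M ^ (2 : ℝ) * volume.real K := by
    have h1 : ∫ x, ‖φ x‖ ^ (2 : ℝ) = ∫ x in K, ‖φ x‖ ^ (2 : ℝ) := by
      rw [setIntegral_eq_integral_of_forall_compl_eq_zero]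
      intro x hx
      simp [h0 x hx]
    rw [h1]
    have h2 : ‖∫ x in K, ‖φ x‖ ^ (2 : ℝ)‖ ≤ M ^ (2 : ℝ) * volume.real K := by
      refine norm_setIntegral_le_of_norm_le_const hK.measure_lt_top fun x _ => ?_
      rw [Real.norm_of_nonneg (by positivity)]
      exact Real.rpow_le_rpow (norm_nonneg _) (h x) (by norm_num)
    exact (le_abs_self _).trans h2
  rw [SchwartzMap.norm_toLp' (by norm_num) (by norm_num)]
  simp only [ENNReal.toReal_ofNat]
  calc (∫ x, ‖φ x‖ ^ (2 : ℝ)) ^ (2 : ℝ)⁻¹ ≤ (M ^ (2 : ℝ) * volume.real K) ^ (2 : ℝ)⁻¹ :=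
        Real.rpow_le_rpow (integral_nonneg fun x => by positivity) hi (by norm_num)
    _ = M * (volume.real K) ^ (1 / 2 : ℝ) := by
        rw [Real.mul_rpow (by positivity) (by positivity), ← Real.rpow_mul hM]
        norm_num

theorem norm_toL2_twist {a : Space n → ℝ} (ha : Function.HasTemperateGrowth a)
    (φ : 𝓢(Space n, ℂ)) : ‖toL2 (twist a φ)‖ = ‖toL2 φ‖ := by
  refine le_antisymm ?_ ?_
  · simpa using norm_toL2_le (twist a φ) φ 1 zero_le_one fun x => by rw [norm_twist_apply ha, one_mul]
  · simpa using norm_toL2_le φ (twist a φ) 1 zero_le_one fun x => by rw [norm_twist_apply ha, one_mul]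

theorem norm_toL2_fourierInv (f : 𝓢(Space n, ℂ)) : ‖toL2 (𝓕⁻ f)‖ = ‖toL2 f‖ := by
  have := SchwartzMap.norm_fourier_toL2_eq (𝓕⁻ f)
  rw [FourierTransform.fourier_fourierInv_eq] at this
  exact this.symm

theorem norm_cexp_I_mul_sub_one_sub_le (r : ℝ) :
    ‖Complex.exp (Complex.I * (r : ℂ)) - 1 - Complex.I * (r : ℂ)‖ ≤ 2 * |r| ^ 2 := by
  have hn : ‖Complex.I * (r : ℂ)‖ = |r| := by simp
  -- Taylor for |r| ≤ 1; for |r| ≥ 1 the crude bound 2|r| is at most 2|r|².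
  rcases le_total |r| 1 with h | h
  · have := Complex.norm_exp_sub_one_sub_id_le (x := Complex.I * (r : ℂ)) (by rwa [hn])
    rw [hn] at this
    nlinarith [sq_nonneg |r|]
  · have h1 := Real.norm_exp_I_mul_ofReal_sub_one_le (x := r)
    have h2 := norm_sub_le (Complex.exp (Complex.I * (r : ℂ)) - 1) (Complex.I * (r : ℂ))
    rw [hn] at h2
    rw [Real.norm_eq_abs] at h1
    nlinarith

end Twist

/-! ### Differentiating x-dependent phases along curves of parameters. -/

section PhaseDerivative

variable {n : ℕ} {F : Type*} [NormedAddCommGroup F] [NormedSpace ℝ F]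

/-- A family of phases `x ↦ P x h`, linear in `h` and at most quadratic in `x`. -/
structure IsPhaseFamily (P : Space n → F →L[ℝ] ℝ) (C : ℝ) : Prop where
  temperate : ∀ h, Function.HasTemperateGrowth (fun x => P x h)
  bound : ∀ x, ‖P x‖ ≤ C * (1 + ‖x‖ ^ 2)

theorem IsPhaseFamily.abs_le {P : Space n → F →L[ℝ] ℝ} {C : ℝ} (hP : IsPhaseFamily P C)
    (x : Space n) (h : F) : |P x h| ≤ ‖h‖ * (C * (1 + ‖x‖ ^ 2)) := by
  have := (P x).le_opNorm h
  rw [Real.norm_eq_abs] at this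
  calc |P x h| ≤ ‖P x‖ * ‖h‖ := this
    _ ≤ (C * (1 + ‖x‖ ^ 2)) * ‖h‖ := by gcongr; exact hP.bound x
    _ = _ := mul_comm _ _

/-- Multiplication by `C (1 + |x|²)`. -/
def quadWeight (C : ℝ) (φ : 𝓢(Space n, ℂ)) : 𝓢(Space n, ℂ) :=
  SchwartzMap.smulLeftCLM ℂ (fun x : Space n => C * (1 + ‖x‖ ^ 2)) φ

theorem quadWeight_apply (C : ℝ) (φ : 𝓢(Space n, ℂ)) (x : Space n) :
    quadWeight C φ x = ((C * (1 + ‖x‖ ^ 2) : ℝ) : ℂ) * φ x := by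
  have : Function.HasTemperateGrowth (fun x : Space n => C * (1 + ‖x‖ ^ 2)) := by fun_prop
  rw [quadWeight, SchwartzMap.smulLeftCLM_apply_apply this]
  simp

theorem IsPhaseFamily.abs_mul_norm_le {P : Space n → F →L[ℝ] ℝ} {C : ℝ} (hP : IsPhaseFamily P C)
    (φ : 𝓢(Space n, ℂ)) (x : Space n) (h : F) : |P x h| * ‖φ x‖ ≤ ‖h‖ * ‖quadWeight C φ x‖ := by
  rw [quadWeight_apply, norm_mul, ← mul_assoc, Complex.norm_real, Real.norm_eq_abs]
  refine mul_le_mul_of_nonneg_right ?_ (norm_nonneg _)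
  refine (hP.abs_le x h).trans ?_
  gcongr
  exact le_abs_self _

/-- Multiplication by `i P(x) h`. -/
def phaseMul (P : Space n → F →L[ℝ] ℝ) (h : F) (φ : 𝓢(Space n, ℂ)) : 𝓢(Space n, ℂ) :=
  Complex.I • SchwartzMap.smulLeftCLM ℂ (fun x => P x h) φ

theorem IsPhaseFamily.phaseMul_apply {P : Space n → F →L[ℝ] ℝ} {C : ℝ} (hP : IsPhaseFamily P C)
    (h : F) (φ : 𝓢(Space n, ℂ)) (x : Space n) :
    phaseMul P h φ x = Complex.I * (P x h : ℂ) * φ x := by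
  simp [phaseMul, SchwartzMap.smulLeftCLM_apply_apply (hP.temperate h), mul_assoc]

theorem IsPhaseFamily.norm_twist_sub_le {P : Space n → F →L[ℝ] ℝ} {C : ℝ}
    (hP : IsPhaseFamily P C) (a b : F) (φ : 𝓢(Space n, ℂ)) :
    ‖toL2 (twist (fun x => P x a) φ) - toL2 (twist (fun x => P x b) φ)‖
      ≤ ‖a - b‖ * ‖toL2 (quadWeight C φ)‖ := by
  rw [← toL2_sub]
  refine norm_toL2_le _ _ _ (norm_nonneg _) fun x => ?_
  rw [sub_apply, twist_apply (hP.temperate a), twist_apply (hP.temperate b)]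
  have h1 : Complex.exp (Complex.I * (P x a : ℂ)) * φ x - Complex.exp (Complex.I * (P x b : ℂ)) * φ x
      = Complex.exp (Complex.I * (P x b : ℂ)) *
        ((Complex.exp (Complex.I * (P x (a - b) : ℂ)) - 1) * φ x) := by
    have : Complex.exp (Complex.I * (P x a : ℂ)) =
        Complex.exp (Complex.I * (P x b : ℂ)) * Complex.exp (Complex.I * (P x (a - b) : ℂ)) := by
      rw [← Complex.exp_add, map_sub]
      congr 1
      push_cast
      ring
    rw [this]
    ring
  rw [h1, norm_mul, norm_mul, Complex.norm_exp_I_mul_ofReal, one_mul]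
  refine le_trans ?_ (hP.abs_mul_norm_le φ x (a - b))
  gcongr
  exact Real.norm_exp_I_mul_ofReal_sub_one_le

theorem IsPhaseFamily.continuous_twist {P : Space n → F →L[ℝ] ℝ} {C : ℝ}
    (hP : IsPhaseFamily P C) (φ : 𝓢(Space n, ℂ)) :
    Continuous (fun a : F => toL2 (twist (fun x => P x a) φ)) := by
  refine (LipschitzWith.of_dist_le_mul (K := ‖toL2 (quadWeight C φ)‖₊) fun a b => ?_).continuous
  rw [dist_eq_norm, dist_eq_norm, mul_comm]
  exact hP.norm_twist_sub_le a b φ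

/-- Second order Taylor expansion of the exponential. The direction `c` is kept apart from `a - b`
so that along a curve it can be the linear part of the increment; the difference is then the small
remainder of the curve. -/
theorem IsPhaseFamily.norm_twist_sub_sub_le {P : Space n → F →L[ℝ] ℝ} {C : ℝ}
    (hP : IsPhaseFamily P C) (a b c : F) (φ : 𝓢(Space n, ℂ)) :
    ‖toL2 (twist (fun x => P x a) φ) - toL2 (twist (fun x => P x b) φ)
        - toL2 (twist (fun x => P x b) (phaseMul P c φ))‖
      ≤ (2 * ‖a - b‖ ^ 2) * ‖toL2 (quadWeight C (quadWeight C φ))‖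
        + ‖a - b - c‖ * ‖toL2 (quadWeight C φ)‖ := by
  rw [← toL2_sub, ← toL2_sub]
  refine norm_toL2_le_add _ _ _ _ _ (by positivity) (norm_nonneg _) fun x => ?_
  rw [sub_apply, sub_apply, twist_apply (hP.temperate a),
    twist_apply (hP.temperate b), twist_apply (hP.temperate b), hP.phaseMul_apply]
  have h1 : Complex.exp (Complex.I * (P x a : ℂ)) * φ x - Complex.exp (Complex.I * (P x b : ℂ)) * φ x
        - Complex.exp (Complex.I * (P x b : ℂ)) * (Complex.I * (P x c : ℂ) * φ x)
      = Complex.exp (Complex.I * (P x b : ℂ)) *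
        ((Complex.exp (Complex.I * (P x (a - b) : ℂ)) - 1 - Complex.I * (P x (a - b) : ℂ)) * φ x
          + Complex.I * (P x (a - b - c) : ℂ) * φ x) := by
    have : Complex.exp (Complex.I * (P x a : ℂ)) =
        Complex.exp (Complex.I * (P x b : ℂ)) * Complex.exp (Complex.I * (P x (a - b) : ℂ)) := by
      rw [← Complex.exp_add, map_sub]
      congr 1
      push_cast
      ring
    rw [this, map_sub _ (a - b) c]
    push_cast
    ring
  rw [h1, norm_mul, Complex.norm_exp_I_mul_ofReal, one_mul]
  refine (norm_add_le _ _).trans (add_le_add ?_ ?_)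
  · rw [norm_mul]
    have h2 := hP.abs_mul_norm_le (quadWeight C φ) x (a - b)
    have h3 := hP.abs_mul_norm_le φ x (a - b)
    calc _ ≤ (2 * |P x (a - b)| ^ 2) * ‖φ x‖ := by
          gcongr; exact norm_cexp_I_mul_sub_one_sub_le _
      _ = 2 * (|P x (a - b)| * (|P x (a - b)| * ‖φ x‖)) := by ring
      _ ≤ 2 * (|P x (a - b)| * (‖a - b‖ * ‖quadWeight C φ x‖)) := by gcongr
      _ = 2 * (‖a - b‖ * (|P x (a - b)| * ‖quadWeight C φ x‖)) := by ring
      _ ≤ 2 * (‖a - b‖ * (‖a - b‖ * ‖quadWeight C (quadWeight C φ) x‖)) := by gcongr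
      _ = _ := by ring
  · rw [norm_mul, norm_mul, Complex.norm_I, one_mul, Complex.norm_real, Real.norm_eq_abs]
    exact hP.abs_mul_norm_le φ x (a - b - c)

theorem IsPhaseFamily.phaseMul_smul {P : Space n → F →L[ℝ] ℝ} {C : ℝ}
    (hP : IsPhaseFamily P C) (r : ℝ) (h : F) (φ : 𝓢(Space n, ℂ)) :
    phaseMul P (r • h) φ = (r : ℂ) • phaseMul P h φ := by
  ext x
  rw [smul_apply, hP.phaseMul_apply, hP.phaseMul_apply, map_smul]
  simp only [smul_eq_mul]
  push_cast
  ring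

theorem twist_smul (a : Space n → ℝ) (c : ℂ) (φ : 𝓢(Space n, ℂ)) :
    twist a (c • φ) = c • twist a φ := map_smul _ _ _

theorem twist_sub (a : Space n → ℝ) (φ ψ : 𝓢(Space n, ℂ)) :
    twist a (φ - ψ) = twist a φ - twist a ψ := map_sub _ _ _

theorem twist_add (a : Space n → ℝ) (φ ψ : 𝓢(Space n, ℂ)) :
    twist a (φ + ψ) = twist a φ + twist a ψ := map_add _ _ _

/-- Product rule. Phases are unbounded functions of x, so differentiating them costs weights, but
these fall only on the fixed functions `χ t` and `χ'`; the remainder of `χ` is multiplied by a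
unimodular phase, hence L² differentiability of `χ` is enough. -/
theorem IsPhaseFamily.hasDerivAt_twist_comp {P : Space n → F →L[ℝ] ℝ} {C : ℝ}
    (hP : IsPhaseFamily P C) {β : ℝ → F} {β' : F} {t : ℝ} (hβ : HasDerivAt β β' t)
    {χ : ℝ → 𝓢(Space n, ℂ)} {χ' : 𝓢(Space n, ℂ)}
    (hχ : HasDerivAt (fun r => toL2 (χ r)) (toL2 χ') t) :
    HasDerivAt (fun r => toL2 (twist (fun x => P x (β r)) (χ r)))
      (toL2 (twist (fun x => P x (β t)) (phaseMul P β' (χ t) + χ'))) t := by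
  rw [hasDerivAt_iff_isLittleO] at hχ ⊢
  have hβ1 := hasDerivAt_iff_isLittleO.1 hβ
  have hβ2 : (fun r => β r - β t) =O[𝓝 t] fun r => r - t := hβ.isBigO_sub
  have e1 : (fun r => toL2 (twist (fun x => P x (β r)) (χ r - χ t - ((r - t : ℝ) : ℂ) • χ')))
      =o[𝓝 t] fun r => r - t := by
    refine Asymptotics.IsBigO.trans_isLittleO
      (Asymptotics.IsBigO.of_bound 1 (Eventually.of_forall fun r => ?_)) hχ
    rw [norm_toL2_twist (hP.temperate _), one_mul]
    rfl
  have e2 : (fun r => ((r - t : ℝ) : ℂ) • (toL2 (twist (fun x => P x (β r)) χ')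
      - toL2 (twist (fun x => P x (β t)) χ'))) =o[𝓝 t] fun r => r - t := by
    have h1 : (fun r => toL2 (twist (fun x => P x (β r)) χ')
        - toL2 (twist (fun x => P x (β t)) χ')) =o[𝓝 t] fun _ => (1 : ℝ) := by
      rw [Asymptotics.isLittleO_one_iff]
      have := ((hP.continuous_twist χ').continuousAt.comp (x := t) hβ.continuousAt).sub_const
        (toL2 (twist (fun x => P x (β t)) χ'))
      simpa [ContinuousAt] using this
    have h2 : (fun r : ℝ => ((r - t : ℝ) : ℂ)) =O[𝓝 t] fun r => r - t :=
      Asymptotics.IsBigO.of_bound 1 (Eventually.of_forall fun r => by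
        rw [Complex.norm_real, one_mul])
    simpa using h2.smul_isLittleO h1
  have e3 : (fun r => toL2 (twist (fun x => P x (β r)) (χ t))
      - toL2 (twist (fun x => P x (β t)) (χ t))
      - toL2 (twist (fun x => P x (β t)) (phaseMul P ((r - t) • β') (χ t))))
      =o[𝓝 t] fun r => r - t := by
    have h1 : (fun r => (2 * ‖β r - β t‖ ^ 2) * ‖toL2 (quadWeight C (quadWeight C (χ t)))‖
        + ‖β r - β t - (r - t) • β'‖ * ‖toL2 (quadWeight C (χ t))‖) =o[𝓝 t] fun r => r - t := by
      refine Asymptotics.IsLittleO.add ?_ ?_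
      · have h2 : (fun r => ‖β r - β t‖ ^ 2) =o[𝓝 t] fun r => r - t := by
          have h3 : (fun r => ‖β r - β t‖ ^ 2) =O[𝓝 t] fun r => (r - t) ^ 2 := hβ2.norm_left.pow 2
          refine h3.trans_isLittleO ?_
          have h4 : (fun r : ℝ => r - t) =o[𝓝 t] fun _ => (1 : ℝ) := by
            rw [Asymptotics.isLittleO_one_iff]
            have : ContinuousAt (fun r : ℝ => r - t) t := by fun_prop
            simpa [ContinuousAt] using this
          have h5 := (Asymptotics.isBigO_refl (fun r : ℝ => r - t) (𝓝 t)).mul_isLittleO h4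
          simpa [sq] using h5
        have h6 := h2.const_mul_left (2 * ‖toL2 (quadWeight C (quadWeight C (χ t)))‖)
        refine h6.congr_left fun r => by ring
      · have h6 := hβ1.norm_left.const_mul_left ‖toL2 (quadWeight C (χ t))‖
        refine h6.congr_left fun r => by ring
    refine Asymptotics.IsBigO.trans_isLittleO ?_ h1
    refine Asymptotics.IsBigO.of_bound 1 (Eventually.of_forall fun r => ?_)
    rw [one_mul, Real.norm_of_nonneg (by positivity)]
    exact hP.norm_twist_sub_sub_le _ _ _ _
  refine ((e1.add e2).add e3).congr_left fun r => ?_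
  rw [hP.phaseMul_smul, twist_add, twist_sub, twist_sub, twist_smul, twist_smul]
  simp only [toL2_add, toL2_sub, toL2_smul]
  have : ∀ v : L2 n, (r - t) • v = ((r - t : ℝ) : ℂ) • v := fun v => (Complex.coe_smul (r - t) v).symm
  rw [this]
  module

end PhaseDerivative

/-! ### The free evolution in Fourier space and its position and momentum operators. -/

section FreeEvolution

variable {n : ℕ}

theorem lineDeriv_twist_apply {a : Space n → ℝ} (ha : Function.HasTemperateGrowth a)
    {a' : Space n →L[ℝ] ℝ} {x : Space n} (hd : HasFDerivAt a a' x) (f : 𝓢(Space n, ℂ))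
    (m : Space n) :
    (∂_{m} (twist a f)) x
      = Complex.exp (Complex.I * (a x : ℂ)) * ((∂_{m} f) x + Complex.I * (a' m : ℂ) * f x) := by
  rw [SchwartzMap.lineDerivOp_apply_eq_fderiv, SchwartzMap.lineDerivOp_apply_eq_fderiv]
  have h0 : ⇑(twist a f) = fun x => Complex.exp (Complex.I * (a x : ℂ)) * f x :=
    funext fun x => twist_apply ha f x
  have h1 : HasFDerivAt (fun x => Complex.I * (a x : ℂ))
      (Complex.I • Complex.ofRealCLM.comp a') x :=
    (Complex.ofRealCLM.hasFDerivAt.comp x hd).const_mul Complex.I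
  have h2 := h1.cexp.mul (f.hasFDerivAt x)
  rw [h0]
  erw [h2.fderiv]
  simp
  ring

/-- The phases `e^{i b·x}`. -/
def momentumPhase (x : Space n) : Space n →L[ℝ] ℝ := innerSL ℝ x

theorem momentumPhase_apply (x b : Space n) : momentumPhase x b = inner ℝ x b := rfl

theorem isPhaseFamily_momentumPhase : IsPhaseFamily (momentumPhase (n := n)) 1 where
  temperate h := by
    change Function.HasTemperateGrowth fun x : Space n => inner ℝ x h
    fun_prop
  bound x := by
    rw [momentumPhase, innerSL_apply_norm]
    nlinarith [sq_nonneg (‖x‖ - 1), norm_nonneg x]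

/-- The phases `e^{-i (2π² t |ξ|² + 2π y·ξ + κ)}`. -/
def freePhase (ξ : Space n) : (ℝ × Space n × ℝ) →L[ℝ] ℝ :=
  -((2 * Real.pi ^ 2 * ‖ξ‖ ^ 2) • ContinuousLinearMap.fst ℝ ℝ (Space n × ℝ)
    + (2 * Real.pi) • (innerSL ℝ ξ).comp
      ((ContinuousLinearMap.fst ℝ (Space n) ℝ).comp (ContinuousLinearMap.snd ℝ ℝ (Space n × ℝ)))
    + (ContinuousLinearMap.snd ℝ (Space n) ℝ).comp (ContinuousLinearMap.snd ℝ ℝ (Space n × ℝ)))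

theorem freePhase_apply (ξ : Space n) (z : ℝ × Space n × ℝ) :
    freePhase ξ z = -(2 * Real.pi ^ 2 * ‖ξ‖ ^ 2 * z.1 + 2 * Real.pi * inner ℝ ξ z.2.1 + z.2.2) := by
  simp [freePhase]

theorem isPhaseFamily_freePhase :
    IsPhaseFamily (freePhase (n := n)) (2 * Real.pi ^ 2 + 2 * Real.pi + 1) where
  temperate z := by
    simp only [freePhase_apply]
    fun_prop
  bound ξ := by
    refine ContinuousLinearMap.opNorm_le_bound _ (by positivity) fun z => ?_
    rw [freePhase_apply, norm_neg]
    have h1 : |z.1| ≤ ‖z‖ := norm_fst_le z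
    have h2 : ‖z.2.1‖ ≤ ‖z‖ := (norm_fst_le z.2).trans (norm_snd_le z)
    have h3 : |z.2.2| ≤ ‖z‖ := (norm_snd_le z.2).trans (norm_snd_le z)
    have h4 : |inner ℝ ξ z.2.1| ≤ ‖ξ‖ * ‖z‖ :=
      (abs_real_inner_le_norm _ _).trans (by gcongr)
    have hpi := Real.pi_pos
    have h5 : ‖ξ‖ ≤ 1 + ‖ξ‖ ^ 2 := by nlinarith [sq_nonneg (‖ξ‖ - 1), norm_nonneg ξ]
    calc ‖2 * Real.pi ^ 2 * ‖ξ‖ ^ 2 * z.1 + 2 * Real.pi * inner ℝ ξ z.2.1 + z.2.2‖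
        ≤ 2 * Real.pi ^ 2 * ‖ξ‖ ^ 2 * |z.1| + 2 * Real.pi * |inner ℝ ξ z.2.1| + |z.2.2| := by
          refine (norm_add_le _ _).trans (add_le_add ((norm_add_le _ _).trans (le_of_eq ?_)) le_rfl)
          rw [norm_mul, norm_mul (2 * Real.pi),
            Real.norm_of_nonneg (by positivity : 0 ≤ 2 * Real.pi ^ 2 * ‖ξ‖ ^ 2),
            Real.norm_of_nonneg (by positivity : 0 ≤ 2 * Real.pi)]
          rfl
      _ ≤ 2 * Real.pi ^ 2 * (1 + ‖ξ‖ ^ 2) * ‖z‖ + 2 * Real.pi * ((1 + ‖ξ‖ ^ 2) * ‖z‖)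
          + (1 + ‖ξ‖ ^ 2) * ‖z‖ := by
          have h6 : ‖ξ‖ ^ 2 ≤ 1 + ‖ξ‖ ^ 2 := by linarith
          have h7 : (1 : ℝ) ≤ 1 + ‖ξ‖ ^ 2 := by nlinarith [sq_nonneg ‖ξ‖]
          have h8 : |z.2.2| ≤ (1 + ‖ξ‖ ^ 2) * ‖z‖ := by nlinarith [norm_nonneg z]
          have h9 : |inner ℝ ξ z.2.1| ≤ (1 + ‖ξ‖ ^ 2) * ‖z‖ := h4.trans (by gcongr)
          gcongr
      _ = _ := by ring

/-- The free evolution `e^{-i κ} e^{-i y·p} e^{-i t p²/2} 𝓕⁻ f` for `z = (t, y, κ)`. -/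
def freeEvol (z : ℝ × Space n × ℝ) (f : 𝓢(Space n, ℂ)) : 𝓢(Space n, ℂ) :=
  𝓕⁻ (twist (fun ξ => freePhase ξ z) f)

theorem fourierInv_add' (f g : 𝓢(Space n, ℂ)) : 𝓕⁻ (f + g) = 𝓕⁻ f + 𝓕⁻ g :=
  FourierTransform.fourierInv_add f g

theorem fourierInv_smul' (c : ℂ) (g : 𝓢(Space n, ℂ)) : 𝓕⁻ (c • g) = c • 𝓕⁻ g :=
  FourierTransform.fourierInv_smul c g

theorem freeEvol_add (z : ℝ × Space n × ℝ) (f g : 𝓢(Space n, ℂ)) :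
    freeEvol z (f + g) = freeEvol z f + freeEvol z g := by
  rw [freeEvol, twist_add, fourierInv_add']; rfl

theorem freeEvol_smul (z : ℝ × Space n × ℝ) (c : ℂ) (f : 𝓢(Space n, ℂ)) :
    freeEvol z (c • f) = c • freeEvol z f := by
  rw [freeEvol, twist_smul, fourierInv_smul']; rfl

theorem freeEvol_sub (z : ℝ × Space n × ℝ) (f g : 𝓢(Space n, ℂ)) :
    freeEvol z (f - g) = freeEvol z f - freeEvol z g := by
  have := freeEvol_add z (f - g) g
  rw [sub_add_cancel] at this
  rw [this, add_sub_cancel_right]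

theorem norm_toL2_freeEvol (z : ℝ × Space n × ℝ) (f : 𝓢(Space n, ℂ)) :
    ‖toL2 (freeEvol z f)‖ = ‖toL2 f‖ := by
  rw [freeEvol, norm_toL2_fourierInv, norm_toL2_twist (isPhaseFamily_freePhase.temperate z)]

theorem toL2_freeEvol_sub_le (z z' : ℝ × Space n × ℝ) (f : 𝓢(Space n, ℂ)) :
    ‖toL2 (freeEvol z f) - toL2 (freeEvol z' f)‖
      ≤ ‖z - z'‖ * ‖toL2 (quadWeight (2 * Real.pi ^ 2 + 2 * Real.pi + 1) f)‖ := by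
  refine le_trans (le_of_eq ?_) (isPhaseFamily_freePhase.norm_twist_sub_le z z' f)
  rw [← toL2_sub, ← toL2_sub, ← norm_toL2_fourierInv (twist _ _ - twist _ _)]
  congr 2
  exact (map_sub (FourierTransform.fourierCLE ℂ 𝓢(Space n, ℂ)).symm _ _).symm

theorem continuous_toL2_freeEvol (f : 𝓢(Space n, ℂ)) :
    Continuous (fun z => toL2 (freeEvol z f)) := by
  refine (LipschitzWith.of_dist_le_mul
    (K := ‖toL2 (quadWeight (2 * Real.pi ^ 2 + 2 * Real.pi + 1) f)‖₊) fun a b => ?_).continuous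
  rw [dist_eq_norm, dist_eq_norm, mul_comm]
  exact toL2_freeEvol_sub_le a b f

theorem hasDerivAt_toL2_fourierInv {χ : ℝ → 𝓢(Space n, ℂ)} {χ' : 𝓢(Space n, ℂ)} {t : ℝ}
    (h : HasDerivAt (fun r => toL2 (χ r)) (toL2 χ') t) :
    HasDerivAt (fun r => toL2 (𝓕⁻ (χ r))) (toL2 (𝓕⁻ χ')) t := by
  have h1 : ∀ f : 𝓢(Space n, ℂ), toL2 (𝓕⁻ f)
      = (((Lp.fourierTransformₗᵢ (Space n) ℂ).symm.toContinuousLinearEquiv :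
        L2 n →L[ℂ] L2 n).restrictScalars ℝ) (toL2 f) := fun f =>
    (SchwartzMap.toLp_fourierInv_eq f).symm
  simp only [h1]
  exact (ContinuousLinearMap.hasFDerivAt _).comp_hasDerivAt t h

theorem hasDerivAt_toL2_freeEvol {β : ℝ → ℝ × Space n × ℝ} {β' : ℝ × Space n × ℝ} {t : ℝ}
    (hβ : HasDerivAt β β' t) (f : 𝓢(Space n, ℂ)) :
    HasDerivAt (fun r => toL2 (freeEvol (β r) f))
      (toL2 (freeEvol (β t) (phaseMul freePhase β' f))) t := by
  have h0 : HasDerivAt (fun _ : ℝ => toL2 f) (toL2 (0 : 𝓢(Space n, ℂ))) t := by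
    have : toL2 (0 : 𝓢(Space n, ℂ)) = 0 := map_zero (SchwartzMap.toLpCLM ℂ ℂ 2 volume)
    rw [this]
    exact hasDerivAt_const t _
  have := isPhaseFamily_freePhase.hasDerivAt_twist_comp (χ := fun _ => f) hβ h0
  rw [add_zero] at this
  exact hasDerivAt_toL2_fourierInv this

/-- Multiplication by `m·x`. -/
def coordMul (m : Space n) (φ : 𝓢(Space n, ℂ)) : 𝓢(Space n, ℂ) :=
  SchwartzMap.smulLeftCLM ℂ (inner ℝ · m) φ

theorem coordMul_apply (m : Space n) (φ : 𝓢(Space n, ℂ)) (x : Space n) :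
    coordMul m φ x = ((inner ℝ x m : ℝ) : ℂ) * φ x := by
  have : Function.HasTemperateGrowth (fun x : Space n => inner ℝ x m) := by fun_prop
  rw [coordMul, SchwartzMap.smulLeftCLM_apply_apply this]
  simp

/-- The position operator `m·x` in the representation given by `freeEvol z`. -/
def positionSymbol (z : ℝ × Space n × ℝ) (m : Space n) (f : 𝓢(Space n, ℂ)) : 𝓢(Space n, ℂ) :=
  (Complex.I / (2 * Real.pi) : ℂ) • ∂_{m} f + ((2 * Real.pi * z.1 : ℝ) : ℂ) • coordMul m f
    + ((inner ℝ z.2.1 m : ℝ) : ℂ) • f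

/-- Position is (i/2π)∂_m on the Fourier side. The derivative that hits the phase produces the
classical position 2πtξ + y, because p = 2πξ in this normalization. -/
theorem coordMul_freeEvol (z : ℝ × Space n × ℝ) (m : Space n) (f : 𝓢(Space n, ℂ)) :
    coordMul m (freeEvol z f) = freeEvol z (positionSymbol z m f) := by
  have h1 : ∂_{m} (twist (fun ξ => freePhase ξ z) f)
      = (-(2 * Real.pi * Complex.I) : ℂ) • twist (fun ξ => freePhase ξ z) (positionSymbol z m f) := by
    ext ξ
    have hd : HasFDerivAt (fun ξ : Space n => freePhase ξ z)
        (-((4 * Real.pi ^ 2 * z.1) • innerSL ℝ ξ + (2 * Real.pi) • innerSL ℝ z.2.1)) ξ := by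
      simp only [freePhase_apply]
      have e1 := ((hasStrictFDerivAt_norm_sq ξ).hasFDerivAt.const_mul (2 * Real.pi ^ 2)).mul_const z.1
      have e2 := ((innerSL ℝ z.2.1).hasFDerivAt (x := ξ)).const_mul (2 * Real.pi)
      have e3 := ((e1.add e2).add_const z.2.2).neg
      refine (e3.congr_fderiv ?_).congr_of_eventuallyEq (Eventually.of_forall fun x => ?_)
      · ext v
        simp
        ring
      · simp [real_inner_comm]
    rw [lineDeriv_twist_apply (isPhaseFamily_freePhase.temperate z) hd, smul_apply,
      twist_apply (isPhaseFamily_freePhase.temperate z), positionSymbol]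
    simp only [add_apply, smul_apply, smul_eq_mul, coordMul_apply, neg_apply,
      innerSL_apply_apply]
    have hpi : (Real.pi : ℂ) ≠ 0 := by exact_mod_cast Real.pi_ne_zero
    push_cast
    field_simp
    linear_combination ((∂_{m} f) ξ) * Complex.I_sq
  have h2 := SchwartzMap.fourierInv_lineDerivOp_eq (twist (fun ξ => freePhase ξ z) f) m
  rw [h1, fourierInv_smul'] at h2
  have hne : (-(2 * Real.pi * Complex.I) : ℂ) ≠ 0 := by
    simp [Real.pi_ne_zero, Complex.I_ne_zero]
  exact (smul_right_injective _ hne h2).symm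

theorem lineDeriv_twist_fourierInv (b m : Space n) (g : 𝓢(Space n, ℂ)) :
    ∂_{m} (twist (fun x => momentumPhase x b) (𝓕⁻ g))
      = twist (fun x => momentumPhase x b)
        (𝓕⁻ (Complex.I • ((2 * Real.pi : ℂ) • coordMul m g + ((inner ℝ b m : ℝ) : ℂ) • g))) := by
  ext x
  have hd : HasFDerivAt (fun x : Space n => momentumPhase x b) (innerSL ℝ b) x := by
    refine ((innerSL ℝ b).hasFDerivAt (x := x)).congr_of_eventuallyEq
      (Eventually.of_forall fun x => ?_)
    exact real_inner_comm b x
  rw [lineDeriv_twist_apply (isPhaseFamily_momentumPhase.temperate b) hd,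
    twist_apply (isPhaseFamily_momentumPhase.temperate b), SchwartzMap.lineDerivOp_fourierInv_eq,
    fourierInv_smul', fourierInv_smul', fourierInv_add', fourierInv_smul', fourierInv_smul']
  simp only [smul_apply, add_apply, smul_eq_mul, coordMul, innerSL_apply_apply]
  ring

end FreeEvolution

/-! ### Symmetry of the operators on Schwartz functions, and density. -/

section Symmetry

variable {n : ℕ}

theorem inner_toL2 (φ ψ : 𝓢(Space n, ℂ)) :
    inner ℂ (toL2 φ) (toL2 ψ) = ∫ x, ψ x * star (φ x) :=
  SchwartzMap.inner_toL2_toL2_eq φ ψ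

theorem inner_toL2_smulLeft {g : Space n → ℝ}
    (hg : Function.HasTemperateGrowth (fun x : Space n => ((g x : ℝ) : ℂ))) (φ ψ : 𝓢(Space n, ℂ)) :
    inner ℂ (toL2 (SchwartzMap.smulLeftCLM ℂ (fun x : Space n => ((g x : ℝ) : ℂ)) φ)) (toL2 ψ)
      = inner ℂ (toL2 φ)
        (toL2 (SchwartzMap.smulLeftCLM ℂ (fun x : Space n => ((g x : ℝ) : ℂ)) ψ)) := by
  rw [inner_toL2, inner_toL2]
  refine integral_congr_ae (Eventually.of_forall fun x => ?_)
  simp [SchwartzMap.smulLeftCLM_apply_apply hg]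
  ring

theorem inner_toL2_laplacian (φ ψ : 𝓢(Space n, ℂ)) :
    inner ℂ (toL2 (Δ φ)) (toL2 ψ) = inner ℂ (toL2 φ) (toL2 (Δ ψ)) := by
  rw [inner_toL2, inner_toL2]
  have := SchwartzMap.integral_bilinear_laplacian_right_eq_left (μ := volume) φ ψ
    ((ContinuousLinearMap.mul ℝ ℂ).comp (Complex.conjCLE : ℂ →L[ℝ] ℂ))
  simp only [ContinuousLinearMap.comp_apply, ContinuousLinearMap.mul_apply'] at this
  rw [eq_comm]
  simpa [mul_comm] using this

theorem inner_toL2_lineDeriv (φ ψ : 𝓢(Space n, ℂ)) (m : Space n) :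
    inner ℂ (toL2 (∂_{m} φ)) (toL2 ψ) = - inner ℂ (toL2 φ) (toL2 (∂_{m} ψ)) := by
  rw [inner_toL2, inner_toL2]
  have := SchwartzMap.integral_bilinear_lineDerivOp_right_eq_neg_left (μ := volume) φ ψ
    ((ContinuousLinearMap.mul ℝ ℂ).comp (Complex.conjCLE : ℂ →L[ℝ] ℂ)) m
  simp only [ContinuousLinearMap.comp_apply, ContinuousLinearMap.mul_apply'] at this
  rw [eq_comm, neg_eq_iff_eq_neg]
  simpa [mul_comm] using this

theorem inner_toL2_freeHamiltonian (E : ℝ → Space n) (t : ℝ) (φ ψ : 𝓢(Space n, ℂ)) :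
    inner ℂ (toL2 (freeHamiltonian E t φ)) (toL2 ψ)
      = inner ℂ (toL2 φ) (toL2 (freeHamiltonian E t ψ)) := by
  have h : Function.HasTemperateGrowth (fun x : Space n => ((inner ℝ (E t) x : ℝ) : ℂ)) := by
    fun_prop
  simp only [freeHamiltonian, toL2_sub, toL2_neg, toL2_smul, inner_sub_left, inner_sub_right,
    inner_neg_left, inner_neg_right, inner_smul_left, inner_smul_right, inner_toL2_smulLeft h,
    inner_toL2_laplacian]
  have h2 : (starRingEnd ℂ) (1 / 2) = 1 / 2 := by
    rw [show (1 / 2 : ℂ) = ((1 / 2 : ℝ) : ℂ) by norm_num, Complex.conj_ofReal]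
  rw [h2]

theorem denseRange_toL2 : DenseRange (fun φ : 𝓢(Space n, ℂ) => toL2 φ) :=
  SchwartzMap.denseRange_toLpCLM (by norm_num)

theorem eq_of_inner_toL2_eq {a b : L2 n}
    (h : ∀ ψ : 𝓢(Space n, ℂ), inner ℂ a (toL2 ψ) = inner ℂ b (toL2 ψ)) : a = b := by
  have h1 : (fun v : L2 n => inner ℂ a v) = fun v => inner ℂ b v :=
    (denseRange_toL2 (n := n)).equalizer (by fun_prop) (by fun_prop) (funext h)
  exact ext_inner_right ℂ fun v => congrFun h1 v

end Symmetry

/-! ### The free Hamiltonian acting on the Avron–Herbst ansatz. -/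

section AvronHerbst

variable {n : ℕ}

/-- The twist shifts the momentum 2πξ by b, so Δ has symbol -|2πξ + b|². This is twice `freePhase ξ`
evaluated at (1, b, |b|²/2), the velocity of the classical orbit. -/
theorem laplacian_twist_fourierInv (b : Space n) (g : 𝓢(Space n, ℂ)) :
    (Δ (twist (fun x => momentumPhase x b) (𝓕⁻ g)) : 𝓢(Space n, ℂ))
      = twist (fun x => momentumPhase x b) (𝓕⁻ ((-2 * Complex.I) •
          phaseMul freePhase (1, b, (1 / 2) * ‖b‖ ^ 2) g)) := by
  have hsum : ∀ (ι : Type) (s : Finset ι) (F : ι → 𝓢(Space n, ℂ)),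
      ∑ i ∈ s, twist (fun x => momentumPhase x b) (𝓕⁻ (F i))
        = twist (fun x => momentumPhase x b) (𝓕⁻ (∑ i ∈ s, F i)) := by
    intro ι s F
    have h1 : 𝓕⁻ (∑ i ∈ s, F i) = ∑ i ∈ s, 𝓕⁻ (F i) :=
      map_sum (FourierTransform.fourierCLE ℂ 𝓢(Space n, ℂ)).symm F s
    rw [h1, twist, map_sum]
    rfl
  rw [SchwartzMap.laplacian_eq_sum (EuclideanSpace.basisFun (Fin n) ℝ)]
  simp only [lineDeriv_twist_fourierInv]
  rw [hsum]
  congr 2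
  ext ξ
  simp only [FunLike.coe_sum, Finset.sum_apply, smul_apply, add_apply, coordMul_apply,
    smul_eq_mul, isPhaseFamily_freePhase.phaseMul_apply, freePhase_apply]
  have h2 : ∀ i : Fin n, inner ℝ ξ (EuclideanSpace.basisFun (Fin n) ℝ i) = ξ i := by
    intro i; simp [EuclideanSpace.inner_single_right]
  have h3 : ∀ i : Fin n, inner ℝ b (EuclideanSpace.basisFun (Fin n) ℝ i) = b i := by
    intro i; simp [EuclideanSpace.inner_single_right]
  simp only [h2, h3]
  have h4 : ‖ξ‖ ^ 2 = ∑ i, ξ i * ξ i := by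
    rw [EuclideanSpace.norm_sq_eq]; simp [sq]
  have h5 : ‖b‖ ^ 2 = ∑ i, b i * b i := by
    rw [EuclideanSpace.norm_sq_eq]; simp [sq]
  have h6 : inner ℝ ξ b = ∑ i, ξ i * b i := by
    simp [PiLp.inner_apply, mul_comm]
  rw [h4, h5, h6]
  push_cast
  simp only [Finset.mul_sum, Finset.sum_mul, mul_add, neg_mul, mul_neg, add_mul,
    ← Finset.sum_add_distrib, ← Finset.sum_neg_distrib]
  refine Finset.sum_congr rfl fun i _ => ?_
  ring_nf

/-- The right-hand side has the form that `IsPhaseFamily.hasDerivAt_twist_comp` gives along a curve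
with b' = E(t) and z' = (1, b, |b|²/2); this identifies the ansatz as a solution. -/
theorem freeHamiltonian_twist_freeEvol (E : ℝ → Space n) (t : ℝ) (b : Space n)
    (z : ℝ × Space n × ℝ) (f : 𝓢(Space n, ℂ)) :
    (-Complex.I) • freeHamiltonian E t (twist (fun x => momentumPhase x b) (freeEvol z f))
      = twist (fun x => momentumPhase x b) (phaseMul momentumPhase (E t) (freeEvol z f)
        + freeEvol z (phaseMul freePhase (1, b, (1 / 2) * ‖b‖ ^ 2) f)) := by
  have h1 : phaseMul freePhase (1, b, (1 / 2) * ‖b‖ ^ 2) (twist (fun ξ => freePhase ξ z) f)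
      = twist (fun ξ => freePhase ξ z) (phaseMul freePhase (1, b, (1 / 2) * ‖b‖ ^ 2) f) := by
    ext ξ
    rw [isPhaseFamily_freePhase.phaseMul_apply,
      twist_apply (isPhaseFamily_freePhase.temperate z),
      twist_apply (isPhaseFamily_freePhase.temperate z), isPhaseFamily_freePhase.phaseMul_apply]
    ring
  have h2 : Function.HasTemperateGrowth (fun x : Space n => ((inner ℝ (E t) x : ℝ) : ℂ)) := by
    fun_prop
  rw [freeHamiltonian, freeEvol, laplacian_twist_fourierInv, h1, fourierInv_smul', twist_smul,
    twist_add]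
  change _ = _ + twist _ (freeEvol z _)
  rw [freeEvol]
  ext x
  simp only [smul_apply, sub_apply, neg_apply, smul_eq_mul, add_apply,
    SchwartzMap.smulLeftCLM_apply_apply h2, twist_apply (isPhaseFamily_momentumPhase.temperate b),
    isPhaseFamily_momentumPhase.phaseMul_apply]
  simp only [momentumPhase_apply, real_inner_comm x (E t)]
  linear_combination (-Complex.exp (Complex.I * ((inner ℝ x b : ℝ) : ℂ)) *
    (𝓕⁻ (twist (fun ξ => freePhase ξ z) (phaseMul freePhase (1, b, (1 / 2) * ‖b‖ ^ 2) f))) x) * Complex.I_sq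

end AvronHerbst

/-! ### Classical orbits, the explicit free solution and its uniqueness. -/

section AvronHerbst

variable {n : ℕ}

theorem continuous_positionSymbol {X : Type*} [TopologicalSpace X] {z : X → ℝ × Space n × ℝ}
    (hz : Continuous z) {g : X → 𝓢(Space n, ℂ)} (hg : Continuous g) (m : Space n) :
    Continuous (fun x => positionSymbol (z x) m (g x)) := by
  have h1 : Continuous fun φ : 𝓢(Space n, ℂ) => ∂_{m} φ :=
    (LineDeriv.lineDerivOpCLM ℂ 𝓢(Space n, ℂ) m).continuous
  have h2 : Continuous fun φ : 𝓢(Space n, ℂ) => coordMul m φ :=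
    (SchwartzMap.smulLeftCLM ℂ (inner ℝ · m)).continuous
  unfold positionSymbol
  have h3 : Continuous fun x => ((2 * Real.pi * (z x).1 : ℝ) : ℂ) := by fun_prop
  have h4 : Continuous fun x => ((inner ℝ (z x).2.1 m : ℝ) : ℂ) := by fun_prop
  have h5 : Continuous fun x => (Complex.I / (2 * Real.pi) : ℂ) • ∂_{m} (g x) :=
    Continuous.const_smul (g := fun x => ∂_{m} (g x)) (h1.comp hg)
      (Complex.I / (2 * Real.pi) : ℂ)
  exact (h5.add (h3.smul (h2.comp hg))).add (h4.smul hg)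

/-- By `coordMul_freeEvol` the weight moves inside the isometric free evolution, so that continuity
in z of a weighted norm becomes continuity of an argument in the Schwartz topology. -/
theorem quadWeight_freeEvol (z : ℝ × Space n × ℝ) (f : 𝓢(Space n, ℂ)) :
    quadWeight 1 (freeEvol z f) = freeEvol z (f + ∑ i : Fin n,
      positionSymbol z (EuclideanSpace.single i 1)
        (positionSymbol z (EuclideanSpace.single i 1) f)) := by
  have hsum : freeEvol z (∑ i : Fin n, positionSymbol z (EuclideanSpace.single i 1)
        (positionSymbol z (EuclideanSpace.single i 1) f))
      = ∑ i : Fin n, freeEvol z (positionSymbol z (EuclideanSpace.single i 1)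
        (positionSymbol z (EuclideanSpace.single i 1) f)) :=
    map_sum (AddMonoidHom.mk' (freeEvol z) (freeEvol_add z)) _ _
  rw [freeEvol_add, hsum]
  simp only [← coordMul_freeEvol]
  ext x
  simp only [quadWeight_apply, add_apply, FunLike.coe_sum, Finset.sum_apply, coordMul_apply]
  have h2 : ∀ i : Fin n, inner ℝ x (EuclideanSpace.single i (1 : ℝ)) = x i := by
    intro i; simp [EuclideanSpace.inner_single_right]
  simp only [h2]
  have h4 : ‖x‖ ^ 2 = ∑ i, x i * x i := by
    rw [EuclideanSpace.norm_sq_eq]; simp [sq]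
  rw [h4]
  push_cast
  rw [one_mul, add_mul, one_mul, Finset.sum_mul]
  congr 1
  exact Finset.sum_congr rfl fun i _ => by ring

theorem continuous_norm_quadWeight_freeEvol {β : ℝ → ℝ × Space n × ℝ} (hβ : Continuous β)
    (f : 𝓢(Space n, ℂ)) :
    Continuous (fun t => ‖toL2 (quadWeight 1 (freeEvol (β t) f))‖) := by
  simp only [quadWeight_freeEvol, norm_toL2_freeEvol]
  refine (SchwartzMap.continuous_toLp.comp (continuous_const.add ?_)).norm
  exact continuous_finsetSum _ fun i _ =>
    continuous_positionSymbol hβ (continuous_positionSymbol hβ continuous_const _) _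

/-- The classical momentum at time `t`, with initial value `η` at time `s`. -/
def fieldMomentum (E : ℝ → Space n) (s : ℝ) (η : Space n) (t : ℝ) : Space n :=
  η + ∫ σ in s..t, E σ

/-- Time, classical displacement and action at time `t`. -/
def fieldOrbit (E : ℝ → Space n) (s : ℝ) (η : Space n) (t : ℝ) : ℝ × Space n × ℝ :=
  (t - s, ∫ σ in s..t, fieldMomentum E s η σ, ∫ σ in s..t, (1 / 2) * ‖fieldMomentum E s η σ‖ ^ 2)

theorem IsPeriodicField.intervalIntegrable {E : ℝ → Space n} (hE : IsPeriodicField E) (a b : ℝ) :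
    IntervalIntegrable E volume a b :=
  (hE.locallyIntegrable.integrableOn_isCompact isCompact_uIcc).intervalIntegrable

theorem hasACDeriv_fieldMomentum {E : ℝ → Space n} (hE : IsPeriodicField E) (s : ℝ)
    (η : Space n) : HasACDeriv (fieldMomentum E s η) E :=
  hasACDeriv_of_integral hE.intervalIntegrable fun _ => rfl

theorem hasDerivAt_fieldOrbit {E : ℝ → Space n} (hE : IsPeriodicField E) (s : ℝ) (η : Space n)
    (t : ℝ) : HasDerivAt (fieldOrbit E s η)
      (1, fieldMomentum E s η t, (1 / 2) * ‖fieldMomentum E s η t‖ ^ 2) t := by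
  have hc := (hasACDeriv_fieldMomentum hE s η).continuous
  have h1 : HasDerivAt (fun t : ℝ => t - s) 1 t := (hasDerivAt_id t).sub_const s
  have h2 := (hc.integral_hasStrictDerivAt s t).hasDerivAt
  have h3 := (Continuous.integral_hasStrictDerivAt
    (f := fun σ => (1 / 2) * ‖fieldMomentum E s η σ‖ ^ 2) (by fun_prop) s t).hasDerivAt
  exact h1.prodMk (h2.prodMk h3)

theorem continuous_fieldOrbit {E : ℝ → Space n} (hE : IsPeriodicField E) (s : ℝ) (η : Space n) :
    Continuous (fieldOrbit E s η) :=
  continuous_iff_continuousAt.2 fun t => (hasDerivAt_fieldOrbit hE s η t).continuousAt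

theorem fieldOrbit_self (E : ℝ → Space n) (s : ℝ) (η : Space n) : fieldOrbit E s η s = 0 := by
  simp [fieldOrbit]

theorem freeEvol_zero (f : 𝓢(Space n, ℂ)) : freeEvol 0 f = 𝓕⁻ f := by
  rw [freeEvol]
  congr 1
  ext ξ
  rw [twist_apply (isPhaseFamily_freePhase.temperate 0)]
  simp

/-- The free solution with initial value `e^{i η·x} 𝓕⁻ f` at time `s`. -/
def freeSolution (E : ℝ → Space n) (s : ℝ) (η : Space n) (f : 𝓢(Space n, ℂ)) (t : ℝ) :
    𝓢(Space n, ℂ) :=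
  twist (fun x => momentumPhase x (fieldMomentum E s η t)) (freeEvol (fieldOrbit E s η t) f)

theorem freeSolution_self (E : ℝ → Space n) (s : ℝ) (η : Space n) (f : 𝓢(Space n, ℂ)) :
    freeSolution E s η f s = twist (fun x => momentumPhase x η) (𝓕⁻ f) := by
  simp [freeSolution, fieldOrbit_self, freeEvol_zero, fieldMomentum]

/-- The orbit is C¹ in time, but b is only absolutely continuous. An increment is therefore split
into a change of the orbit, Lipschitz in L², and a change of b, whose coefficient is a weighted norm
that is bounded on compact time intervals. -/
theorem hasACDeriv_freeSolution {E : ℝ → Space n} (hE : IsPeriodicField E) (s : ℝ)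
    (η : Space n) (f : 𝓢(Space n, ℂ)) :
    HasACDeriv (fun t => toL2 (freeSolution E s η f t))
      (fun t => toL2 ((-Complex.I) • freeHamiltonian E t (freeSolution E s η f t))) := by
  constructor
  · intro a b
    have hβ : AbsolutelyContinuousOnInterval (fieldOrbit E s η) a b := by
      refine ContDiffOn.absolutelyContinuousOnInterval (ContDiff.contDiffOn ?_)
      have hc := (hasACDeriv_fieldMomentum hE s η).continuous
      refine contDiff_one_iff_deriv.2
        ⟨fun t => (hasDerivAt_fieldOrbit hE s η t).differentiableAt, ?_⟩
      have : deriv (fieldOrbit E s η)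
          = fun t => (1, fieldMomentum E s η t, (1 / 2) * ‖fieldMomentum E s η t‖ ^ 2) :=
        funext fun t => (hasDerivAt_fieldOrbit hE s η t).deriv
      rw [this]
      fun_prop
    obtain ⟨N, hN⟩ := (isCompact_uIcc (a := a) (b := b)).exists_bound_of_continuousOn
      (continuous_norm_quadWeight_freeEvol (continuous_fieldOrbit hE s η) f).continuousOn
    refine absolutelyContinuousOnInterval_of_dist_le_add
      (C := ‖toL2 (quadWeight (2 * Real.pi ^ 2 + 2 * Real.pi + 1) f)‖) (D := N) hβ
      ((hasACDeriv_fieldMomentum hE s η).ac a b) fun x _ y hy => ?_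
    have h1 : toL2 (freeSolution E s η f x) - toL2 (freeSolution E s η f y)
        = toL2 (twist (fun r => momentumPhase r (fieldMomentum E s η x))
            (freeEvol (fieldOrbit E s η x) f - freeEvol (fieldOrbit E s η y) f))
          + (toL2 (twist (fun r => momentumPhase r (fieldMomentum E s η x))
              (freeEvol (fieldOrbit E s η y) f))
            - toL2 (twist (fun r => momentumPhase r (fieldMomentum E s η y))
              (freeEvol (fieldOrbit E s η y) f))) := by
      rw [twist_sub, toL2_sub, freeSolution, freeSolution]
      abel
    rw [dist_eq_norm, h1]
    refine (norm_add_le _ _).trans (add_le_add ?_ ?_)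
    · rw [norm_toL2_twist (isPhaseFamily_momentumPhase.temperate _), toL2_sub, dist_eq_norm,
        mul_comm]
      exact toL2_freeEvol_sub_le _ _ _
    · refine (isPhaseFamily_momentumPhase.norm_twist_sub_le _ _ _).trans ?_
      rw [dist_eq_norm, mul_comm]
      gcongr
      exact (le_abs_self _).trans (hN y hy)
  · filter_upwards [(hasACDeriv_fieldMomentum hE s η).deriv] with t ht
    have h1 := hasDerivAt_toL2_freeEvol (hasDerivAt_fieldOrbit hE s η t) f
    have h2 := isPhaseFamily_momentumPhase.hasDerivAt_twist_comp ht h1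
    rw [← freeHamiltonian_twist_freeEvol] at h2
    exact h2

theorem IsPropagator.exists_schwartz {H : ℝ → 𝓢(Space n, ℂ) → 𝓢(Space n, ℂ)}
    {U : ℝ → ℝ → (L2 n ≃ₗᵢ[ℂ] L2 n)} (hU : IsPropagator H U) (s : ℝ) (φ : 𝓢(Space n, ℂ)) :
    ∃ u : ℝ → 𝓢(Space n, ℂ), (∀ t, U t s (toL2 φ) = toL2 (u t)) ∧
      HasACDeriv (fun t => toL2 (u t)) (fun t => toL2 ((-Complex.I) • H t (u t))) := by
  choose u hu using fun t => hU.invariant t s φ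
  refine ⟨u, hu, ?_⟩
  obtain ⟨h1, h2⟩ := hU.forward s φ u hu
  refine hasACDeriv_of_integral (c := toL2 φ) (s := s) (fun a b => IntervalIntegrable.smul (h1 a b) (-Complex.I)) fun t => ?_
  rw [← hu t, h2 t]
  simp only [toL2_smul]
  rw [intervalIntegral.integral_smul, neg_smul, sub_eq_add_neg]

theorem IsPropagator.apply_self {H : ℝ → 𝓢(Space n, ℂ) → 𝓢(Space n, ℂ)}
    {U : ℝ → ℝ → (L2 n ≃ₗᵢ[ℂ] L2 n)} (hU : IsPropagator H U) (s : ℝ) (f : L2 n) :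
    U s s f = f :=
  (U s s).injective (hU.cocycle s s s f)

theorem IsPropagator.apply_apply {H : ℝ → 𝓢(Space n, ℂ) → 𝓢(Space n, ℂ)}
    {U : ℝ → ℝ → (L2 n ≃ₗᵢ[ℂ] L2 n)} (hU : IsPropagator H U) (s t : ℝ) (f : L2 n) :
    U s t (U t s f) = f := by
  rw [hU.cocycle, hU.apply_self]

/-- The free propagator is given by the Avron–Herbst formula. -/
theorem IsPropagator.apply_freeSolution {E : ℝ → Space n} (hE : IsPeriodicField E)
    {U₀ : ℝ → ℝ → (L2 n ≃ₗᵢ[ℂ] L2 n)} (hU₀ : IsPropagator (freeHamiltonian E) U₀)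
    (s : ℝ) (η : Space n) (f : 𝓢(Space n, ℂ)) (t : ℝ) :
    U₀ t s (toL2 (twist (fun x => momentumPhase x η) (𝓕⁻ f))) = toL2 (freeSolution E s η f t) := by
  -- Weak uniqueness: the product of the explicit solution with any Schwartz solution of the
  -- propagator is conserved, since H₀(t) is symmetric. Comparing times t and s identifies the two.
  have key : ∀ ψ : 𝓢(Space n, ℂ), inner ℂ ((U₀ t s).symm (toL2 (freeSolution E s η f t))) (toL2 ψ)
      = inner ℂ (toL2 (twist (fun x => momentumPhase x η) (𝓕⁻ f))) (toL2 ψ) := by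
    intro ψ
    obtain ⟨u, hu, hu'⟩ := hU₀.exists_schwartz s ψ
    have h1 := (hasACDeriv_freeSolution hE s η f).inner_inner hu'
    have h2 := h1.eq_of_ae_zero (Eventually.of_forall fun r => by
      rw [toL2_smul, toL2_smul, inner_smul_right, inner_smul_left, inner_toL2_freeHamiltonian]
      simp) t s
    rw [← hu t, ← hu s, hU₀.apply_self, freeSolution_self] at h2
    rw [← h2, ← (U₀ t s).inner_map_map, LinearIsometryEquiv.apply_symm_apply]
  rw [← eq_of_inner_toL2_eq key, LinearIsometryEquiv.apply_symm_apply]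

end AvronHerbst

/-! ### Bounds for the potential and continuity in time. -/

section PotentialBounds

variable {n : ℕ}

theorem one_le_bracket (x : Space n) : 1 ≤ bracket x := by
  rw [bracket, Real.one_le_sqrt]
  nlinarith [sq_nonneg ‖x‖]

theorem bracket_pos (x : Space n) : 0 < bracket x := zero_lt_one.trans_le (one_le_bracket x)

theorem norm_le_bracket (x : Space n) : ‖x‖ ≤ bracket x := by
  rw [bracket]
  exact Real.le_sqrt_of_sq_le (by linarith)

theorem bracket_le_one_add_norm (x : Space n) : bracket x ≤ 1 + ‖x‖ := by
  rw [bracket, Real.sqrt_le_left (by positivity)]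
  nlinarith [norm_nonneg x]

theorem IsPotential.exists_bound {δ : ℝ} {V : ℝ → Space n → ℝ} (hV : IsPotential δ V) :
    ∃ C, 0 ≤ C ∧ ∀ t x, |V t x| ≤ C * bracket x ^ (-δ) := by
  obtain ⟨C, hC⟩ := hV.decay 0 0
  refine ⟨|C|, abs_nonneg _, fun t x => ?_⟩
  have h := hC t x
  simp only [iteratedDeriv_zero, norm_iteratedFDeriv_zero, Nat.cast_zero, sub_zero,
    Real.norm_eq_abs] at h
  refine h.trans ?_
  have := (bracket_pos x).le
  gcongr
  exact le_abs_self C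

theorem IsPotential.exists_fderiv_bound {δ : ℝ} {V : ℝ → Space n → ℝ} (hV : IsPotential δ V) :
    ∃ C, 0 ≤ C ∧ ∀ t x, ‖fderiv ℝ (V t) x‖ ≤ C * bracket x ^ (-δ - 1) := by
  obtain ⟨C, hC⟩ := hV.decay 0 1
  refine ⟨|C|, abs_nonneg _, fun t x => ?_⟩
  have h := hC t x
  simp only [iteratedDeriv_zero, norm_iteratedFDeriv_one, Nat.cast_one] at h
  refine h.trans ?_
  have := (bracket_pos x).le
  gcongr
  exact le_abs_self C

theorem IsPotential.contDiff_slice {δ : ℝ} {V : ℝ → Space n → ℝ} (hV : IsPotential δ V) (t : ℝ) :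
    ContDiff ℝ ((⊤ : ℕ∞) : WithTop ℕ∞) (V t) :=
  hV.smooth.comp (contDiff_const.prodMk contDiff_id)

theorem IsPotential.exists_time_lipschitz {δ : ℝ} {V : ℝ → Space n → ℝ} (hδ : 0 < δ)
    (hV : IsPotential δ V) : ∃ C, 0 ≤ C ∧ ∀ t t' x, |V t x - V t' x| ≤ C * |t - t'| := by
  obtain ⟨C, hC⟩ := hV.decay 1 0
  refine ⟨|C|, abs_nonneg _, fun t t' x => ?_⟩
  have hd : ∀ r : ℝ, DifferentiableAt ℝ (fun r => V r x) r := by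
    intro r
    have : ContDiff ℝ ((⊤ : ℕ∞) : WithTop ℕ∞) (fun r => V r x) :=
      hV.smooth.comp (contDiff_id.prodMk contDiff_const)
    exact (this.differentiable (by simp)).differentiableAt
  have hb : ∀ r : ℝ, ‖deriv (fun r => V r x) r‖ ≤ |C| := by
    intro r
    have h := hC r x
    simp only [iteratedDeriv_one, norm_iteratedFDeriv_zero, Nat.cast_zero, sub_zero] at h
    refine h.trans ?_
    have h1 : bracket x ^ (-δ) ≤ 1 :=
      Real.rpow_le_one_of_one_le_of_nonpos (one_le_bracket x) (by linarith)
    have h2 : 0 ≤ bracket x ^ (-δ) := Real.rpow_nonneg (bracket_pos x).le _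
    calc C * bracket x ^ (-δ) ≤ |C| * bracket x ^ (-δ) := by gcongr; exact le_abs_self C
      _ ≤ |C| * 1 := by gcongr
      _ = |C| := mul_one _
  have := convex_univ.norm_image_sub_le_of_norm_deriv_le (f := fun r => V r x)
    (fun r _ => hd r) (fun r _ => hb r) (Set.mem_univ t') (Set.mem_univ t)
  simpa [Real.norm_eq_abs] using this

/-- Multiplication by the real function `g`. -/
def realMul (g : Space n → ℝ) (φ : 𝓢(Space n, ℂ)) : 𝓢(Space n, ℂ) :=
  SchwartzMap.smulLeftCLM ℂ (fun x : Space n => ((g x : ℝ) : ℂ)) φ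

theorem realMul_apply {g : Space n → ℝ}
    (hg : Function.HasTemperateGrowth (fun x : Space n => ((g x : ℝ) : ℂ))) (φ : 𝓢(Space n, ℂ))
    (x : Space n) : realMul g φ x = (g x : ℂ) * φ x := by
  rw [realMul, SchwartzMap.smulLeftCLM_apply_apply hg, smul_eq_mul]

theorem hamiltonian_eq_add (E : ℝ → Space n) (V : ℝ → Space n → ℝ) (t : ℝ) (φ : 𝓢(Space n, ℂ)) :
    hamiltonian E V t φ = freeHamiltonian E t φ + realMul (V t) φ := rfl

theorem norm_toL2_realMul_le {g : Space n → ℝ}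
    (hg : Function.HasTemperateGrowth (fun x : Space n => ((g x : ℝ) : ℂ))) {C : ℝ} (hC : 0 ≤ C)
    (h : ∀ x, |g x| ≤ C) (φ : 𝓢(Space n, ℂ)) : ‖toL2 (realMul g φ)‖ ≤ C * ‖toL2 φ‖ := by
  refine norm_toL2_le _ _ _ hC fun x => ?_
  rw [realMul_apply hg, norm_mul, Complex.norm_real, Real.norm_eq_abs]
  gcongr
  exact h x

theorem IsPotential.continuous_toL2_realMul {δ : ℝ} {V : ℝ → Space n → ℝ} (hδ : 0 < δ)
    (hV : IsPotential δ V) {A : ℝ → 𝓢(Space n, ℂ)} (hA : Continuous fun t => toL2 (A t)) :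
    Continuous (fun t => toL2 (realMul (V t) (A t))) := by
  obtain ⟨C, hC0, hC⟩ := hV.exists_bound
  obtain ⟨D, hD0, hD⟩ := hV.exists_time_lipschitz hδ
  have hC' : ∀ t x, |V t x| ≤ C := fun t x => (hC t x).trans (by
    have h1 : bracket x ^ (-δ) ≤ 1 :=
      Real.rpow_le_one_of_one_le_of_nonpos (one_le_bracket x) (by linarith)
    nlinarith)
  refine continuous_iff_continuousAt.2 fun t => ?_
  rw [ContinuousAt, tendsto_iff_norm_sub_tendsto_zero]
  have hlim : Tendsto (fun r => C * ‖toL2 (A r) - toL2 (A t)‖ + (D * |r - t|) * ‖toL2 (A t)‖)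
      (𝓝 t) (𝓝 0) := by
    have : Continuous fun r =>
        C * ‖toL2 (A r) - toL2 (A t)‖ + (D * |r - t|) * ‖toL2 (A t)‖ := by fun_prop
    have h0 := this.tendsto t
    simpa using h0
  refine squeeze_zero (fun _ => norm_nonneg _) (fun r => ?_) hlim
  have hg := hV.hasTemperateGrowth hδ
  rw [← toL2_sub, ← toL2_sub]
  refine norm_toL2_le_add _ _ _ _ _ hC0 (by positivity) fun x => ?_
  rw [sub_apply, sub_apply, realMul_apply (hg r), realMul_apply (hg t)]
  have h1 : (V r x : ℂ) * A r x - (V t x : ℂ) * A t x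
      = (V r x : ℂ) * (A r x - A t x) + ((V r x - V t x : ℝ) : ℂ) * A t x := by
    push_cast; ring
  rw [h1]
  refine (norm_add_le _ _).trans ?_
  rw [norm_mul, norm_mul, Complex.norm_real, Complex.norm_real, Real.norm_eq_abs, Real.norm_eq_abs]
  gcongr
  · exact hC' r x
  · exact hD r t x

theorem continuous_propagator_apply {H : ℝ → 𝓢(Space n, ℂ) → 𝓢(Space n, ℂ)}
    {U : ℝ → ℝ → (L2 n ≃ₗᵢ[ℂ] L2 n)} (hU : IsPropagator H U) (s : ℝ) {g : ℝ → L2 n}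
    (hg : Continuous g) : Continuous (fun t => U s t (g t)) := by
  refine continuous_iff_continuousAt.2 fun t => ?_
  rw [ContinuousAt, tendsto_iff_norm_sub_tendsto_zero]
  have hc : Continuous fun r => U s r (g t) :=
    (hU.continuous (g t)).comp (continuous_const.prodMk continuous_id)
  have hlim : Tendsto (fun r => ‖g r - g t‖ + ‖U s r (g t) - U s t (g t)‖) (𝓝 t) (𝓝 0) := by
    have : Continuous fun r => ‖g r - g t‖ + ‖U s r (g t) - U s t (g t)‖ := by fun_prop
    have h0 := this.tendsto t
    simpa using h0
  refine squeeze_zero (fun _ => norm_nonneg _) (fun r => ?_) hlim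
  have h1 : U s r (g r) - U s t (g t) = U s r (g r - g t) + (U s r (g t) - U s t (g t)) := by
    rw [map_sub]; abel
  rw [h1]
  refine (norm_add_le _ _).trans ?_
  rw [LinearIsometryEquiv.norm_map]

end PotentialBounds

/-! ### The derivative of the interaction-picture evolution. -/

section Duhamel

variable {n : ℕ}

theorem IsPropagator.inner_apply_left {H : ℝ → 𝓢(Space n, ℂ) → 𝓢(Space n, ℂ)}
    {U : ℝ → ℝ → (L2 n ≃ₗᵢ[ℂ] L2 n)} (hU : IsPropagator H U) (s t : ℝ) (f g : L2 n) :
    inner ℂ (U s t f) g = inner ℂ f (U t s g) := by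
  rw [← (U s t).inner_map_map f, hU.apply_apply]

/-- Tested against a Schwartz ψ, the propagator moves over to ψ as U(t,s), both factors are
absolutely continuous, and the free parts cancel by symmetry. What is left involves only V and is
continuous in t, so the integrated identity can be differentiated at every t, although E is only
integrable. -/
theorem hasDerivAt_propagator_freeSolution {δ : ℝ} (hδ : 0 < δ) {E : ℝ → Space n}
    (hE : IsPeriodicField E) {V : ℝ → Space n → ℝ} (hV : IsPotential δ V)
    {U : ℝ → ℝ → (L2 n ≃ₗᵢ[ℂ] L2 n)} (hU : IsPropagator (hamiltonian E V) U)
    (s : ℝ) (η : Space n) (f : 𝓢(Space n, ℂ)) (t : ℝ) :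
    HasDerivAt (fun t => U s t (toL2 (freeSolution E s η f t)))
      (Complex.I • U s t (toL2 (realMul (V t) (freeSolution E s η f t)))) t := by
  set A := freeSolution E s η f with hAdef
  have hA : HasACDeriv (fun t => toL2 (A t))
      (fun t => toL2 ((-Complex.I) • freeHamiltonian E t (A t))) := hasACDeriv_freeSolution hE s η f
  set k : ℝ → L2 n := fun t => U s t (toL2 (realMul (V t) (A t))) with hk
  have hkc : Continuous k := continuous_propagator_apply hU s
    (hV.continuous_toL2_realMul hδ hA.continuous)
  have hki : ∀ a b : ℝ, IntervalIntegrable (fun t => Complex.I • k t) volume a b := fun a b =>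
    (hkc.const_smul Complex.I).intervalIntegrable a b
  have hY : HasACDeriv (fun t => ∫ τ in s..t, Complex.I • k τ) (fun t => Complex.I • k t) :=
    hasACDeriv_of_integral (c := 0) hki fun t => by rw [zero_add]
  have key : ∀ t, U s t (toL2 (A t)) = toL2 (A s) + ∫ τ in s..t, Complex.I • k τ := by
    intro t
    refine eq_of_inner_toL2_eq fun ψ => ?_
    obtain ⟨u, hu, hu'⟩ := hU.exists_schwartz s ψ
    have hψ : HasACDeriv (fun _ : ℝ => toL2 ψ) (fun _ => 0) :=
      hasACDeriv_of_integral (c := toL2 ψ) (s := 0) (fun a b => by simp) fun t => by simp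
    have h1 := (hA.inner_inner hu').sub (hY.inner_inner hψ)
    have h2 := h1.eq_of_ae_zero (Eventually.of_forall fun r => by
      have e1 : inner ℂ (toL2 (A r)) (toL2 (realMul (V r) (u r))) = inner ℂ (k r) (toL2 ψ) := by
        rw [hk, hU.inner_apply_left, hu r]
        exact (inner_toL2_smulLeft (hV.hasTemperateGrowth hδ r) _ _).symm
      rw [toL2_smul, toL2_smul, inner_smul_right, inner_smul_left, inner_smul_left,
        hamiltonian_eq_add, toL2_add, inner_add_right, e1, inner_toL2_freeHamiltonian]
      simp only [map_neg, Complex.conj_I, inner_zero_right]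
      ring) t s
    have e2 : ∀ r, inner ℂ (toL2 (A r)) (toL2 (u r)) = inner ℂ (U s r (toL2 (A r))) (toL2 ψ) := by
      intro r
      rw [hU.inner_apply_left, hu r]
    simp only [e2, intervalIntegral.integral_same, inner_zero_left, sub_zero, hU.apply_self] at h2
    rw [inner_add_left, ← h2]
    ring
  have h3 := ((hkc.const_smul Complex.I).integral_hasStrictDerivAt s t).hasDerivAt.const_add
    (toL2 (A s))
  exact h3.congr_of_eventuallyEq (Eventually.of_forall key)

end Duhamel

/-! ### Propagation estimates by division by the classical position. -/

section Decay

variable {n : ℕ}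

theorem lineDeriv_coordMul (l m : Space n) (g : 𝓢(Space n, ℂ)) :
    ∂_{m} (coordMul l g) = coordMul l (∂_{m} g) + ((inner ℝ m l : ℝ) : ℂ) • g := by
  ext x
  rw [add_apply, smul_apply, coordMul_apply, SchwartzMap.lineDerivOp_apply_eq_fderiv,
    SchwartzMap.lineDerivOp_apply_eq_fderiv]
  have h0 : ⇑(coordMul l g) = (fun x => ((inner ℝ x l : ℝ) : ℂ)) * ⇑g :=
    funext fun x => coordMul_apply l g x
  have h1 : HasFDerivAt (fun x : Space n => ((inner ℝ x l : ℝ) : ℂ))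
      (Complex.ofRealCLM.comp ((innerSL ℝ).flip l)) x :=
    Complex.ofRealCLM.hasFDerivAt.comp x (((innerSL ℝ).flip l).hasFDerivAt)
  have h2 : (innerSL ℝ l) m = inner ℝ m l := real_inner_comm m l
  rw [h0, (h1.mul (g.hasFDerivAt x)).fderiv]
  simp [h2]
  ring

/-- The denominator is nonzero on the closed support of `f`, so the quotient, extended by zero, is
smooth across the boundary of the support. -/
theorem exists_div (f : 𝓢(Space n, ℂ)) (hf : HasCompactSupport f) (l : Space n) (p q : ℝ)
    (h : ∀ ξ ∈ tsupport f, p * inner ℝ ξ l + q ≠ 0) :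
    ∃ g : 𝓢(Space n, ℂ), f = (p : ℂ) • coordMul l g + (q : ℂ) • g ∧ tsupport g ⊆ tsupport f := by
  set den : Space n → ℂ := fun ξ => ((p * inner ℝ ξ l + q : ℝ) : ℂ) with hden
  have hdc : ContDiff ℝ ((⊤ : ℕ∞) : WithTop ℕ∞) den := by
    have : ContDiff ℝ ((⊤ : ℕ∞) : WithTop ℕ∞) (fun ξ : Space n => p * inner ℝ ξ l + q) :=
      (contDiff_const.mul (contDiff_id.inner ℝ contDiff_const)).add contDiff_const
    exact Complex.ofRealCLM.contDiff.comp this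
  have hc : ContDiff ℝ ((⊤ : ℕ∞) : WithTop ℕ∞) (fun ξ => (den ξ)⁻¹ * f ξ) := by
    refine contDiff_iff_contDiffAt.2 fun ξ => ?_
    by_cases hξ : ξ ∈ tsupport f
    · refine (hdc.contDiffAt.inv ?_).mul (f.smooth ⊤).contDiffAt
      simp only [hden]
      exact_mod_cast h ξ hξ
    · have h0 : (fun ξ => (den ξ)⁻¹ * f ξ) =ᶠ[𝓝 ξ] fun _ => 0 := by
        filter_upwards [notMem_tsupport_iff_eventuallyEq.1 hξ] with x hx
        simp [hx]
      exact contDiffAt_const.congr_of_eventuallyEq h0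
  have hs : tsupport (fun ξ => (den ξ)⁻¹ * f ξ) ⊆ tsupport f :=
    closure_mono (Function.support_mul_subset_right _ _)
  have hcs : HasCompactSupport (fun ξ => (den ξ)⁻¹ * f ξ) := hf.mul_left
  refine ⟨hcs.toSchwartzMap hc, ?_, hs⟩
  ext ξ
  have : (hcs.toSchwartzMap hc) ξ = (den ξ)⁻¹ * f ξ := rfl
  rw [add_apply, smul_apply, smul_apply, coordMul_apply, this]
  by_cases hξ : ξ ∈ tsupport f
  · have h1 : den ξ ≠ 0 := by
      simp only [hden]
      exact_mod_cast h ξ hξ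
    have h2 : den ξ = p * ((inner ℝ ξ l : ℝ) : ℂ) + q := by simp [hden]
    simp only [smul_eq_mul]
    calc f ξ = den ξ * ((den ξ)⁻¹ * f ξ) := by rw [mul_inv_cancel_left₀ h1]
      _ = _ := by nth_rewrite 1 [h2]; ring
  · simp [image_eq_zero_of_notMem_tsupport hξ]

/-- The symbol of `l·x` in the representation `freeEvol z`, without its differential part. -/
def symbolDen (z : ℝ × Space n × ℝ) (l ξ : Space n) : ℝ :=
  2 * Real.pi * z.1 * inner ℝ ξ l + inner ℝ z.2.1 l

/-- One integration by parts: with f = `symbolDen`·g, the position operator applied to the evolution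
of g gives back that of f up to a term with ∂_l g. Differentiating the denominator along l yields
2πt, and `2π|t| ≤ Mρ` keeps its ratio to the denominator below M, so each derivative of g still
gains 1/ρ. The successive constants are 1, 2M and 5M². The nested implications allow a second
division with one derivative fewer. -/
theorem exists_freeEvol_div (f : 𝓢(Space n, ℂ)) (hf : HasCompactSupport f)
    (z : ℝ × Space n × ℝ) (l : Space n) (hl : ‖l‖ = 1) {ρ M : ℝ} (hρ : 0 < ρ) (hM : 1 ≤ M)
    (ht : 2 * Real.pi * |z.1| ≤ M * ρ) (h : ∀ ξ ∈ tsupport f, ρ ≤ |symbolDen z l ξ|) :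
    ∃ g : 𝓢(Space n, ℂ), tsupport g ⊆ tsupport f ∧
      freeEvol z f = coordMul l (freeEvol z g)
        - (Complex.I / (2 * Real.pi) : ℂ) • freeEvol z (∂_{l} g) ∧
      ∀ A : ℝ, (∀ ξ, ‖f ξ‖ ≤ A) → (∀ ξ, ‖g ξ‖ ≤ 5 * M ^ 2 * A / ρ) ∧
        ((∀ ξ, ‖(∂_{l} f) ξ‖ ≤ A) → (∀ ξ, ‖(∂_{l} g) ξ‖ ≤ 5 * M ^ 2 * A / ρ) ∧
          ((∀ ξ, ‖(∂_{l} (∂_{l} f)) ξ‖ ≤ A) →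
            ∀ ξ, ‖(∂_{l} (∂_{l} g)) ξ‖ ≤ 5 * M ^ 2 * A / ρ)) := by
  obtain ⟨g, hg, hs⟩ := exists_div f hf l (2 * Real.pi * z.1) (inner ℝ z.2.1 l) (fun ξ hξ h0 => by
    have := h ξ hξ
    rw [symbolDen, h0, abs_zero] at this
    linarith)
  have hll : inner ℝ l l = (1 : ℝ) := by rw [real_inner_self_eq_norm_sq, hl]; norm_num
  set κ : ℝ := 2 * Real.pi * z.1 with hκ
  have hκabs : |κ| ≤ M * ρ := by
    rw [hκ, abs_mul, abs_of_pos (by positivity : 0 < 2 * Real.pi)]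
    exact ht
  have hg1 : ∂_{l} f = (κ : ℂ) • (coordMul l (∂_{l} g) + g)
      + ((inner ℝ z.2.1 l : ℝ) : ℂ) • ∂_{l} g := by
    conv_lhs => rw [hg]
    rw [LineDeriv.lineDerivOp_add, LineDeriv.lineDerivOp_smul, LineDeriv.lineDerivOp_smul,
      lineDeriv_coordMul, hll]
    simp
  have hg2 : ∂_{l} (∂_{l} f) = (κ : ℂ) • (coordMul l (∂_{l} (∂_{l} g)) + (2 : ℂ) • ∂_{l} g)
      + ((inner ℝ z.2.1 l : ℝ) : ℂ) • ∂_{l} (∂_{l} g) := by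
    rw [hg1, LineDeriv.lineDerivOp_add, LineDeriv.lineDerivOp_smul, LineDeriv.lineDerivOp_smul,
      LineDeriv.lineDerivOp_add, lineDeriv_coordMul, hll, two_smul]
    simp [add_assoc]
  have e0 : ∀ ξ, (symbolDen z l ξ : ℂ) * g ξ = f ξ := fun ξ => by
    conv_rhs => rw [hg]
    simp only [add_apply, smul_apply, smul_eq_mul, coordMul_apply, symbolDen, ← hκ]
    push_cast; ring
  have e1 : ∀ ξ, (symbolDen z l ξ : ℂ) * (∂_{l} g) ξ = (∂_{l} f) ξ - κ * g ξ := fun ξ => by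
    rw [hg1]
    simp only [add_apply, smul_apply, smul_eq_mul, coordMul_apply, symbolDen, ← hκ]
    push_cast; ring
  have e2 : ∀ ξ, (symbolDen z l ξ : ℂ) * (∂_{l} (∂_{l} g)) ξ
      = (∂_{l} (∂_{l} f)) ξ - 2 * κ * (∂_{l} g) ξ := fun ξ => by
    rw [hg2]
    simp only [add_apply, smul_apply, smul_eq_mul, coordMul_apply, symbolDen, ← hκ]
    push_cast; ring
  have hdiv : ∀ (u : 𝓢(Space n, ℂ)) (ξ : Space n) (B : ℝ), tsupport u ⊆ tsupport f → 0 ≤ B →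
      ‖(symbolDen z l ξ : ℂ) * u ξ‖ ≤ B → ‖u ξ‖ ≤ B / ρ := by
    intro u ξ B hu hB hb
    by_cases hξ : ξ ∈ tsupport f
    · rw [le_div_iff₀ hρ]
      rw [norm_mul, Complex.norm_real, Real.norm_eq_abs] at hb
      have := h ξ hξ
      nlinarith [norm_nonneg (u ξ)]
    · have : u ξ = 0 := image_eq_zero_of_notMem_tsupport fun h' => hξ (hu h')
      rw [this, norm_zero]
      positivity
  have hs1 : tsupport (∂_{l} g : 𝓢(Space n, ℂ)) ⊆ tsupport f :=
    (SchwartzMap.tsupport_lineDerivOp_subset l g).trans hs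
  have hs2 : tsupport (∂_{l} (∂_{l} g) : 𝓢(Space n, ℂ)) ⊆ tsupport f :=
    (SchwartzMap.tsupport_lineDerivOp_subset l _).trans hs1
  refine ⟨g, hs, ?_, fun A hA => ?_⟩
  · rw [coordMul_freeEvol, ← freeEvol_smul, ← freeEvol_sub, positionSymbol]
    congr 1
    nth_rewrite 1 [hg]
    abel
  have hA0 : 0 ≤ A := (norm_nonneg _).trans (hA 0)
  have hM2 : 1 ≤ M ^ 2 := one_le_pow₀ hM
  have b0 : ∀ ξ, ‖g ξ‖ ≤ A / ρ := fun ξ => hdiv g ξ A hs hA0 (by rw [e0]; exact hA ξ)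
  refine ⟨fun ξ => (b0 ξ).trans (by gcongr; nlinarith), fun hA1 => ?_⟩
  have b1 : ∀ ξ, ‖(∂_{l} g) ξ‖ ≤ 2 * M * A / ρ := fun ξ => hdiv _ ξ _ hs1 (by positivity) (by
    rw [e1]
    refine (norm_sub_le _ _).trans ?_
    rw [norm_mul, Complex.norm_real, Real.norm_eq_abs]
    calc ‖(∂_{l} f) ξ‖ + |κ| * ‖g ξ‖ ≤ A + (M * ρ) * (A / ρ) := by
          gcongr
          · exact hA1 ξ
          · exact b0 ξ
      _ = A + M * A := by field_simp
      _ ≤ 2 * M * A := by nlinarith)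
  refine ⟨fun ξ => (b1 ξ).trans (by gcongr <;> nlinarith), fun hA2 ξ => ?_⟩
  refine hdiv _ ξ _ hs2 (by positivity) ?_
  rw [e2]
  refine (norm_sub_le _ _).trans ?_
  rw [norm_mul, norm_mul, Complex.norm_real, Real.norm_eq_abs]
  calc ‖(∂_{l} (∂_{l} f)) ξ‖ + ‖(2 : ℂ)‖ * |κ| * ‖(∂_{l} g) ξ‖
      ≤ A + 2 * (M * ρ) * (2 * M * A / ρ) := by
        gcongr
        · exact hA2 ξ
        · simp
        · exact b1 ξ
    _ = A + 4 * M ^ 2 * A := by field_simp; ring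
    _ ≤ 5 * M ^ 2 * A := by nlinarith

theorem exists_lineDeriv_bound (f : 𝓢(Space n, ℂ)) : ∃ A : ℝ, 0 ≤ A ∧ ∀ l : Space n, ‖l‖ = 1 →
    (∀ ξ, ‖f ξ‖ ≤ A) ∧ (∀ ξ, ‖(∂_{l} f) ξ‖ ≤ A) ∧ (∀ ξ, ‖(∂_{l} (∂_{l} f)) ξ‖ ≤ A) := by
  set s : ℕ → ℝ := fun k => SchwartzMap.seminorm ℝ 0 k f
  have hs : ∀ k, 0 ≤ s k := fun k => apply_nonneg _ _
  have hk : ∀ (k : ℕ) (l : Space n), ‖l‖ = 1 → ∀ ξ, ‖(∂^{fun _ : Fin k => l} f) ξ‖ ≤ s k := by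
    intro k l hl ξ
    rw [SchwartzMap.iteratedLineDerivOp_eq_iteratedFDeriv]
    refine (ContinuousMultilinearMap.le_opNorm _ _).trans ?_
    simp only [hl, Finset.prod_const_one, mul_one]
    exact SchwartzMap.norm_iteratedFDeriv_le_seminorm ℝ f k ξ
  refine ⟨s 0 + s 1 + s 2, by linarith [hs 0, hs 1, hs 2], fun l hl => ⟨fun ξ => ?_, fun ξ => ?_,
    fun ξ => ?_⟩⟩
  · have := hk 0 l hl ξ
    rw [LineDeriv.iteratedLineDerivOp_fin_zero] at this
    linarith [hs 1, hs 2]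
  · have := hk 1 l hl ξ
    rw [LineDeriv.iteratedLineDerivOp_one] at this
    linarith [hs 0, hs 2]
  · have := hk 2 l hl ξ
    rw [LineDeriv.iteratedLineDerivOp_const_eq_iter_lineDerivOp] at this
    simp only [Function.iterate_succ, Function.iterate_zero, Function.comp_apply, id] at this
    linarith [hs 0, hs 1]

/-- Interpolation between the weights 1 and ⟨x⟩⁻²: the first term dominates where ⟨x⟩ ≥ ρ, the
second where ⟨x⟩ ≤ ρ. -/
theorem bracket_rpow_neg_le {x : Space n} {ρ μ : ℝ} (hρ : 0 < ρ) (hμ : 0 ≤ μ) (hμ2 : μ ≤ 2) :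
    bracket x ^ (-μ) ≤ ρ ^ (-μ) + ρ ^ (2 - μ) * (bracket x ^ 2)⁻¹ := by
  have hb := bracket_pos x
  rcases le_total ρ (bracket x) with h | h
  · have := Real.rpow_le_rpow_of_nonpos hρ h (by linarith : -μ ≤ 0)
    have h2 : 0 ≤ ρ ^ (2 - μ) * (bracket x ^ 2)⁻¹ := by positivity
    linarith
  · have h1 : bracket x ^ (-μ) = bracket x ^ (2 - μ) * (bracket x ^ 2)⁻¹ := by
      rw [← Real.rpow_natCast, ← Real.rpow_neg hb.le, ← Real.rpow_add hb]
      congr 1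
      push_cast
      ring
    have h2 : bracket x ^ (2 - μ) ≤ ρ ^ (2 - μ) := Real.rpow_le_rpow hb.le h (by linarith)
    have h3 : 0 ≤ ρ ^ (-μ) := by positivity
    have h4 : bracket x ^ (2 - μ) * (bracket x ^ 2)⁻¹ ≤ ρ ^ (2 - μ) * (bracket x ^ 2)⁻¹ := by
      gcongr
    linarith

/-- Two divisions write the evolution of f as a polynomial of degree 2 in l·x whose coefficients are
O(ρ⁻²) in L². This settles μ = 2, and `bracket_rpow_neg_le` interpolates with μ = 0. -/
theorem exists_freeEvol_weighted_bound (f : 𝓢(Space n, ℂ)) (hf : HasCompactSupport f)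
    {M : ℝ} (hM : 1 ≤ M) :
    ∃ C, 0 ≤ C ∧ ∀ (z : ℝ × Space n × ℝ) (l : Space n) (ρ : ℝ), ‖l‖ = 1 → 0 < ρ →
      2 * Real.pi * |z.1| ≤ M * ρ → (∀ ξ ∈ tsupport f, ρ ≤ |symbolDen z l ξ|) →
      ∀ (g : Space n → ℝ) (D μ : ℝ),
        Function.HasTemperateGrowth (fun x : Space n => ((g x : ℝ) : ℂ)) → 0 ≤ D →
        0 ≤ μ → μ ≤ 2 → (∀ x, |g x| ≤ D * bracket x ^ (-μ)) →
        ‖toL2 (realMul g (freeEvol z f))‖ ≤ C * D * ρ ^ (-μ) := by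
  obtain ⟨A, hA0, hA⟩ := exists_lineDeriv_bound f
  set v : ℝ := (volume.real (tsupport f)) ^ (1 / 2 : ℝ) with hv
  have hv0 : 0 ≤ v := by positivity
  -- Each of the four coefficients of the polynomial contributes (5M²)²·A·v.
  refine ⟨‖toL2 f‖ + 100 * M ^ 4 * A * v, by positivity,
    fun z l ρ hl hρ ht h g D μ hg hD hμ hμ2 hgD => ?_⟩
  obtain ⟨hAf, hAf1, hAf2⟩ := hA l hl
  obtain ⟨g₁, hg₁s, hg₁, hg₁b⟩ := exists_freeEvol_div f hf z l hl hρ hM ht h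
  obtain ⟨b0, hb⟩ := hg₁b A hAf
  obtain ⟨b1, hb⟩ := hb hAf1
  have b2 := hb hAf2
  set g₂ : 𝓢(Space n, ℂ) := ∂_{l} g₁ with hg₂
  have hg₂s : tsupport g₂ ⊆ tsupport f := (SchwartzMap.tsupport_lineDerivOp_subset l g₁).trans hg₁s
  have hc₁ : HasCompactSupport g₁ := hf.of_isClosed_subset (isClosed_tsupport _) hg₁s
  have hc₂ : HasCompactSupport g₂ := hf.of_isClosed_subset (isClosed_tsupport _) hg₂s
  obtain ⟨h₁, hh₁s, hh₁, hh₁b⟩ := exists_freeEvol_div g₁ hc₁ z l hl hρ hM ht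
    fun ξ hξ => h ξ (hg₁s hξ)
  obtain ⟨h₂, hh₂s, hh₂, hh₂b⟩ := exists_freeEvol_div g₂ hc₂ z l hl hρ hM ht
    fun ξ hξ => h ξ (hg₂s hξ)
  obtain ⟨c0, hc⟩ := hh₁b _ b0
  have c1 := (hc b1).1
  obtain ⟨d0, hd⟩ := hh₂b _ b1
  have d1 := (hd b2).1
  set R : ℝ := 5 * M ^ 2 * (5 * M ^ 2 * A / ρ) / ρ with hR
  have hR0 : 0 ≤ R := by positivity
  have hsupp : ∀ u : 𝓢(Space n, ℂ), tsupport u ⊆ tsupport f → (∀ ξ, ‖u ξ‖ ≤ R) →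
      ‖toL2 (freeEvol z u)‖ ≤ R * v := by
    intro u hu hb
    rw [norm_toL2_freeEvol]
    exact norm_toL2_le_of_support u hf R hR0 hb fun x hx =>
      image_eq_zero_of_notMem_tsupport fun h' => hx (hu h')
  have n1 := hsupp h₁ (hh₁s.trans hg₁s) c0
  have n2 := hsupp (∂_{l} h₁) ((SchwartzMap.tsupport_lineDerivOp_subset l h₁).trans
    (hh₁s.trans hg₁s)) c1
  have n3 := hsupp h₂ (hh₂s.trans hg₂s) d0
  have n4 := hsupp (∂_{l} h₂) ((SchwartzMap.tsupport_lineDerivOp_subset l h₂).trans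
    (hh₂s.trans hg₂s)) d1
  have hcn : ‖(Complex.I / (2 * Real.pi) : ℂ)‖ ≤ 1 := by
    rw [norm_div, Complex.norm_I, norm_mul, Complex.norm_real, Real.norm_of_nonneg Real.pi_pos.le]
    simp only [Complex.norm_ofNat]
    rw [div_le_one (by positivity)]
    linarith [Real.pi_gt_three]
  have hpt : ∀ x, ‖freeEvol z f x‖ ≤ bracket x ^ 2 * (‖freeEvol z h₁ x‖
      + ‖freeEvol z (∂_{l} h₁) x‖ + ‖freeEvol z h₂ x‖ + ‖freeEvol z (∂_{l} h₂) x‖) := by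
    intro x
    rw [hg₁, hh₁, hh₂]
    simp only [sub_apply, smul_apply, coordMul_apply, smul_eq_mul]
    have hx : ‖((inner ℝ x l : ℝ) : ℂ)‖ ≤ bracket x := by
      rw [Complex.norm_real]
      refine (norm_inner_le_norm x l).trans ?_
      rw [hl, mul_one]
      exact norm_le_bracket x
    have hb1 := one_le_bracket x
    set a := freeEvol z h₁ x
    set b := freeEvol z (∂_{l} h₁) x
    set c := freeEvol z h₂ x
    set d := freeEvol z (∂_{l} h₂) x
    set r : ℂ := ((inner ℝ x l : ℝ) : ℂ)
    set k : ℂ := Complex.I / (2 * Real.pi)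
    set B := bracket x
    have i1 : ‖r * (r * a - k * b)‖ ≤ B * (B * ‖a‖ + 1 * ‖b‖) := by
      rw [norm_mul]
      gcongr
      refine (norm_sub_le _ _).trans ?_
      rw [norm_mul, norm_mul]
      gcongr
    have i2 : ‖k * (r * c - k * d)‖ ≤ 1 * (B * ‖c‖ + 1 * ‖d‖) := by
      rw [norm_mul]
      gcongr
      refine (norm_sub_le _ _).trans ?_
      rw [norm_mul, norm_mul]
      gcongr
    refine (norm_sub_le _ _).trans ((add_le_add i1 i2).trans ?_)
    have q1 : B ≤ B ^ 2 := by nlinarith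
    have q2 : 1 ≤ B ^ 2 := by nlinarith
    have := mul_le_mul_of_nonneg_right q1 (norm_nonneg b)
    have := mul_le_mul_of_nonneg_right q1 (norm_nonneg c)
    have := mul_le_mul_of_nonneg_right q2 (norm_nonneg d)
    linarith
  have hfin := norm_toL2_le_sum (Finset.univ : Finset (Fin 5))
    ![D * ρ ^ (-μ), D * ρ ^ (2 - μ), D * ρ ^ (2 - μ), D * ρ ^ (2 - μ), D * ρ ^ (2 - μ)]
    (realMul g (freeEvol z f))
    ![freeEvol z f, freeEvol z h₁, freeEvol z (∂_{l} h₁), freeEvol z h₂, freeEvol z (∂_{l} h₂)]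
    (by
      have h1 : 0 ≤ D * ρ ^ (-μ) := by positivity
      have h2 : 0 ≤ D * ρ ^ (2 - μ) := by positivity
      intro i _
      fin_cases i
      exacts [h1, h2, h2, h2, h2])
    (by
      intro x
      rw [realMul_apply hg, norm_mul, Complex.norm_real, Real.norm_eq_abs]
      simp only [Fin.sum_univ_five, Matrix.cons_val]
      have hb := bracket_pos x
      have h1 : |g x| ≤ D * (ρ ^ (-μ) + ρ ^ (2 - μ) * (bracket x ^ 2)⁻¹) :=
        (hgD x).trans (by gcongr; exact bracket_rpow_neg_le hρ hμ hμ2)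
      have h2 : (bracket x ^ 2)⁻¹ * ‖freeEvol z f x‖ ≤ ‖freeEvol z h₁ x‖
          + ‖freeEvol z (∂_{l} h₁) x‖ + ‖freeEvol z h₂ x‖ + ‖freeEvol z (∂_{l} h₂) x‖ := by
        rw [inv_mul_le_iff₀ (by positivity)]
        exact hpt x
      have h3 : 0 ≤ D * ρ ^ (2 - μ) := by positivity
      calc |g x| * ‖freeEvol z f x‖
          ≤ (D * (ρ ^ (-μ) + ρ ^ (2 - μ) * (bracket x ^ 2)⁻¹)) * ‖freeEvol z f x‖ := by gcongr
        _ = D * ρ ^ (-μ) * ‖freeEvol z f x‖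
            + D * ρ ^ (2 - μ) * ((bracket x ^ 2)⁻¹ * ‖freeEvol z f x‖) := by ring
        _ ≤ D * ρ ^ (-μ) * ‖freeEvol z f x‖
            + D * ρ ^ (2 - μ) * (‖freeEvol z h₁ x‖
          + ‖freeEvol z (∂_{l} h₁) x‖ + ‖freeEvol z h₂ x‖ + ‖freeEvol z (∂_{l} h₂) x‖) := by
            gcongr
        _ = _ := by ring)
  simp only [Fin.sum_univ_five, Matrix.cons_val] at hfin
  rw [norm_toL2_freeEvol] at hfin
  have hpow : ρ ^ (2 - μ) = ρ ^ 2 * ρ ^ (-μ) := by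
    rw [← Real.rpow_natCast, ← Real.rpow_add hρ]
    congr 1
  have hRρ : ρ ^ 2 * R = 25 * M ^ 4 * A := by
    rw [hR]; field_simp; ring
  have hP : 0 ≤ D * ρ ^ (2 - μ) := by positivity
  calc _ ≤ _ := hfin
    _ ≤ D * ρ ^ (-μ) * ‖toL2 f‖ + D * ρ ^ (2 - μ) * (R * v) + D * ρ ^ (2 - μ) * (R * v)
        + D * ρ ^ (2 - μ) * (R * v) + D * ρ ^ (2 - μ) * (R * v) := by gcongr
    _ = D * ρ ^ (-μ) * (‖toL2 f‖ + 4 * (ρ ^ 2 * R) * v) := by rw [hpow]; ring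
    _ = _ := by rw [hRρ]; ring

/-- Propagation estimate: if the classical trajectories of momenta in the support of `f` are at
distance at least of order `Q` from the origin, then multiplication by a function that decays
like `⟨x⟩^{-μ}` gains `Q^{-μ}`. -/
theorem exists_freeEvol_decay (f : 𝓢(Space n, ℂ)) (hf : HasCompactSupport f)
    {M : ℝ} (hM : 1 ≤ M) :
    ∃ C, 0 ≤ C ∧ ∀ (z : ℝ × Space n × ℝ) (l : Space n) (Q : ℝ), ‖l‖ = 1 → 1 ≤ Q →
      (Q ≤ M ∨ (2 * Real.pi * |z.1| ≤ M * Q ∧ ∀ ξ ∈ tsupport f, Q ≤ M * |symbolDen z l ξ|)) →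
      ∀ (g : Space n → ℝ) (D μ : ℝ),
        Function.HasTemperateGrowth (fun x : Space n => ((g x : ℝ) : ℂ)) → 0 ≤ D →
        0 ≤ μ → μ ≤ 2 → (∀ x, |g x| ≤ D * bracket x ^ (-μ)) →
        ‖toL2 (realMul g (freeEvol z f))‖ ≤ C * D * Q ^ (-μ) := by
  -- The weighted bound is used with ρ = Q/M, for which the time condition 2π|t| ≤ MQ reads 2π|t| ≤
  -- M²ρ. If Q ≤ M, the trivial bound suffices because M²Q^{-μ} ≥ 1.
  obtain ⟨C, hC0, hC⟩ := exists_freeEvol_weighted_bound f hf (one_le_pow₀ hM : 1 ≤ M ^ 2)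
  refine ⟨(‖toL2 f‖ + C) * M ^ 2, by positivity,
    fun z l Q hl hQ hz g D μ hg hD hμ hμ2 hgD => ?_⟩
  have hM0 : 0 < M := by linarith
  have hQ0 : 0 < Q := by linarith
  have hMμ : M ^ μ ≤ M ^ 2 := by
    rw [← Real.rpow_natCast]
    exact Real.rpow_le_rpow_of_exponent_le hM (by exact_mod_cast hμ2)
  have hQμ : 0 ≤ Q ^ (-μ) := by positivity
  rcases hz with hz | ⟨ht, hz⟩
  · have h1 : ‖toL2 (realMul g (freeEvol z f))‖ ≤ D * ‖toL2 f‖ := by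
      rw [← norm_toL2_freeEvol z f]
      refine norm_toL2_realMul_le hg hD (fun x => (hgD x).trans ?_) _
      have : bracket x ^ (-μ) ≤ 1 :=
        Real.rpow_le_one_of_one_le_of_nonpos (one_le_bracket x) (by linarith)
      nlinarith
    have h2 : 1 ≤ M ^ 2 * Q ^ (-μ) := by
      have h3 : M ^ μ * M ^ (-μ) = 1 := by rw [← Real.rpow_add hM0]; simp
      have h4 : M ^ (-μ) ≤ Q ^ (-μ) := Real.rpow_le_rpow_of_nonpos hQ0 hz (by linarith)
      calc 1 = M ^ μ * M ^ (-μ) := h3.symm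
        _ ≤ M ^ 2 * Q ^ (-μ) := by gcongr
    calc _ ≤ D * ‖toL2 f‖ := h1
      _ ≤ (D * ‖toL2 f‖) * (M ^ 2 * Q ^ (-μ)) := le_mul_of_one_le_right (by positivity) h2
      _ ≤ (D * (‖toL2 f‖ + C)) * (M ^ 2 * Q ^ (-μ)) := by gcongr; linarith
      _ = _ := by ring
  · have h1 := hC z l (Q / M) hl (by positivity) (ht.trans (le_of_eq (by field_simp)))
      (fun ξ hξ => by rw [div_le_iff₀ hM0, mul_comm]; exact hz ξ hξ) g D μ hg hD hμ hμ2 hgD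
    have h2 : (Q / M) ^ (-μ) = M ^ μ * Q ^ (-μ) := by
      rw [Real.div_rpow hQ0.le hM0.le, Real.rpow_neg hM0.le, div_inv_eq_mul, mul_comm]
    rw [h2] at h1
    calc _ ≤ C * D * (M ^ μ * Q ^ (-μ)) := h1
      _ ≤ (‖toL2 f‖ + C) * D * (M ^ 2 * Q ^ (-μ)) := by
          gcongr
          linarith [norm_nonneg (toL2 f)]
      _ = _ := by ring

end Decay

/-! ### Large-time behaviour of the classical orbits. -/

section FieldAsymptotics

variable {n : ℕ}

theorem exists_bound_of_periodic {F : Type*} [NormedAddCommGroup F] {f : ℝ → F}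
    (hc : Continuous f) (hp : ∀ t, f (t + 1) = f t) : ∃ K, 0 ≤ K ∧ ∀ t, ‖f t‖ ≤ K := by
  obtain ⟨K, hK⟩ := (isCompact_Icc (a := (0 : ℝ)) (b := 1)).exists_bound_of_continuousOn
    hc.continuousOn
  refine ⟨|K|, abs_nonneg _, fun t => ?_⟩
  have hper : Function.Periodic f 1 := hp
  obtain ⟨y, hy, hyt⟩ := hper.exists_mem_Ico₀ one_pos t
  rw [hyt]
  exact (hK y ⟨hy.1, hy.2.le⟩).trans (le_abs_self K)

theorem IsPeriodicField.integral_add_one {E : ℝ → Space n} (hE : IsPeriodicField E) (s t : ℝ) :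
    ∫ σ in s..(t + 1), E σ = (∫ σ in s..t, E σ) + meanField E := by
  have hi := hE.intervalIntegrable
  have h1 : ∫ σ in (1 : ℝ)..(t + 1), E σ = ∫ σ in (0 : ℝ)..t, E σ := by
    have h2 := intervalIntegral.integral_comp_add_right E (1 : ℝ) (a := 0) (b := t)
    rw [zero_add] at h2
    rw [← h2]
    refine intervalIntegral.integral_congr_ae ?_
    filter_upwards [hE.periodic] with r hr _ using hr
  rw [← intervalIntegral.integral_add_adjacent_intervals (hi s 0) (hi 0 (t + 1)),
    ← intervalIntegral.integral_add_adjacent_intervals (hi 0 1) (hi 1 (t + 1)), h1,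
    ← intervalIntegral.integral_add_adjacent_intervals (hi s 0) (hi 0 t), meanField]
  abel

/-- The displacement of a classical particle that is at rest at time `s`. -/
def displacement (E : ℝ → Space n) (s t : ℝ) : Space n := ∫ σ in s..t, ∫ r in s..σ, E r

theorem continuous_integral_field {E : ℝ → Space n} (hE : IsPeriodicField E) (s : ℝ) :
    Continuous fun t => ∫ σ in s..t, E σ := by
  have h : (fun t => ∫ σ in s..t, E σ) = fieldMomentum E s 0 := by
    funext t
    simp [fieldMomentum]
  rw [h]
  exact (hasACDeriv_fieldMomentum hE s 0).continuous

theorem fieldOrbit_position {E : ℝ → Space n} (hE : IsPeriodicField E) (s : ℝ) (η : Space n)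
    (t : ℝ) : (fieldOrbit E s η t).2.1 = (t - s) • η + displacement E s t := by
  simp only [fieldOrbit, fieldMomentum, displacement]
  rw [intervalIntegral.integral_add (by simp)
    ((continuous_integral_field hE s).intervalIntegrable _ _)]
  simp

/-- After removal of its mean growth, the primitive of E is 1-periodic and bounded; this gives the
second estimate. Its own primitive is linear, with slope the mean `c`, plus a periodic bounded
function; this gives the first. -/
theorem exists_displacement_asymptotics {E : ℝ → Space n} (hE : IsPeriodicField E) (s : ℝ) :
    ∃ (c : Space n) (K : ℝ), 0 ≤ K ∧
      (∀ t, ‖displacement E s t - ((t - s) ^ 2 / 2) • meanField E - (t - s) • c‖ ≤ K) ∧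
      (∀ t, ‖displacement E s t - ((t - s) ^ 2 / 2) • meanField E‖ ≤ K * |t - s|) := by
  set b : ℝ → Space n := fun t => (∫ σ in s..t, E σ) - (t - s) • meanField E with hb
  have hbc : Continuous b := by
    have := continuous_integral_field hE s
    fun_prop
  have hbp : ∀ t, b (t + 1) = b t := fun t => by
    simp only [hb, hE.integral_add_one]
    module
  obtain ⟨K₁, hK₁, hbK⟩ := exists_bound_of_periodic hbc hbp
  have hbi : ∀ t, ∫ σ in s..t, b σ = displacement E s t - ((t - s) ^ 2 / 2) • meanField E := by
    intro t
    simp only [hb]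
    rw [intervalIntegral.integral_sub ((continuous_integral_field hE s).intervalIntegrable _ _)
      (Continuous.intervalIntegrable (by fun_prop) _ _), intervalIntegral.integral_smul_const]
    have : ∫ σ in s..t, (σ - s) = (t - s) ^ 2 / 2 := by
      rw [intervalIntegral.integral_comp_sub_right (fun x => x), integral_id]
      simp
    rw [this, displacement]
  set c : Space n := ∫ σ in s..(s + 1), b σ with hc
  have hhc : Continuous fun t => ∫ σ in s..t, (b σ - c) :=
    intervalIntegral.continuous_primitive
      (fun _ _ => Continuous.intervalIntegrable (by fun_prop) _ _) s
  have hii : ∀ a a', IntervalIntegrable (fun σ => b σ - c) volume a a' := fun _ _ =>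
    Continuous.intervalIntegrable (by fun_prop) _ _
  have hper : Function.Periodic (fun σ => b σ - c) 1 := fun σ => by simp only [hbp]
  obtain ⟨K₂, hK₂, hhK⟩ := exists_bound_of_periodic hhc fun t => by
    rw [← intervalIntegral.integral_add_adjacent_intervals (hii s t) (hii t (t + 1)),
      hper.intervalIntegral_add_eq t s, intervalIntegral.integral_sub (b := s + 1)
      (hbc.intervalIntegrable _ _) (by simp), ← hc]
    simp
  refine ⟨c, K₁ + K₂, by positivity, fun t => ?_, fun t => ?_⟩
  · rw [← hbi]
    have h1 := hhK t
    rw [intervalIntegral.integral_sub (hbc.intervalIntegrable _ _) (by simp),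
      intervalIntegral.integral_const] at h1
    linarith
  · rw [← hbi]
    refine (intervalIntegral.norm_integral_le_of_norm_le_const fun x _ => hbK x).trans ?_
    gcongr
    linarith

/-- The orbit `z` is, in some direction and for all momenta in `K`, at distance at least of
order `Q` from the origin (or `Q` is bounded by `M`). -/
def IsFar (K : Set (Space n)) (M : ℝ) (z : ℝ × Space n × ℝ) (Q : ℝ) : Prop :=
  ∃ l : Space n, ‖l‖ = 1 ∧
    (Q ≤ M ∨ (2 * Real.pi * |z.1| ≤ M * Q ∧ ∀ ξ ∈ K, Q ≤ M * |symbolDen z l ξ|))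

theorem abs_le_one_add_pow (r : ℝ) {a : ℕ} (ha : 1 ≤ a) : |r| ≤ (1 + |r|) ^ a := by
  have h1 : 1 + |r| ≤ (1 + |r|) ^ a := le_self_pow₀ (by linarith [abs_nonneg r]) (by omega)
  linarith

/-- In the direction e the position is (t-s)(2πξ + c)·e + O(1). Momenta on the hyperplane (2πξ +
c)·e = 0 need not move away along e and are excluded; on a compact set off the hyperplane the
coefficient is bounded below. -/
theorem exists_isFar_of_meanField_eq_zero {E : ℝ → Space n} (hE : IsPeriodicField E)
    (h0 : meanField E = 0) (s : ℝ) {e : Space n} (he : ‖e‖ = 1) :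
    ∃ c : Space n, ∀ K : Set (Space n), IsCompact K →
      K ⊆ {ξ | 2 * Real.pi * inner ℝ ξ e + inner ℝ c e ≠ 0} →
      ∃ M, 1 ≤ M ∧ ∀ t, IsFar K M (fieldOrbit E s 0 t) ((1 + |t - s|) ^ 1) := by
  obtain ⟨c, C, hC0, hC, -⟩ := exists_displacement_asymptotics hE s
  refine ⟨c, fun K hK hKs => ?_⟩
  obtain ⟨ε, hε, hεK⟩ : ∃ ε : ℝ, 0 < ε ∧ ∀ ξ ∈ K, ε ≤ |2 * Real.pi * inner ℝ ξ e + inner ℝ c e| := by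
    rcases K.eq_empty_or_nonempty with rfl | hne
    · exact ⟨1, one_pos, by simp⟩
    · obtain ⟨ξ₀, h1, h2⟩ := hK.exists_isMinOn hne
        (f := fun ξ => |2 * Real.pi * inner ℝ ξ e + inner ℝ c e|) (by fun_prop)
      exact ⟨_, abs_pos.2 (hKs h1), fun ξ hξ => h2 hξ⟩
  -- Beyond T₀ the bounded error C is at most half of ε|T|, and |T| ≥ 1.
  set T₀ : ℝ := 1 + 2 * C / ε with hT₀
  have hT₀1 : 1 ≤ T₀ := by rw [hT₀]; linarith [div_nonneg (mul_nonneg zero_le_two hC0) hε.le]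
  have hM4 : 0 < 4 / ε := by positivity
  refine ⟨1 + T₀ + 4 / ε + 2 * Real.pi, by linarith [Real.pi_pos], fun t => ⟨e, he, ?_⟩⟩
  set T := t - s with hT
  rw [pow_one]
  rcases le_total |T| T₀ with h | h
  · left
    linarith [Real.pi_pos]
  · right
    refine ⟨?_, fun ξ hξ => ?_⟩
    · have h1 : (fieldOrbit E s 0 t).1 = T := rfl
      rw [h1]
      have := Real.pi_pos
      calc 2 * Real.pi * |T| ≤ (1 + T₀ + 4 / ε + 2 * Real.pi) * |T| := by gcongr; linarith
        _ ≤ _ := by gcongr; linarith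
    · have h1 : symbolDen (fieldOrbit E s 0 t) e ξ = T * (2 * Real.pi * inner ℝ ξ e + inner ℝ c e)
          + inner ℝ (displacement E s t - (T ^ 2 / 2) • meanField E - T • c) e := by
        rw [symbolDen, fieldOrbit_position hE, h0]
        have : (fieldOrbit E s 0 t).1 = T := rfl
        rw [this]
        simp only [smul_zero, zero_add, sub_zero, inner_sub_left, real_inner_smul_left]
        ring
      have h2 : |inner ℝ (displacement E s t - (T ^ 2 / 2) • meanField E - T • c) e| ≤ C := by
        refine (abs_real_inner_le_norm _ _).trans ?_
        rw [he, mul_one]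
        exact hC t
      have h3 : ε * |T| - C ≤ |symbolDen (fieldOrbit E s 0 t) e ξ| := by
        have h4 : ε * |T| ≤ |T * (2 * Real.pi * inner ℝ ξ e + inner ℝ c e)| := by
          rw [abs_mul, mul_comm]
          gcongr
          exact hεK ξ hξ
        rw [h1]
        set u := T * (2 * Real.pi * inner ℝ ξ e + inner ℝ c e)
        set r := inner ℝ (displacement E s t - (T ^ 2 / 2) • meanField E - T • c) e
        have := abs_sub_abs_le_abs_sub u (-r)
        rw [abs_neg, sub_neg_eq_add] at this
        linarith
      have h5 : C ≤ ε * |T| / 2 := by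
        have : 2 * C / ε ≤ |T| := by linarith
        rw [div_le_iff₀ hε] at this
        linarith
      have h6 : ε * (1 + |T|) ≤ 4 * |symbolDen (fieldOrbit E s 0 t) e ξ| := by nlinarith
      calc 1 + |T| = (ε * (1 + |T|)) / ε := by field_simp
        _ ≤ (4 * |symbolDen (fieldOrbit E s 0 t) e ξ|) / ε := by gcongr
        _ = (4 / ε) * |symbolDen (fieldOrbit E s 0 t) e ξ| := by ring
        _ ≤ _ := by gcongr; linarith [Real.pi_pos]

/-- Along E₀ the acceleration term (t-s)²|E₀|/2 eventually beats any bounded initial momentum, so no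
momenta have to be excluded. -/
theorem exists_isFar_of_meanField_ne_zero {E : ℝ → Space n} (hE : IsPeriodicField E)
    (h0 : meanField E ≠ 0) (s : ℝ) (K : Set (Space n)) (hK : IsCompact K) :
    ∃ M, 1 ≤ M ∧ ∀ t, IsFar K M (fieldOrbit E s 0 t) ((1 + |t - s|) ^ 2) := by
  obtain ⟨-, C, hC0, -, hC⟩ := exists_displacement_asymptotics hE s
  set F : ℝ := ‖meanField E‖ with hF
  have hF0 : 0 < F := norm_pos_iff.2 h0
  set e : Space n := F⁻¹ • meanField E with he'
  have he : ‖e‖ = 1 := by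
    rw [he', norm_smul, norm_inv, Real.norm_of_nonneg hF0.le, ← hF, inv_mul_cancel₀ hF0.ne']
  have hee : inner ℝ (meanField E) e = F := by
    rw [he', real_inner_smul_right, real_inner_self_eq_norm_sq, ← hF]
    field_simp
  obtain ⟨R, hR0, hR⟩ : ∃ R : ℝ, 0 ≤ R ∧ ∀ ξ ∈ K, ‖ξ‖ ≤ R := by
    obtain ⟨R, hR⟩ := hK.exists_bound_of_continuousOn (f := fun ξ : Space n => ξ) (by fun_prop)
    exact ⟨|R|, abs_nonneg _, fun ξ hξ => (hR ξ hξ).trans (le_abs_self R)⟩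
  have hpi := Real.pi_pos
  set N : ℝ := 2 * Real.pi * R + C with hN
  have hN0 : 0 ≤ N := by positivity
  -- Beyond T₀ the linear terms N|T| use up at most half of the quadratic term FT²/2.
  set T₀ : ℝ := 1 + 4 * N / F with hT₀
  have hT₀1 : 1 ≤ T₀ := by rw [hT₀]; linarith [div_nonneg (mul_nonneg zero_le_four hN0) hF0.le]
  have hM4 : 0 < 16 / F := by positivity
  refine ⟨(1 + T₀) ^ 2 + 16 / F + 2 * Real.pi, by nlinarith, fun t => ⟨e, he, ?_⟩⟩
  set T := t - s with hT
  rcases le_total |T| T₀ with h | h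
  · left
    have : (1 + |T|) ^ 2 ≤ (1 + T₀) ^ 2 := by gcongr
    linarith
  · right
    refine ⟨?_, fun ξ hξ => ?_⟩
    · have h1 : (fieldOrbit E s 0 t).1 = T := rfl
      rw [h1]
      calc 2 * Real.pi * |T| ≤ ((1 + T₀) ^ 2 + 16 / F + 2 * Real.pi) * |T| := by
            gcongr
            nlinarith
        _ ≤ _ := by
            gcongr
            exact abs_le_one_add_pow T one_le_two
    · have h1 : symbolDen (fieldOrbit E s 0 t) e ξ = (T ^ 2 / 2) * F
          + (T * (2 * Real.pi * inner ℝ ξ e)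
          + inner ℝ (displacement E s t - (T ^ 2 / 2) • meanField E) e) := by
        rw [symbolDen, fieldOrbit_position hE, ← hee]
        have : (fieldOrbit E s 0 t).1 = T := rfl
        rw [this]
        simp only [smul_zero, zero_add, inner_sub_left, real_inner_smul_left]
        ring
      have h2 : |T * (2 * Real.pi * inner ℝ ξ e)
          + inner ℝ (displacement E s t - (T ^ 2 / 2) • meanField E) e| ≤ N * |T| := by
        refine (abs_add_le _ _).trans ?_
        have e1 : |inner ℝ ξ e| ≤ R := by
          refine (abs_real_inner_le_norm _ _).trans ?_
          rw [he, mul_one]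
          exact hR ξ hξ
        have e2 : |inner ℝ (displacement E s t - (T ^ 2 / 2) • meanField E) e| ≤ C * |T| := by
          refine (abs_real_inner_le_norm _ _).trans ?_
          rw [he, mul_one]
          exact hC t
        rw [abs_mul, abs_mul, abs_of_pos (by positivity : 0 < 2 * Real.pi)]
        calc |T| * (2 * Real.pi * |inner ℝ ξ e|) + _ ≤ |T| * (2 * Real.pi * R) + C * |T| := by
              gcongr
          _ = _ := by rw [hN]; ring
      have hTT : T ^ 2 = |T| * |T| := by rw [← sq, sq_abs]
      have h5 : N ≤ F * |T| / 4 := by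
        have : 4 * N / F ≤ |T| := by linarith
        rw [div_le_iff₀ hF0] at this
        linarith
      have h3 : F * |T| ^ 2 / 4 ≤ |symbolDen (fieldOrbit E s 0 t) e ξ| := by
        rw [h1]
        set r := T * (2 * Real.pi * inner ℝ ξ e)
          + inner ℝ (displacement E s t - (T ^ 2 / 2) • meanField E) e
        have h6 := neg_abs_le r
        have h7 := le_abs_self (T ^ 2 / 2 * F + r)
        have h8 : N * |T| ≤ F * |T| / 4 * |T| := by gcongr
        rw [sq_abs]
        rw [hTT] at *
        nlinarith
      have h6 : F * (1 + |T|) ^ 2 ≤ 16 * |symbolDen (fieldOrbit E s 0 t) e ξ| := by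
        have h7 : (1 + |T|) ^ 2 ≤ 4 * |T| ^ 2 := by nlinarith
        nlinarith
      calc (1 + |T|) ^ 2 = (F * (1 + |T|) ^ 2) / F := by field_simp
        _ ≤ (16 * |symbolDen (fieldOrbit E s 0 t) e ξ|) / F := by gcongr
        _ = (16 / F) * |symbolDen (fieldOrbit E s 0 t) e ξ| := by ring
        _ ≤ _ := by gcongr; nlinarith

set_option maxHeartbeats 600000 in
/-- At high velocity orthogonal to the mean field, the classical orbits move away from the
origin at least like `v |t - s|` and `|t - s| ^ a`. -/
theorem exists_isFar_highVelocity {E : ℝ → Space n} (hE : IsPeriodicField E) (s : ℝ)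
    {w : Space n} (hw : ‖w‖ = 1) (hwE : inner ℝ w (meanField E) = 0) {a : ℕ}
    (ha : a = 1 ∨ a = 2 ∧ meanField E ≠ 0) (R : ℝ) :
    ∃ M v₀, 1 ≤ M ∧ 1 ≤ v₀ ∧ ∀ v, v₀ ≤ v → ∀ t,
      IsFar (Metric.closedBall 0 R) M (fieldOrbit E s (v • w) t) (1 + v * |t - s|) ∧
      IsFar (Metric.closedBall 0 R) M (fieldOrbit E s (v • w) t) ((1 + |t - s|) ^ a) ∧
      1 + v * |t - s| ≤ M * bracket (fieldOrbit E s (v • w) t).2.1 ∧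
      (1 + |t - s|) ^ a ≤ M * bracket (fieldOrbit E s (v • w) t).2.1 := by
  obtain ⟨-, C, hC0, -, hC⟩ := exists_displacement_asymptotics hE s
  -- Truncating the field strength at 1 makes 32/F at least 32, so that one constant serves every
  -- estimate. For a = 1 the field strength plays no role.
  obtain ⟨F, hF0, hF, hFE⟩ : ∃ F : ℝ, 0 < F ∧ F ≤ 1 ∧ (a = 2 → F ≤ ‖meanField E‖) := by
    rcases ha with rfl | ⟨rfl, h⟩
    · exact ⟨1, one_pos, le_rfl, by simp⟩
    · exact ⟨min 1 ‖meanField E‖, lt_min one_pos (norm_pos_iff.2 h), min_le_left _ _,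
        fun _ => min_le_right _ _⟩
  have hpi := Real.pi_pos
  have hpi4 := Real.pi_le_four
  have hM32 : 32 ≤ 32 / F := by rw [le_div_iff₀ hF0]; linarith
  have hR0 := abs_nonneg R
  -- This threshold for v makes half of v|T| absorb both the oscillating displacement C|T| and the
  -- spread 2π|R||T| of the momenta.
  refine ⟨32 / F, 1 + 2 * C + 4 * Real.pi * |R|, by linarith, by nlinarith, fun v hv t => ?_⟩
  set T := t - s with hT
  set y := (fieldOrbit E s (v • w) t).2.1 with hy
  have hz1 : (fieldOrbit E s (v • w) t).1 = T := rfl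
  have hv1 : 1 ≤ v := by nlinarith
  have hT0 := abs_nonneg T
  -- The main part of the orbit. As w ⟂ E₀, Pythagoras bounds ‖u‖ below by each of its two terms.
  set u : Space n := (T * v) • w + (T ^ 2 / 2) • meanField E with hu
  have hu2 : ‖u‖ ^ 2 = (v * |T|) ^ 2 + (T ^ 2 / 2 * ‖meanField E‖) ^ 2 := by
    rw [hu, norm_add_sq_real, inner_smul_left, inner_smul_right, hwE, norm_smul, norm_smul, hw,
      mul_pow ‖_‖, Real.norm_eq_abs, Real.norm_eq_abs, sq_abs, mul_pow _ ‖_‖, sq_abs, mul_pow v,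
      sq_abs]
    simp
    ring
  have hu1 : v * |T| ≤ ‖u‖ :=
    abs_le_of_sq_le_sq' (by rw [hu2]; nlinarith [sq_nonneg (T ^ 2 / 2 * ‖meanField E‖)])
      (norm_nonneg _) |>.2
  have hu3 : T ^ 2 / 2 * ‖meanField E‖ ≤ ‖u‖ :=
    abs_le_of_sq_le_sq' (by rw [hu2]; nlinarith [sq_nonneg (v * |T|)]) (norm_nonneg _) |>.2
  have hyu : ‖u‖ - C * |T| ≤ ‖y‖ := by
    have h1 : y = u + (displacement E s t - (T ^ 2 / 2) • meanField E) := by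
      rw [hy, fieldOrbit_position hE, hu, smul_smul]
      abel
    have h2 := norm_sub_le y (displacement E s t - (T ^ 2 / 2) • meanField E)
    rw [h1, add_sub_cancel_right, ← h1] at h2
    linarith [hC t]
  set d := ‖u‖ / 2 with hd
  have hRT : (C + 2 * Real.pi * |R|) * |T| ≤ d := by nlinarith
  have hRT' : 0 ≤ 2 * Real.pi * |R| * |T| := by positivity
  have hyd : d + 2 * Real.pi * |R| * |T| ≤ ‖y‖ := by linarith
  -- The direction of the orbit point y itself; if y = 0 any unit vector will do.
  obtain ⟨l, hl, hld⟩ : ∃ l : Space n, ‖l‖ = 1 ∧ ∀ ξ ∈ Metric.closedBall (0 : Space n) R,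
      d ≤ |symbolDen (fieldOrbit E s (v • w) t) l ξ| := by
    obtain ⟨l, hl, hly⟩ : ∃ l : Space n, ‖l‖ = 1 ∧ inner ℝ y l = ‖y‖ := by
      by_cases h : y = 0
      · exact ⟨w, hw, by simp [h]⟩
      · refine ⟨‖y‖⁻¹ • y, by rw [norm_smul]; simp [h], ?_⟩
        rw [real_inner_smul_right, real_inner_self_eq_norm_sq]
        have := norm_ne_zero_iff.2 h
        field_simp
    refine ⟨l, hl, fun ξ hξ => ?_⟩
    rw [symbolDen, ← hy, hz1, hly]
    have h1 : |inner ℝ ξ l| ≤ |R| := by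
      refine (abs_real_inner_le_norm _ _).trans ?_
      rw [hl, mul_one]
      exact (mem_closedBall_zero_iff.1 hξ).trans (le_abs_self R)
    have h2 : |2 * Real.pi * T * inner ℝ ξ l| ≤ 2 * Real.pi * |R| * |T| := by
      rw [abs_mul, abs_mul, abs_of_pos (by positivity : 0 < 2 * Real.pi)]
      calc _ ≤ 2 * Real.pi * |T| * |R| := by gcongr
        _ = _ := by ring
    have h3 := neg_abs_le (2 * Real.pi * T * inner ℝ ξ l)
    exact le_trans (by linarith) (le_abs_self _)
  have hd0 : 0 ≤ d := by positivity
  have hcase : ∀ Q : ℝ, |T| ≤ Q → (Q ≤ 32 / F ∨ Q ≤ 32 / F * d) →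
      IsFar (Metric.closedBall 0 R) (32 / F) (fieldOrbit E s (v • w) t) Q ∧
        Q ≤ 32 / F * bracket y := by
    intro Q hTQ hQ
    have h1 : 2 * Real.pi * |(fieldOrbit E s (v • w) t).1| ≤ 32 / F * Q := by
      rw [hz1]
      calc 2 * Real.pi * |T| ≤ 32 * |T| := by gcongr; linarith
        _ ≤ _ := by gcongr
    refine ⟨⟨l, hl, hQ.imp_right fun h => ⟨h1, fun ξ hξ => h.trans
      (mul_le_mul_of_nonneg_left (hld ξ hξ) (by positivity))⟩⟩, ?_⟩
    · rcases hQ with h | h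
      · refine h.trans (le_mul_of_one_le_right (by positivity) (one_le_bracket _))
      · refine h.trans ?_
        gcongr
        linarith [norm_le_bracket y]
  have hTv : |T| ≤ v * |T| := le_mul_of_one_le_left hT0 hv1
  have hA := hcase (1 + v * |T|) (by linarith) (by
    rcases le_total (v * |T|) 1 with h | h
    · left; linarith
    · right
      calc 1 + v * |T| ≤ 32 * d := by linarith
        _ ≤ _ := by gcongr)
  have hB := hcase ((1 + |T|) ^ a) (abs_le_one_add_pow T (by omega)) (by
    rcases le_total |T| 1 with h | h
    · left
      rcases ha with rfl | ⟨rfl, -⟩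
      · linarith
      · nlinarith
    · right
      rcases ha with rfl | ⟨rfl, -⟩
      · calc (1 + |T|) ^ 1 ≤ 32 * d := by linarith
          _ ≤ _ := by gcongr
      · have hFE' := hFE rfl
        have h1 : T ^ 2 / 2 * F ≤ T ^ 2 / 2 * ‖meanField E‖ := by gcongr
        have h2 : (1 + |T|) ^ 2 ≤ 4 * T ^ 2 := by
          rw [← sq_abs T]
          nlinarith only [h]
        rw [div_mul_eq_mul_div, le_div_iff₀ hF0]
        calc (1 + |T|) ^ 2 * F ≤ 4 * T ^ 2 * F := by gcongr
          _ ≤ _ := by linarith)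
  exact ⟨hA.1, hB.1, hA.2, hB.2⟩

end FieldAsymptotics

/-! ### Existence of the wave operators. -/

section WaveOperators

variable {n : ℕ}

theorem IsPotential.mono {δ δ' : ℝ} {V : ℝ → Space n → ℝ} (h : δ' ≤ δ) (hV : IsPotential δ V) :
    IsPotential δ' V where
  smooth := hV.smooth
  periodic := hV.periodic
  decay k m := by
    obtain ⟨C, hC⟩ := hV.decay k m
    refine ⟨|C|, fun t x => (hC t x).trans ?_⟩
    have h1 : bracket x ^ (-δ - (m : ℝ)) ≤ bracket x ^ (-δ' - (m : ℝ)) :=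
      Real.rpow_le_rpow_of_exponent_le (one_le_bracket x) (by linarith)
    have h2 : (0 : ℝ) ≤ bracket x ^ (-δ - (m : ℝ)) := Real.rpow_nonneg (bracket_pos x).le _
    calc C * bracket x ^ (-δ - (m : ℝ)) ≤ |C| * bracket x ^ (-δ - (m : ℝ)) := by
          gcongr
          exact le_abs_self C
      _ ≤ _ := by gcongr

theorem exists_tendsto_of_hasDerivAt_of_integrable {F : Type*} [NormedAddCommGroup F]
    [NormedSpace ℝ F] [CompleteSpace F] {u u' : ℝ → F} (h : ∀ t, HasDerivAt u (u' t) t)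
    (hi : Integrable u') :
    (∃ a, Tendsto u atTop (𝓝 a)) ∧ ∃ a, Tendsto u atBot (𝓝 a) :=
  ⟨⟨_, tendsto_limUnder_of_hasDerivAt_of_integrableOn_Ioi (a := 0) (fun t _ => h t)
    hi.integrableOn⟩,
  ⟨_, tendsto_limUnder_of_hasDerivAt_of_integrableOn_Iic (a := 0) (fun t _ => h t)
    hi.integrableOn⟩⟩

theorem integrable_one_add_abs_rpow {r : ℝ} (hr : 1 < r) :
    Integrable fun t : ℝ => (1 + |t|) ^ (-r) := by
  have := integrable_one_add_norm (E := ℝ) (μ := volume) (r := r) (by simpa using hr)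
  simpa using this

theorem integrable_one_add_abs_sub_pow_rpow {a : ℕ} {δ : ℝ} (h : 1 < a * δ) (s : ℝ) :
    Integrable fun t : ℝ => ((1 + |t - s|) ^ a) ^ (-δ) := by
  have h1 := (integrable_one_add_abs_rpow h).comp_sub_right s
  refine h1.congr (Eventually.of_forall fun t => ?_)
  simp only
  rw [← Real.rpow_natCast, ← Real.rpow_mul (by positivity)]
  congr 1
  ring

theorem norm_toL2_realMul_twist {g : Space n → ℝ}
    (hg : Function.HasTemperateGrowth (fun x : Space n => ((g x : ℝ) : ℂ))) {b : Space n → ℝ}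
    (hb : Function.HasTemperateGrowth b) (φ : 𝓢(Space n, ℂ)) :
    ‖toL2 (realMul g (twist b φ))‖ = ‖toL2 (realMul g φ)‖ := by
  have : realMul g (twist b φ) = twist b (realMul g φ) := by
    ext x
    rw [realMul_apply hg, twist_apply hb, twist_apply hb, realMul_apply hg]
    ring
  rw [this, norm_toL2_twist hb]

theorem hasTemperateGrowth_momentumPhase (b : Space n) :
    Function.HasTemperateGrowth (fun x : Space n => momentumPhase x b) :=
  isPhaseFamily_momentumPhase.temperate b

theorem twist_momentumPhase_zero (φ : 𝓢(Space n, ℂ)) :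
    twist (fun x => momentumPhase x 0) φ = φ := by
  ext x
  rw [twist_apply (hasTemperateGrowth_momentumPhase 0)]
  simp [momentumPhase]

theorem IsFar.norm_toL2_realMul_freeEvol_le {f : 𝓢(Space n, ℂ)} (hf : HasCompactSupport f) {M : ℝ}
    (hM : 1 ≤ M) {K : Set (Space n)} (hK : tsupport f ⊆ K) :
    ∃ C, 0 ≤ C ∧ ∀ z Q, 1 ≤ Q → IsFar K M z Q →
      ∀ (g : Space n → ℝ) (D μ : ℝ),
        Function.HasTemperateGrowth (fun x : Space n => ((g x : ℝ) : ℂ)) → 0 ≤ D →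
        0 ≤ μ → μ ≤ 2 → (∀ x, |g x| ≤ D * bracket x ^ (-μ)) →
        ‖toL2 (realMul g (freeEvol z f))‖ ≤ C * D * Q ^ (-μ) := by
  obtain ⟨C, hC0, hC⟩ := exists_freeEvol_decay f hf hM
  refine ⟨C, hC0, fun z Q hQ ⟨l, hl, h⟩ => hC z l Q hl hQ ?_⟩
  exact h.imp_right fun h => ⟨h.1, fun ξ hξ => h.2 ξ (hK hξ)⟩

/-- Cook's method: by the propagation estimate the derivative is O((1+|t-s|)^{-aδ}) in norm, hence
integrable over the whole line. -/
theorem exists_tendsto_of_isFar {δ : ℝ} (hδ : 0 < δ) (hδ2 : δ ≤ 2) {E : ℝ → Space n}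
    (hE : IsPeriodicField E) {V : ℝ → Space n → ℝ} (hV : IsPotential δ V)
    {U₀ U : ℝ → ℝ → (L2 n ≃ₗᵢ[ℂ] L2 n)} (hU₀ : IsPropagator (freeHamiltonian E) U₀)
    (hU : IsPropagator (hamiltonian E V) U) (s : ℝ) {a : ℕ} (ha : 1 < a * δ)
    {f : 𝓢(Space n, ℂ)} (hf : HasCompactSupport f) {K : Set (Space n)} (hK : tsupport f ⊆ K) {M : ℝ}
    (hM : 1 ≤ M) (hfar : ∀ t, IsFar K M (fieldOrbit E s 0 t) ((1 + |t - s|) ^ a)) :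
    (∃ W, Tendsto (fun t => U s t (U₀ t s (toL2 (𝓕⁻ f)))) atTop (𝓝 W)) ∧
      ∃ W, Tendsto (fun t => U s t (U₀ t s (toL2 (𝓕⁻ f)))) atBot (𝓝 W) := by
  have h1 : ∀ t, U₀ t s (toL2 (𝓕⁻ f)) = toL2 (freeSolution E s 0 f t) := fun t => by
    rw [← hU₀.apply_freeSolution hE s 0 f t, twist_momentumPhase_zero]
  simp only [h1]
  refine exists_tendsto_of_hasDerivAt_of_integrable
    (hasDerivAt_propagator_freeSolution hδ hE hV hU s 0 f) ?_
  obtain ⟨C, hC0, hC⟩ := IsFar.norm_toL2_realMul_freeEvol_le hf hM hK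
  obtain ⟨D, hD0, hD⟩ := hV.exists_bound
  refine ((integrable_one_add_abs_sub_pow_rpow ha s).const_mul (C * D)).mono'
    (Continuous.aestronglyMeasurable ?_) (Eventually.of_forall fun t => ?_)
  · refine (continuous_const_smul Complex.I).comp (continuous_propagator_apply hU s ?_)
    exact hV.continuous_toL2_realMul hδ (hasACDeriv_freeSolution hE s 0 f).continuous
  · rw [norm_smul, Complex.norm_I, one_mul, LinearIsometryEquiv.norm_map, freeSolution,
      norm_toL2_realMul_twist (hV.hasTemperateGrowth hδ t) (hasTemperateGrowth_momentumPhase _)]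
    exact hC _ _ (one_le_pow₀ (by linarith [abs_nonneg (t - s)])) (hfar t) (V t) D δ
      (hV.hasTemperateGrowth hδ t) hD0 hδ.le hδ2 (hD t)

/-- The vectors on which a family of isometries has a strong limit. -/
def limitSubmodule {ι F : Type*} [NormedAddCommGroup F] [InnerProductSpace ℂ F]
    (T : ι → F →ₗᵢ[ℂ] F) (l : Filter ι) : Submodule ℂ F where
  carrier := {g | ∃ y, Tendsto (fun t => T t g) l (𝓝 y)}
  zero_mem' := ⟨0, by simpa using tendsto_const_nhds⟩
  add_mem' := by
    rintro g h ⟨y, hy⟩ ⟨z, hz⟩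
    exact ⟨y + z, by simpa using hy.add hz⟩
  smul_mem' := by
    rintro c g ⟨y, hy⟩
    exact ⟨c • y, by simpa using hy.const_smul c⟩

/-- Isometries are equicontinuous, so the Cauchy property passes to limits of vectors by an ε/4
argument. -/
theorem isClosed_limitSubmodule {ι F : Type*} [NormedAddCommGroup F] [InnerProductSpace ℂ F]
    [CompleteSpace F] (T : ι → F →ₗᵢ[ℂ] F) (l : Filter ι) [l.NeBot] :
    IsClosed (limitSubmodule T l : Set F) := by
  refine isClosed_of_closure_subset fun g hg => ?_
  change ∃ y, Tendsto (fun t => T t g) l (𝓝 y)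
  rw [← cauchy_map_iff_exists_tendsto, Metric.cauchy_iff]
  refine ⟨inferInstance, fun ε hε => ?_⟩
  obtain ⟨h, ⟨y, hy⟩, hgh⟩ := Metric.mem_closure_iff.1 hg (ε / 4) (by positivity)
  have h1 := hy (Metric.ball_mem_nhds y (by positivity : 0 < ε / 4))
  refine ⟨_, image_mem_map h1, ?_⟩
  rintro - ⟨i, hi, rfl⟩ - ⟨j, hj, rfl⟩
  have hi' : dist (T i h) y < ε / 4 := hi
  have hj' : dist (T j h) y < ε / 4 := hj
  have e1 : dist (T i g) (T i h) < ε / 4 := by rwa [(T i).dist_map]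
  have e2 : dist (T j g) (T j h) < ε / 4 := by rwa [(T j).dist_map]
  have e3 := dist_triangle4 (T i g) (T i h) (T j h) (T j g)
  have e4 := dist_triangle_right (T i h) (T j h) y
  rw [dist_comm (T j h)] at e3
  linarith

/-- By Plancherel, 𝓕g integrates to zero against all real test functions supported in O. So it
vanishes almost everywhere on O, which has full measure. This is the density statement needed for
the wave operators. -/
theorem eq_zero_of_inner_fourierInv_eq_zero {O : Set (Space n)} (hO : IsOpen O)
    (hO' : volume Oᶜ = 0) {g : L2 n}
    (h : ∀ f : 𝓢(Space n, ℂ), HasCompactSupport f → tsupport f ⊆ O →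
      inner ℂ (toL2 (𝓕⁻ f)) g = 0) : g = 0 := by
  have hloc : LocallyIntegrable (𝓕 g : L2 n) volume :=
    (Lp.memLp (𝓕 g : L2 n)).locallyIntegrable (by norm_num)
  have h0 : ∀ᵐ ξ, ξ ∈ O → (𝓕 g : L2 n) ξ = 0 := by
    refine hO.ae_eq_zero_of_integral_contDiff_smul_eq_zero (hloc.locallyIntegrableOn O)
      fun ρ hρ hρc hρO => ?_
    have hc : HasCompactSupport fun ξ => (ρ ξ : ℂ) := hρc.comp_left (g := fun r : ℝ => (r : ℂ)) rfl
    have hd : ContDiff ℝ ((⊤ : ℕ∞) : WithTop ℕ∞) fun ξ => (ρ ξ : ℂ) :=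
      Complex.ofRealCLM.contDiff.comp hρ
    have hts : tsupport (fun ξ => (ρ ξ : ℂ)) ⊆ O :=
      (closure_mono (Function.support_comp_subset (g := fun r : ℝ => (r : ℂ)) rfl ρ)).trans hρO
    have h1 := h (hc.toSchwartzMap hd) hc hts
    rw [← MeasureTheory.Lp.inner_fourier_eq, SchwartzMap.toLp_fourier_eq,
      FourierTransform.fourier_fourierInv_eq, L2.inner_def] at h1
    rw [← h1]
    refine integral_congr_ae ?_
    filter_upwards [(hc.toSchwartzMap hd).coeFn_toLp 2 volume] with ξ hξ
    rw [hξ]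
    change _ = (𝓕 g : L2 n) ξ * (starRingEnd ℂ) (ρ ξ : ℂ)
    rw [Complex.conj_ofReal, Complex.real_smul, mul_comm]
  have h2 : (𝓕 g : L2 n) = 0 := by
    refine Lp.ext ?_
    have h3 : ∀ᵐ ξ, ξ ∈ O := by
      rw [ae_iff]
      exact hO'
    filter_upwards [h0, h3, Lp.coeFn_zero ℂ 2 (volume : Measure (Space n))] with ξ h4 h5 h6
    rw [h4 h5, h6, Pi.zero_apply]
  have h3 := MeasureTheory.Lp.norm_fourier_eq g
  rw [h2, norm_zero] at h3
  exact norm_eq_zero.1 h3.symm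

theorem volume_hyperplane_eq_zero {e : Space n} (he : ‖e‖ = 1) (r : ℝ) :
    volume {ξ : Space n | 2 * Real.pi * inner ℝ ξ e + r ≠ 0}ᶜ = 0 := by
  have h1 : (volume : Measure (Space n)) ((ℝ ∙ e)ᗮ : Submodule ℝ (Space n)) = 0 := by
    refine Measure.addHaar_submodule _ _ fun h => ?_
    have : e ∈ (ℝ ∙ e)ᗮ := h ▸ Submodule.mem_top
    rw [Submodule.mem_orthogonal_singleton_iff_inner_right, real_inner_self_eq_norm_sq, he] at this
    norm_num at this
  rw [← h1, ← measure_preimage_add_right volume ((r / (2 * Real.pi)) • e)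
    ((ℝ ∙ e)ᗮ : Submodule ℝ (Space n))]
  congr 1
  ext ξ
  have hpi := Real.pi_pos
  simp only [Set.mem_compl_iff, Set.mem_ofPred_eq, not_not, Set.mem_preimage, SetLike.mem_coe,
    Submodule.mem_orthogonal_singleton_iff_inner_right, inner_add_right, real_inner_smul_right,
    real_inner_self_eq_norm_sq, he, real_inner_comm ξ e]
  field_simp
  constructor <;> intro h <;> linarith

theorem exists_waveOperators {δ : ℝ} (hδ : 0 < δ) (hδ2 : δ ≤ 2) {E : ℝ → Space n}
    (hE : IsPeriodicField E) {V : ℝ → Space n → ℝ} (hV : IsPotential δ V)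
    {U₀ U : ℝ → ℝ → (L2 n ≃ₗᵢ[ℂ] L2 n)} (hU₀ : IsPropagator (freeHamiltonian E) U₀)
    (hU : IsPropagator (hamiltonian E V) U) (s : ℝ) {a : ℕ} (ha : 1 < a * δ)
    {O : Set (Space n)} (hO : IsOpen O) (hO' : volume Oᶜ = 0)
    (hfar : ∀ K, IsCompact K → K ⊆ O →
      ∃ M, 1 ≤ M ∧ ∀ t, IsFar K M (fieldOrbit E s 0 t) ((1 + |t - s|) ^ a)) :
    ∃ Wp Wm : L2 n →L[ℂ] L2 n, IsWaveOperator U U₀ s atTop Wp ∧ IsWaveOperator U U₀ s atBot Wm := by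
  set T : ℝ → L2 n →ₗᵢ[ℂ] L2 n := fun t => ((U₀ t s).trans (U s t)).toLinearIsometry with hT
  have key : ∀ l : Filter ℝ, l.NeBot → l.IsCountablyGenerated →
      (∀ f : 𝓢(Space n, ℂ), HasCompactSupport f → tsupport f ⊆ O →
        toL2 (𝓕⁻ f) ∈ limitSubmodule T l) →
      ∃ W : L2 n →L[ℂ] L2 n, IsWaveOperator U U₀ s l W := by
    intro l hl hl' h
    have htop : limitSubmodule T l = ⊤ := by
      have h1 : (limitSubmodule T l).topologicalClosure = ⊤ := by
        rw [Submodule.topologicalClosure_eq_top_iff, Submodule.eq_bot_iff]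
        intro g hg
        exact eq_zero_of_inner_fourierInv_eq_zero hO hO' fun f hf hfO =>
          (Submodule.mem_orthogonal _ _).1 hg _ (h f hf hfO)
      rwa [(isClosed_limitSubmodule T l).submodule_topologicalClosure_eq] at h1
    have h2 : ∀ g, ∃ y, Tendsto (fun t => T t g) l (𝓝 y) := fun g => by
      have : g ∈ limitSubmodule T l := htop ▸ Submodule.mem_top
      exact this
    choose W hW using h2
    exact ⟨continuousLinearMapOfTendsto (fun t => (T t).toContinuousLinearMap) (f := W)
      (tendsto_pi_nhds.2 hW), hW⟩
  have hlim : ∀ f : 𝓢(Space n, ℂ), HasCompactSupport f → tsupport f ⊆ O →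
      toL2 (𝓕⁻ f) ∈ limitSubmodule T atTop ∧ toL2 (𝓕⁻ f) ∈ limitSubmodule T atBot := by
    intro f hf hfO
    obtain ⟨M, hM, h⟩ := hfar _ hf hfO
    exact exists_tendsto_of_isFar hδ hδ2 hE hV hU₀ hU s ha hf subset_rfl hM h
  obtain ⟨Wp, hp⟩ := key atTop inferInstance inferInstance fun f hf hfO => (hlim f hf hfO).1
  obtain ⟨Wm, hm⟩ := key atBot inferInstance inferInstance fun f hf hfO => (hlim f hf hfO).2
  exact ⟨Wp, Wm, hp, hm⟩

end WaveOperators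

/-! ### First-order expansion of the scattering matrix elements. -/

section FirstOrder

/-- The quantity on the left equals -∫⟨y(∞) - y(t), x'(t)⟩ dt, and ‖y(∞) - y(t)‖ is at most the
length of y. Hence a product of two lengths, that is, an error of second order. -/
theorem norm_inner_limit_sub_le {F : Type*} [NormedAddCommGroup F] [InnerProductSpace ℂ F]
    [CompleteSpace F] {x y x' y' : ℝ → F} (hx : ∀ t, HasDerivAt x (x' t) t)
    (hy : ∀ t, HasDerivAt y (y' t) t) (hxi : Integrable x') (hyi : Integrable y') {c : ℂ}
    (hc : ∀ t, inner ℂ (y t) (x t) = c) {xm yp : F} (hxm : Tendsto x atBot (𝓝 xm))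
    (hyp : Tendsto y atTop (𝓝 yp)) :
    ‖inner ℂ yp xm - c + ∫ t, inner ℂ (y t) (x' t)‖ ≤ (∫ t, ‖x' t‖) * ∫ t, ‖y' t‖ := by
  obtain ⟨xp, hxp⟩ := (exists_tendsto_of_hasDerivAt_of_integrable hx hxi).1
  have h1 : inner ℂ yp xp = c :=
    tendsto_nhds_unique (hyp.inner hxp) (tendsto_const_nhds.congr fun t => (hc t).symm)
  have h2 : xm = xp - ∫ t, x' t := by
    rw [integral_of_hasDerivAt_of_tendsto hx hxi hxm hxp]
    abel
  have hb : ∀ t, ‖yp - y t‖ ≤ ∫ t, ‖y' t‖ := fun t => by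
    rw [← integral_Ioi_of_hasDerivAt_of_tendsto' (fun r _ => hy r) hyi.integrableOn hyp]
    exact (norm_integral_le_integral_norm _).trans
      (setIntegral_le_integral hyi.norm (Eventually.of_forall fun _ => norm_nonneg _))
  have hyc : Continuous y := continuous_iff_continuousAt.2 fun t => (hy t).continuousAt
  have hi1 : Integrable fun t => inner ℂ yp (x' t) := hxi.const_inner yp
  have hm : AEStronglyMeasurable (fun t => inner ℂ (yp - y t) (x' t)) volume :=
    (continuous_const.sub hyc).aestronglyMeasurable.inner hxi.aestronglyMeasurable
  have hle : ∀ t, ‖inner ℂ (yp - y t) (x' t)‖ ≤ (∫ t, ‖y' t‖) * ‖x' t‖ := fun t =>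
    (norm_inner_le_norm _ _).trans (by gcongr; exact hb t)
  have hi2 : Integrable fun t => inner ℂ (yp - y t) (x' t) :=
    (hxi.norm.const_mul (∫ t, ‖y' t‖)).mono' hm (Eventually.of_forall hle)
  have h3 : ∫ t, inner ℂ (y t) (x' t)
      = inner ℂ yp (∫ t, x' t) - ∫ t, inner ℂ (yp - y t) (x' t) := by
    rw [← integral_inner hxi, ← integral_sub hi1 hi2]
    congr 1
    funext t
    rw [inner_sub_left]
    ring
  have h4 : inner ℂ yp xm - c + ∫ t, inner ℂ (y t) (x' t)
      = - ∫ t, inner ℂ (yp - y t) (x' t) := by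
    rw [h3, h2, inner_sub_right, h1]
    ring
  rw [h4, norm_neg]
  calc _ ≤ ∫ t, (∫ t, ‖y' t‖) * ‖x' t‖ :=
        norm_integral_le_of_norm_le (hxi.norm.const_mul _) (Eventually.of_forall hle)
    _ = _ := by rw [integral_const_mul, mul_comm]

variable {n : ℕ}

theorem inner_toL2_twist {a : Space n → ℝ} (ha : Function.HasTemperateGrowth a)
    (φ ψ : 𝓢(Space n, ℂ)) :
    inner ℂ (toL2 (twist a φ)) (toL2 (twist a ψ)) = inner ℂ (toL2 φ) (toL2 ψ) := by
  rw [inner_toL2, inner_toL2]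
  refine integral_congr_ae (Eventually.of_forall fun x => ?_)
  simp only
  rw [twist_apply ha, twist_apply ha, star_mul', mul_mul_mul_comm]
  have : Complex.exp (Complex.I * (a x : ℂ)) * star (Complex.exp (Complex.I * (a x : ℂ))) = 1 := by
    rw [Complex.star_def, ← Complex.exp_conj, ← Complex.exp_add]
    simp
  rw [this, one_mul]

theorem hasTemperateGrowth_sub_const {g : Space n → ℝ}
    (hg : Function.HasTemperateGrowth (fun x : Space n => ((g x : ℝ) : ℂ))) (c : ℝ) :
    Function.HasTemperateGrowth (fun x : Space n => ((g x - c : ℝ) : ℂ)) := by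
  have : (fun x : Space n => ((g x - c : ℝ) : ℂ)) = (fun x => (g x : ℂ)) - fun _ => (c : ℂ) := by
    funext x
    simp
  rw [this]
  exact hg.sub (Function.HasTemperateGrowth.const _)

theorem realMul_sub_const {g : Space n → ℝ}
    (hg : Function.HasTemperateGrowth (fun x : Space n => ((g x : ℝ) : ℂ))) (c : ℝ)
    (φ : 𝓢(Space n, ℂ)) : realMul (fun x => g x - c) φ = realMul g φ - (c : ℂ) • φ := by
  ext x
  rw [realMul_apply (hasTemperateGrowth_sub_const hg c), sub_apply, smul_apply, realMul_apply hg,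
    smul_eq_mul]
  push_cast
  ring

theorem norm_cexp_neg_I_mul (r : ℝ) : ‖Complex.exp (-(Complex.I * (r : ℂ)))‖ = 1 := by
  rw [← mul_neg, ← Complex.ofReal_neg, mul_comm, Complex.norm_exp_ofReal_mul_I]

/-- The scalar phase generated by υ subtracts υ from the potential. It preserves norms and changes
the limits at ±∞ only by scalars. -/
theorem hasDerivAt_gauged_propagator {δ : ℝ} (hδ : 0 < δ) {E : ℝ → Space n}
    (hE : IsPeriodicField E) {V : ℝ → Space n → ℝ} (hV : IsPotential δ V)
    {U : ℝ → ℝ → (L2 n ≃ₗᵢ[ℂ] L2 n)} (hU : IsPropagator (hamiltonian E V) U)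
    (s : ℝ) (η : Space n) {υ : ℝ → ℝ} (hυ : Continuous υ) (f : 𝓢(Space n, ℂ)) (t : ℝ) :
    HasDerivAt (fun t => Complex.exp (-(Complex.I * ((∫ σ in s..t, υ σ : ℝ) : ℂ))) •
        U s t (toL2 (freeSolution E s η f t)))
      (Complex.exp (-(Complex.I * ((∫ σ in s..t, υ σ : ℝ) : ℂ))) • Complex.I •
        U s t (toL2 (realMul (fun x => V t x - υ t) (freeSolution E s η f t)))) t := by
  have h1 : HasDerivAt (fun t => ((∫ σ in s..t, υ σ : ℝ) : ℂ)) (υ t : ℂ) t :=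
    (intervalIntegral.integral_hasDerivAt_right (hυ.intervalIntegrable _ _)
      (hυ.stronglyMeasurableAtFilter _ _) hυ.continuousAt).ofReal_comp
  have h2 := (h1.const_mul Complex.I).neg.cexp
  have h3 := h2.smul (hasDerivAt_propagator_freeSolution hδ hE hV hU s η f t)
  refine h3.congr_deriv ?_
  rw [realMul_sub_const (hV.hasTemperateGrowth hδ t), toL2_sub, toL2_smul, map_sub, map_smul]
  module

theorem continuous_gauged_potential {δ : ℝ} (hδ : 0 < δ) {V : ℝ → Space n → ℝ}
    (hV : IsPotential δ V) {υ : ℝ → ℝ} (hυ : Continuous υ) {A : ℝ → 𝓢(Space n, ℂ)}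
    (hA : Continuous fun t => toL2 (A t)) :
    Continuous fun t => toL2 (realMul (fun x => V t x - υ t) (A t)) := by
  have : (fun t => toL2 (realMul (fun x => V t x - υ t) (A t)))
      = fun t => toL2 (realMul (V t) (A t)) - (υ t : ℂ) • toL2 (A t) := by
    funext t
    rw [realMul_sub_const (hV.hasTemperateGrowth hδ t), toL2_sub, toL2_smul]
  rw [this]
  exact (hV.continuous_toL2_realMul hδ hA).sub ((Complex.continuous_ofReal.comp hυ).smul hA)

/-- First order (Born) approximation of the scattering matrix elements, relative to the phase
generated by a function `υ` of time that is subtracted from the potential. -/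
theorem norm_inner_waveOperator_sub_le {δ : ℝ} (hδ : 0 < δ) {E : ℝ → Space n}
    (hE : IsPeriodicField E) {V : ℝ → Space n → ℝ} (hV : IsPotential δ V)
    {U₀ U : ℝ → ℝ → (L2 n ≃ₗᵢ[ℂ] L2 n)} (hU₀ : IsPropagator (freeHamiltonian E) U₀)
    (hU : IsPropagator (hamiltonian E V) U) (s : ℝ) {Wp Wm : L2 n →L[ℂ] L2 n}
    (hp : IsWaveOperator U U₀ s atTop Wp) (hm : IsWaveOperator U U₀ s atBot Wm) (η : Space n)
    {υ : ℝ → ℝ} (hυ : Continuous υ) (hυi : Integrable υ) (f g : 𝓢(Space n, ℂ))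
    (hf : Integrable fun t =>
      toL2 (realMul (fun x => V t x - υ t) (freeSolution E s η f t)))
    (hg : Integrable fun t =>
      toL2 (realMul (fun x => V t x - υ t) (freeSolution E s η g t))) :
    ‖Complex.exp (Complex.I * ((∫ t, υ t : ℝ) : ℂ)) *
          inner ℂ (Wp (toL2 (twist (fun x => momentumPhase x η) (𝓕⁻ g))))
            (Wm (toL2 (twist (fun x => momentumPhase x η) (𝓕⁻ f))))
        - inner ℂ (toL2 (𝓕⁻ g)) (toL2 (𝓕⁻ f))
        + Complex.I * ∫ t, inner ℂ (toL2 (freeSolution E s η g t))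
            (toL2 (realMul (fun x => V t x - υ t) (freeSolution E s η f t)))‖
      ≤ (∫ t, ‖toL2 (realMul (fun x => V t x - υ t) (freeSolution E s η f t))‖) *
        ∫ t, ‖toL2 (realMul (fun x => V t x - υ t) (freeSolution E s η g t))‖ := by
  set e : ℝ → ℂ := fun t => Complex.exp (-(Complex.I * ((∫ σ in s..t, υ σ : ℝ) : ℂ))) with he
  have he1 : ∀ t, ‖e t‖ = 1 := fun t => norm_cexp_neg_I_mul _
  have hes : ∀ t, starRingEnd ℂ (e t) * e t = 1 := fun t => by
    rw [mul_comm, Complex.mul_conj, Complex.normSq_eq_norm_sq, he1]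
    simp
  have hec : Continuous e := by
    have := intervalIntegral.continuous_primitive (fun a b => hυ.intervalIntegrable a b) s
      (μ := volume)
    fun_prop
  set x : 𝓢(Space n, ℂ) → ℝ → L2 n := fun f t => e t • U s t (toL2 (freeSolution E s η f t)) with hx
  set k : 𝓢(Space n, ℂ) → ℝ → L2 n := fun f t =>
    toL2 (realMul (fun x => V t x - υ t) (freeSolution E s η f t)) with hk
  set x' : 𝓢(Space n, ℂ) → ℝ → L2 n := fun f t => e t • Complex.I • U s t (k f t) with hx'
  have hd : ∀ f t, HasDerivAt (x f) (x' f t) t := fun f t =>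
    hasDerivAt_gauged_propagator hδ hE hV hU s η hυ f t
  have hn : ∀ f t, ‖x' f t‖ = ‖k f t‖ := fun f t => by
    simp only [hx', norm_smul, he1, Complex.norm_I, one_mul, LinearIsometryEquiv.norm_map]
  have hx'c : ∀ f, Continuous (x' f) := fun f =>
    hec.smul ((continuous_const_smul Complex.I).comp (continuous_propagator_apply hU s
      (continuous_gauged_potential hδ hV hυ (hasACDeriv_freeSolution hE s η f).continuous)))
  have hi : ∀ f, Integrable (k f) → Integrable (x' f) := fun f h =>
    h.mono (hx'c f).aestronglyMeasurable (Eventually.of_forall fun t => (hn f t).le)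
  have hinn : ∀ (a b : L2 n) t, inner ℂ (e t • U s t a) (e t • U s t b) = inner ℂ a b := by
    intro a b t
    rw [inner_smul_left, inner_smul_right, ← mul_assoc, hes, one_mul,
      LinearIsometryEquiv.inner_map_map]
  have hc : ∀ t, inner ℂ (x g t) (x f t) = inner ℂ (toL2 (𝓕⁻ g)) (toL2 (𝓕⁻ f)) := by
    intro t
    simp only [hx]
    rw [hinn, ← hU₀.apply_freeSolution hE, ← hU₀.apply_freeSolution hE,
      LinearIsometryEquiv.inner_map_map, inner_toL2_twist (hasTemperateGrowth_momentumPhase η)]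
  set ep := Complex.exp (-(Complex.I * ((∫ σ in Set.Ioi s, υ σ : ℝ) : ℂ))) with hep
  set em := Complex.exp (-(Complex.I * ((-∫ σ in Set.Iic s, υ σ : ℝ) : ℂ))) with hem
  have hlp : Tendsto e atTop (𝓝 ep) := by
    have h1 := intervalIntegral_tendsto_integral_Ioi s hυi.integrableOn (b := id) tendsto_id
    have h2 : Continuous fun r : ℝ => Complex.exp (-(Complex.I * (r : ℂ))) := by fun_prop
    exact (h2.tendsto _).comp h1
  have hlm : Tendsto e atBot (𝓝 em) := by
    have h1 := (intervalIntegral_tendsto_integral_Iic s hυi.integrableOn (a := id) tendsto_id).neg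
    have h2 : Continuous fun r : ℝ => Complex.exp (-(Complex.I * (r : ℂ))) := by fun_prop
    refine ((h2.tendsto _).comp h1).congr fun t => ?_
    simp only [he, Function.comp_apply, id, intervalIntegral.integral_symm s t]
    rw [neg_neg]
  have hxm := hlm.smul (hm (toL2 (twist (fun x => momentumPhase x η) (𝓕⁻ f))))
  have hxp := hlp.smul (hp (toL2 (twist (fun x => momentumPhase x η) (𝓕⁻ g))))
  simp only [hU₀.apply_freeSolution hE] at hxm hxp
  have key := norm_inner_limit_sub_le (hd f) (hd g) (hi f hf) (hi g hg) hc hxm hxp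
  simp only [hn] at key
  have h5 : ∀ t, inner ℂ (x g t) (x' f t)
      = Complex.I * inner ℂ (toL2 (freeSolution E s η g t)) (k f t) := by
    intro t
    simp only [hx, hx', smul_comm (e t) Complex.I]
    rw [inner_smul_right, hinn]
  simp only [h5] at key
  rw [integral_const_mul, inner_smul_left, inner_smul_right, ← mul_assoc] at key
  -- The phases over (s, ∞) and (-∞, s) combine into the integral of υ over the whole line, which no
  -- longer depends on s.
  have h6 : starRingEnd ℂ ep * em = Complex.exp (Complex.I * ((∫ t, υ t : ℝ) : ℂ)) := by
    rw [hep, hem, ← Complex.exp_conj, ← Complex.exp_add,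
      ← intervalIntegral.integral_Iic_add_Ioi hυi.integrableOn hυi.integrableOn (b := s)]
    congr 1
    simp
    ring
  rwa [h6] at key

end FirstOrder

/-! ### The potential minus its value at the classical position. -/

section GaugedPotential

variable {n : ℕ}

/-- If |x-y| ≤ ⟨y⟩/4, every point p of the ball has ⟨p⟩ ≥ ⟨y⟩/4, and the mean value theorem with the
decay of the gradient applies; this is the origin of 4^{δ+1}. Otherwise 4|x-y|/⟨y⟩ ≥ 1 and the two
values are bounded separately. -/
theorem IsPotential.exists_sub_bound {δ : ℝ} {V : ℝ → Space n → ℝ} (hδ : 0 < δ)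
    (hV : IsPotential δ V) :
    ∃ C, 0 ≤ C ∧ ∀ t x y, |V t x - V t y|
      ≤ C * (‖x - y‖ / bracket y) * (bracket x ^ (-δ) + bracket y ^ (-δ)) := by
  obtain ⟨C, hC0, hC⟩ := hV.exists_bound
  obtain ⟨D, hD0, hD⟩ := hV.exists_fderiv_bound
  set A : ℝ := 4 ^ (δ + 1) with hA
  have hA0 : 0 < A := by positivity
  refine ⟨4 * C + D * A, by positivity, fun t x y => ?_⟩
  have hx := bracket_pos x
  have hy := bracket_pos y
  have hx' : 0 < bracket x ^ (-δ) := Real.rpow_pos_of_pos hx _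
  have hy' : 0 < bracket y ^ (-δ) := Real.rpow_pos_of_pos hy _
  set r := ‖x - y‖ with hr
  have hr0 : 0 ≤ r := norm_nonneg _
  rcases le_total r (bracket y / 4) with h | h
  · have hb : ∀ p ∈ Metric.closedBall y r, ‖fderiv ℝ (V t) p‖ ≤ D * (A * bracket y ^ (-δ - 1)) := by
      intro p hp
      have h1 : ‖p - y‖ ≤ r := mem_closedBall_iff_norm.1 hp
      have h2 : bracket y / 4 ≤ bracket p := by
        have e1 := bracket_le_one_add_norm y
        have e2 := norm_sub_norm_le y p
        rw [norm_sub_rev] at e2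
        linarith [norm_le_bracket p, one_le_bracket p]
      refine (hD t p).trans (mul_le_mul_of_nonneg_left ?_ hD0)
      refine (Real.rpow_le_rpow_of_nonpos (by positivity) h2 (by linarith)).trans ?_
      rw [Real.div_rpow hy.le (by norm_num), div_eq_mul_inv, ← Real.rpow_neg (by norm_num), hA,
        mul_comm]
      apply le_of_eq
      congr 2
      ring
    have h2 := (convex_closedBall y r).norm_image_sub_le_of_norm_fderiv_le (𝕜 := ℝ) (f := V t)
      (fun p _ => ((hV.contDiff_slice t).differentiable (by simp)).differentiableAt) hb
      (Metric.mem_closedBall_self hr0) (mem_closedBall_iff_norm.2 le_rfl : x ∈ _)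
    rw [Real.norm_eq_abs] at h2
    refine h2.trans ?_
    have h3 : bracket y ^ (-δ - 1) = bracket y ^ (-δ) / bracket y := Real.rpow_sub_one hy.ne' _
    rw [h3]
    calc D * (A * (bracket y ^ (-δ) / bracket y)) * r
        = (D * A) * (r / bracket y) * bracket y ^ (-δ) := by ring
      _ ≤ _ := by
          gcongr
          · linarith
          · linarith
  · have h1 : 1 ≤ 4 * (r / bracket y) := by
      rw [← mul_div_assoc, le_div_iff₀ hy]
      linarith
    calc |V t x - V t y| ≤ |V t x| + |V t y| := abs_sub _ _
      _ ≤ C * (bracket x ^ (-δ) + bracket y ^ (-δ)) := by linarith [hC t x, hC t y]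
      _ ≤ (4 * (r / bracket y)) * (C * (bracket x ^ (-δ) + bracket y ^ (-δ))) :=
          le_mul_of_one_le_left (by positivity) h1
      _ = (4 * C) * (r / bracket y) * (bracket x ^ (-δ) + bracket y ^ (-δ)) := by ring
      _ ≤ _ := by
          gcongr
          linarith [mul_nonneg hD0 hA0.le]

theorem norm_le_sum_abs_coord (x : Space n) :
    ‖x‖ ≤ ∑ j : Fin n, |inner ℝ x (EuclideanSpace.single j (1 : ℝ))| := by
  conv_lhs => rw [← (EuclideanSpace.basisFun (Fin n) ℝ).sum_repr' x]
  refine (norm_sum_le _ _).trans (Finset.sum_le_sum fun j _ => ?_)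
  rw [norm_smul, OrthonormalBasis.norm_eq_one, mul_one, Real.norm_eq_abs, real_inner_comm,
    EuclideanSpace.basisFun_apply]

theorem hasTemperateGrowth_bracket_rpow (r : ℝ) :
    Function.HasTemperateGrowth (fun x : Space n => ((bracket x ^ r : ℝ) : ℂ)) := by
  have h : (fun x : Space n => bracket x ^ r) = fun x => (1 + ‖x‖ ^ 2) ^ (r / 2) := by
    funext x
    rw [bracket, Real.sqrt_eq_rpow, ← Real.rpow_mul (by positivity)]
    congr 1
    ring
  have h1 := Function.hasTemperateGrowth_one_add_norm_sq_rpow (Space n) (r / 2)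
  rw [← h] at h1
  exact Function.HasTemperateGrowth.comp (g := fun r : ℝ => (r : ℂ)) (by fun_prop) h1

/-- Once the displacement y is removed from `coordMul_freeEvol`, only the spreading of the packet is
left, linear in time. The constant 7 stands for 2π. -/
theorem norm_sub_mul_freeEvol_le (z : ℝ × Space n × ℝ) (m x : Space n) (f : 𝓢(Space n, ℂ)) :
    |inner ℝ (x - z.2.1) m| * ‖freeEvol z f x‖ ≤ 7 * (1 + |z.1|) *
      (‖freeEvol z (∂_{m} f) x‖ + ‖freeEvol z (coordMul m f) x‖) := by
  have hpi := Real.pi_pos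
  have h1 : ((inner ℝ (x - z.2.1) m : ℝ) : ℂ) * freeEvol z f x
      = (Complex.I / (2 * Real.pi) : ℂ) * freeEvol z (∂_{m} f) x
        + ((2 * Real.pi * z.1 : ℝ) : ℂ) * freeEvol z (coordMul m f) x := by
    have h2 := coordMul_apply m (freeEvol z f) x
    rw [coordMul_freeEvol, positionSymbol, freeEvol_add, freeEvol_add, freeEvol_smul,
      freeEvol_smul, freeEvol_smul, add_apply, add_apply, smul_apply, smul_apply, smul_apply,
      smul_eq_mul, smul_eq_mul, smul_eq_mul] at h2
    rw [inner_sub_left]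
    push_cast at h2 ⊢
    linear_combination -h2
  have h3 : |inner ℝ (x - z.2.1) m| * ‖freeEvol z f x‖
      = ‖((inner ℝ (x - z.2.1) m : ℝ) : ℂ) * freeEvol z f x‖ := by
    rw [norm_mul, Complex.norm_real, Real.norm_eq_abs]
  rw [h3, h1]
  refine (norm_add_le _ _).trans ?_
  rw [norm_mul, norm_mul, Complex.norm_real, norm_div, Complex.norm_I, Real.norm_eq_abs, abs_mul,
    abs_of_pos (by positivity : 0 < 2 * Real.pi)]
  have h4 : ‖(2 * Real.pi : ℂ)‖ = 2 * Real.pi := by simp [abs_of_pos hpi]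
  rw [h4, mul_add]
  have h5 : 1 / (2 * Real.pi) ≤ 7 * (1 + |z.1|) := by
    rw [div_le_iff₀ (by positivity)]
    nlinarith [abs_nonneg z.1, Real.pi_gt_three]
  have h6 : 2 * Real.pi * |z.1| ≤ 7 * (1 + |z.1|) := by
    nlinarith [abs_nonneg z.1, Real.pi_lt_d2]
  gcongr

theorem tsupport_coordMul_subset (m : Space n) (f : 𝓢(Space n, ℂ)) :
    tsupport (coordMul m f) ⊆ tsupport f := by
  refine closure_mono fun x hx hx' => hx ?_
  rw [coordMul_apply, hx', mul_zero]

/-- In `IsPotential.exists_sub_bound` the factor |x-y| acts on the packet as spreading, of order 1 +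
|t|, which gives the quotient by ⟨y⟩. The remaining weights ⟨x⟩^{-δ} and ⟨y⟩^{-δ} give Q^{-δ} by the
propagation estimate and by Q ≤ M⟨y⟩. -/
theorem exists_norm_gauged_potential_le {δ : ℝ} (hδ : 0 < δ) (hδ2 : δ ≤ 2) {V : ℝ → Space n → ℝ}
    (hV : IsPotential δ V) {f : 𝓢(Space n, ℂ)} (hf : HasCompactSupport f) {M : ℝ} (hM : 1 ≤ M)
    {K : Set (Space n)} (hK : tsupport f ⊆ K) :
    ∃ C, 0 ≤ C ∧ ∀ t z Q, 1 ≤ Q → IsFar K M z Q → Q ≤ M * bracket z.2.1 →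
      ‖toL2 (realMul (fun x => V t x - V t z.2.1) (freeEvol z f))‖
        ≤ C * ((1 + |z.1|) / bracket z.2.1) * Q ^ (-δ) := by
  obtain ⟨A, hA0, hA⟩ := hV.exists_sub_bound hδ
  set e : Fin n → Space n := fun j => EuclideanSpace.single j (1 : ℝ) with he
  set F : Fin n × Bool → 𝓢(Space n, ℂ) := fun i =>
    if i.2 then ∂_{e i.1} f else coordMul (e i.1) f with hF
  have hFs : ∀ i, tsupport (F i) ⊆ tsupport f := by
    rintro ⟨j, b⟩
    cases b
    · simpa [hF] using tsupport_coordMul_subset (e j) f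
    · simpa [hF] using SchwartzMap.tsupport_lineDerivOp_subset (e j) f
  choose B hB0 hB using fun i => IsFar.norm_toL2_realMul_freeEvol_le
    (hf.of_isClosed_subset (isClosed_tsupport _) (hFs i)) hM ((hFs i).trans hK)
  have hM0 : 0 < M := by linarith
  refine ⟨7 * A * ∑ i, (B i + M ^ δ * ‖toL2 (F i)‖), mul_nonneg (by positivity)
    (Finset.sum_nonneg fun i _ => add_nonneg (hB0 i) (by positivity)), fun t z Q hQ hfar hQM => ?_⟩
  set y := z.2.1 with hy
  have hy0 := bracket_pos y
  set b : ℝ := bracket y ^ (-δ) with hb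
  have hb0 : 0 < b := Real.rpow_pos_of_pos hy0 _
  have hQ0 : 0 < Q := by linarith
  have hbQ : b ≤ M ^ δ * Q ^ (-δ) := by
    have h1 : Q / M ≤ bracket y := by
      rw [div_le_iff₀ (by linarith)]
      linarith
    have h2 := Real.rpow_le_rpow_of_nonpos (by positivity) h1 (by linarith : -δ ≤ 0)
    rw [Real.div_rpow hQ0.le (by linarith), Real.rpow_neg (by linarith : 0 ≤ M), div_inv_eq_mul,
      mul_comm] at h2
    exact h2
  have hw := hasTemperateGrowth_bracket_rpow (n := n) (-δ)
  -- The sum of the two weights, written as a difference to fit `realMul_sub_const`.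
  set g : Space n → ℝ := fun x => bracket x ^ (-δ) - -b with hg
  have hgt : Function.HasTemperateGrowth (fun x : Space n => ((g x : ℝ) : ℂ)) :=
    hasTemperateGrowth_sub_const hw (-b)
  have h1 : ‖toL2 (realMul (fun x => V t x - V t y) (freeEvol z f))‖
      ≤ ∑ i, (7 * A * ((1 + |z.1|) / bracket y)) * ‖toL2 (realMul g (freeEvol z (F i)))‖ := by
    refine norm_toL2_le_sum _ _ _ _ (fun i _ => by positivity) fun x => ?_
    rw [realMul_apply (hasTemperateGrowth_sub_const (hV.hasTemperateGrowth hδ t) _), norm_mul,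
      Complex.norm_real, Real.norm_eq_abs]
    have hgx : g x = bracket x ^ (-δ) + b := by simp [hg]
    have hgx0 : 0 ≤ g x := by
      rw [hgx]
      have := Real.rpow_nonneg (bracket_pos x).le (-δ)
      linarith
    have h2 : ‖x - y‖ * ‖freeEvol z f x‖
        ≤ 7 * (1 + |z.1|) * ∑ i, ‖freeEvol z (F i) x‖ := by
      calc ‖x - y‖ * ‖freeEvol z f x‖
          ≤ (∑ j, |inner ℝ (x - y) (e j)|) * ‖freeEvol z f x‖ := by
            gcongr
            exact norm_le_sum_abs_coord _
        _ = ∑ j, |inner ℝ (x - y) (e j)| * ‖freeEvol z f x‖ := Finset.sum_mul _ _ _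
        _ ≤ ∑ j, 7 * (1 + |z.1|) *
              (‖freeEvol z (∂_{e j} f) x‖ + ‖freeEvol z (coordMul (e j) f) x‖) :=
            Finset.sum_le_sum fun j _ => norm_sub_mul_freeEvol_le z (e j) x f
        _ = _ := by
            rw [← Finset.mul_sum, Fintype.sum_prod_type]
            simp [hF]
    calc |V t x - V t y| * ‖freeEvol z f x‖
        ≤ A * (‖x - y‖ / bracket y) * g x * ‖freeEvol z f x‖ := by
          gcongr
          rw [hgx]
          exact hA t x y
      _ = A / bracket y * g x * (‖x - y‖ * ‖freeEvol z f x‖) := by ring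
      _ ≤ A / bracket y * g x * (7 * (1 + |z.1|) * ∑ i, ‖freeEvol z (F i) x‖) := by gcongr
      _ = ∑ i, (7 * A * ((1 + |z.1|) / bracket y)) * ‖realMul g (freeEvol z (F i)) x‖ := by
          simp only [realMul_apply hgt, norm_mul, Complex.norm_real, Real.norm_of_nonneg hgx0,
            Finset.mul_sum]
          refine Finset.sum_congr rfl fun i _ => ?_
          ring
  refine h1.trans ?_
  have h3 : ∀ i, ‖toL2 (realMul g (freeEvol z (F i)))‖
      ≤ (B i + M ^ δ * ‖toL2 (F i)‖) * Q ^ (-δ) := by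
    intro i
    rw [hg, realMul_sub_const hw, toL2_sub]
    refine (norm_sub_le _ _).trans ?_
    rw [toL2_smul, norm_smul, norm_toL2_freeEvol, Complex.norm_real, norm_neg,
      Real.norm_of_nonneg hb0.le]
    have h4 := hB i z Q hQ hfar (fun x => bracket x ^ (-δ)) 1 δ hw zero_le_one hδ.le hδ2
      (fun x => by rw [one_mul, abs_of_nonneg (Real.rpow_nonneg (bracket_pos x).le _)])
    have h5 : b * ‖toL2 (F i)‖ ≤ M ^ δ * Q ^ (-δ) * ‖toL2 (F i)‖ := by gcongr
    linarith
  calc _ ≤ ∑ i, (7 * A * ((1 + |z.1|) / bracket y)) *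
        ((B i + M ^ δ * ‖toL2 (F i)‖) * Q ^ (-δ)) := by
        gcongr with i
        exact h3 i
    _ = _ := by
        rw [← Finset.mul_sum, ← Finset.sum_mul]
        ring

end GaugedPotential

/-! ### Integrals along high-velocity orbits. -/

section HighVelocity

variable {n : ℕ}

theorem integrable_one_add_mul_abs_sub_rpow {μ : ℝ} (hμ : 1 < μ) {v : ℝ} (hv : 0 < v) (s : ℝ) :
    Integrable fun t : ℝ => (1 + v * |t - s|) ^ (-μ) := by
  have h1 := ((integrable_one_add_abs_rpow hμ).comp_mul_left' hv.ne').comp_sub_right s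
  refine h1.congr (Eventually.of_forall fun t => ?_)
  simp only [abs_mul, abs_of_pos hv]

theorem integral_one_add_mul_abs_sub_rpow {μ : ℝ} {v : ℝ} (hv : 0 < v) (s : ℝ) :
    ∫ t : ℝ, (1 + v * |t - s|) ^ (-μ) = v⁻¹ * ∫ t : ℝ, (1 + |t|) ^ (-μ) := by
  rw [integral_sub_right_eq_self (fun t : ℝ => (1 + v * |t|) ^ (-μ)) s]
  have h2 := Measure.integral_comp_mul_left (fun t : ℝ => (1 + |t|) ^ (-μ)) v
  simp only [abs_mul, abs_of_pos hv, smul_eq_mul, abs_of_pos (inv_pos.2 hv)] at h2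
  exact h2

/-- The potential along the classical orbit. -/
def orbitPotential (V : ℝ → Space n → ℝ) (E : ℝ → Space n) (s : ℝ) (η : Space n) (t : ℝ) : ℝ :=
  V t (fieldOrbit E s η t).2.1

theorem continuous_orbitPotential {δ : ℝ} {E : ℝ → Space n}
    (hE : IsPeriodicField E) {V : ℝ → Space n → ℝ} (hV : IsPotential δ V) (s : ℝ) (η : Space n) :
    Continuous (orbitPotential V E s η) :=
  hV.smooth.continuous.comp
    (continuous_id.prodMk (continuous_fst.comp (continuous_snd.comp (continuous_fieldOrbit hE s η))))

theorem exists_orbitPotential_bound {δ : ℝ} (hδ : 0 < δ) {E : ℝ → Space n}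
    (hE : IsPeriodicField E) {V : ℝ → Space n → ℝ} (hV : IsPotential δ V) (s : ℝ)
    {w : Space n} (hw : ‖w‖ = 1) (hwE : inner ℝ w (meanField E) = 0) {a : ℕ}
    (ha : a = 1 ∨ a = 2 ∧ meanField E ≠ 0) :
    ∃ C v₀, 0 ≤ C ∧ 1 ≤ v₀ ∧ ∀ v, v₀ ≤ v → ∀ t,
      |orbitPotential V E s (v • w) t| ≤ C * ((1 + |t - s|) ^ a) ^ (-δ) ∧
      |orbitPotential V E s (v • w) t| ≤ C * (1 + v * |t - s|) ^ (-δ) := by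
  -- Only the lower bounds for ⟨y⟩ are used, so the radius of the momentum ball is immaterial.
  obtain ⟨M, v₀, hM, hv₀, h⟩ := exists_isFar_highVelocity hE s hw hwE ha 0
  obtain ⟨C, hC0, hC⟩ := hV.exists_bound
  have hM0 : 0 < M := by linarith
  refine ⟨C * M ^ δ, v₀, by positivity, hv₀, fun v hv t => ?_⟩
  obtain ⟨-, -, h1, h2⟩ := h v hv t
  set y := (fieldOrbit E s (v • w) t).2.1 with hy
  have key : ∀ Q, 0 < Q → Q ≤ M * bracket y → |V t y| ≤ C * M ^ δ * Q ^ (-δ) := by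
    intro Q hQ0 hQ
    have h1 : Q / M ≤ bracket y := by
      rw [div_le_iff₀ hM0]
      linarith
    have h2 := Real.rpow_le_rpow_of_nonpos (by positivity) h1 (by linarith : -δ ≤ 0)
    rw [Real.div_rpow hQ0.le hM0.le, Real.rpow_neg hM0.le, div_inv_eq_mul, mul_comm] at h2
    refine (hC t y).trans ?_
    rw [mul_assoc]
    gcongr
  have hv0 : 0 ≤ v := by linarith
  exact ⟨key _ (by positivity) h2, key _ (by positivity) h1⟩

theorem integrable_orbitPotential {δ : ℝ} {E : ℝ → Space n}
    (hE : IsPeriodicField E) {V : ℝ → Space n → ℝ} (hV : IsPotential δ V) {s : ℝ} {η : Space n}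
    {a : ℕ} (haδ : 1 < a * δ) {C : ℝ}
    (h : ∀ t, |orbitPotential V E s η t| ≤ C * ((1 + |t - s|) ^ a) ^ (-δ)) :
    Integrable (orbitPotential V E s η) :=
  ((integrable_one_add_abs_sub_pow_rpow haδ s).const_mul C).mono'
    (continuous_orbitPotential hE hV s η).aestronglyMeasurable (Eventually.of_forall h)

theorem tendsto_one_add_mul_rpow {δ : ℝ} (hδ : 0 < δ) {c : ℝ} (hc : 0 < c) :
    Tendsto (fun v : ℝ => (1 + v * c) ^ (-δ)) atTop (𝓝 0) :=
  (tendsto_rpow_neg_atTop hδ).comp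
    (tendsto_atTop_add_const_left _ _ (tendsto_id.atTop_mul_const hc))

/-- Dominated convergence: the bound by (1+|t-s|)^{-aδ} is the majorant, and the one by
(1+v|t-s|)^{-δ} gives pointwise convergence for t ≠ s. -/
theorem tendsto_integral_orbitPotential {δ : ℝ} (hδ : 0 < δ) {E : ℝ → Space n}
    (hE : IsPeriodicField E) {V : ℝ → Space n → ℝ} (hV : IsPotential δ V) (s : ℝ)
    {w : Space n} (hw : ‖w‖ = 1) (hwE : inner ℝ w (meanField E) = 0) {a : ℕ}
    (ha : a = 1 ∨ a = 2 ∧ meanField E ≠ 0) (haδ : 1 < a * δ) :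
    Tendsto (fun v : ℝ => ∫ t, orbitPotential V E s (v • w) t) atTop (𝓝 0) := by
  obtain ⟨C, v₀, hC0, hv₀, h⟩ := exists_orbitPotential_bound hδ hE hV s hw hwE ha
  have h0 : (0 : ℝ) = ∫ _ : ℝ, (0 : ℝ) := by simp
  rw [h0]
  refine tendsto_integral_filter_of_dominated_convergence
    (fun t => C * ((1 + |t - s|) ^ a) ^ (-δ))
    (Eventually.of_forall fun v => (continuous_orbitPotential hE hV s _).aestronglyMeasurable)
    ?_ ((integrable_one_add_abs_sub_pow_rpow haδ s).const_mul C) ?_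
  · filter_upwards [eventually_ge_atTop v₀] with v hv
    exact Eventually.of_forall fun t => (h v hv t).1
  · have hs : ∀ᵐ t : ℝ, t ≠ s := by simp [ae_iff, measure_singleton]
    filter_upwards [hs] with t ht
    have h1 : 0 < |t - s| := abs_pos.2 (sub_ne_zero.2 ht)
    have h2 := (tendsto_one_add_mul_rpow hδ h1).const_mul C
    rw [mul_zero] at h2
    refine squeeze_zero_norm' ?_ h2
    filter_upwards [eventually_ge_atTop v₀] with v hv using (h v hv t).2

theorem exists_tsupport_subset_closedBall {f : Space n → ℂ} (hf : HasCompactSupport f) :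
    ∃ R, tsupport f ⊆ Metric.closedBall 0 R :=
  hf.isCompact.isBounded.subset_closedBall 0

/-- Both lower bounds for the orbit are needed. Since (1+|T|)/⟨y⟩ ≤ M((1+v|T|)⁻¹ + v⁻¹), the first
part combines with (1+v|T|)^{-δ} to an exponent above 1 and scales like 1/v; the second part carries
1/v already and is integrable through (1+|T|)^{-aδ}. -/
theorem exists_integral_gauged_potential_le {δ : ℝ} (hδ : 0 < δ) (hδ2 : δ ≤ 2) {E : ℝ → Space n}
    (hE : IsPeriodicField E) {V : ℝ → Space n → ℝ} (hV : IsPotential δ V) (s : ℝ)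
    {w : Space n} (hw : ‖w‖ = 1) (hwE : inner ℝ w (meanField E) = 0) {a : ℕ}
    (ha : a = 1 ∨ a = 2 ∧ meanField E ≠ 0) (haδ : 1 < a * δ) {f : 𝓢(Space n, ℂ)}
    (hf : HasCompactSupport f) :
    ∃ C v₀, 0 ≤ C ∧ 1 ≤ v₀ ∧ ∀ v, v₀ ≤ v →
      Integrable (fun t => toL2 (realMul (fun x => V t x - orbitPotential V E s (v • w) t)
        (freeSolution E s (v • w) f t))) ∧
      ∫ t, ‖toL2 (realMul (fun x => V t x - orbitPotential V E s (v • w) t)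
        (freeSolution E s (v • w) f t))‖ ≤ C / v := by
  obtain ⟨R, hR⟩ := exists_tsupport_subset_closedBall hf
  obtain ⟨M, v₀, hM, hv₀, hfar⟩ := exists_isFar_highVelocity hE s hw hwE ha R
  obtain ⟨C, hC0, hC⟩ := exists_norm_gauged_potential_le hδ hδ2 hV hf hM hR
  have hM0 : 0 < M := by linarith
  set I₁ : ℝ := ∫ t : ℝ, (1 + |t|) ^ (-(1 + δ)) with hI₁
  set I₂ : ℝ := ∫ t : ℝ, ((1 + |t - s|) ^ a) ^ (-δ) with hI₂
  have hI₁0 : 0 ≤ I₁ := integral_nonneg fun t => by positivity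
  have hI₂0 : 0 ≤ I₂ := integral_nonneg fun t => by positivity
  refine ⟨C * M * (I₁ + I₂), v₀, by positivity, hv₀, fun v hv => ?_⟩
  have hv0 : 0 < v := by linarith
  have hint : Integrable fun t : ℝ => C * M * ((1 + v * |t - s|) ^ (-(1 + δ))
      + v⁻¹ * ((1 + |t - s|) ^ a) ^ (-δ)) :=
    ((integrable_one_add_mul_abs_sub_rpow (by linarith) hv0 s).add
      ((integrable_one_add_abs_sub_pow_rpow haδ s).const_mul _)).const_mul _
  have hbound : ∀ t, ‖toL2 (realMul (fun x => V t x - orbitPotential V E s (v • w) t)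
      (freeSolution E s (v • w) f t))‖ ≤ C * M * ((1 + v * |t - s|) ^ (-(1 + δ))
      + v⁻¹ * ((1 + |t - s|) ^ a) ^ (-δ)) := by
    intro t
    rw [freeSolution, norm_toL2_realMul_twist
      (hasTemperateGrowth_sub_const (hV.hasTemperateGrowth hδ t) _)
      (hasTemperateGrowth_momentumPhase _)]
    obtain ⟨f1, f2, b1, b2⟩ := hfar v hv t
    set z := fieldOrbit E s (v • w) t with hz
    have hz1 : z.1 = t - s := rfl
    have hT := abs_nonneg (t - s)
    have hvT : 0 ≤ v * |t - s| := by positivity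
    set Q₁ : ℝ := 1 + v * |t - s| with hQ₁
    set Q₂ : ℝ := (1 + |t - s|) ^ a with hQ₂
    have hQ₁1 : 1 ≤ Q₁ := by linarith
    have c1 := hC t z Q₁ hQ₁1 f1 b1
    have c2 := hC t z Q₂ (one_le_pow₀ (by linarith)) f2 b2
    have hb := bracket_pos z.2.1
    have h1 : (1 + |z.1|) / bracket z.2.1 ≤ M * (Q₁⁻¹ + v⁻¹) := by
      rw [hz1, div_le_iff₀ hb]
      have h2 : 1 + |t - s| ≤ Q₁ * (Q₁⁻¹ + v⁻¹) := by
        rw [mul_add, mul_inv_cancel₀ (by positivity)]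
        have : |t - s| ≤ Q₁ * v⁻¹ := by
          rw [← div_eq_mul_inv, le_div_iff₀ hv0]
          linarith
        linarith
      calc 1 + |t - s| ≤ Q₁ * (Q₁⁻¹ + v⁻¹) := h2
        _ ≤ (M * bracket z.2.1) * (Q₁⁻¹ + v⁻¹) := by gcongr
        _ = _ := by ring
    set X := ‖toL2 (realMul (fun x => V t x - V t z.2.1) (freeEvol z f))‖ with hX
    have h0 : 0 ≤ (1 + |z.1|) / bracket z.2.1 := by positivity
    set q := (1 + |z.1|) / bracket z.2.1 with hq
    have h3 : Q₁ ^ (-(1 + δ)) = Q₁⁻¹ * Q₁ ^ (-δ) := by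
      rw [neg_add, Real.rpow_add (by linarith), Real.rpow_neg_one]
    change X ≤ _
    rw [h3]
    have hm : X ≤ C * q * min (Q₁ ^ (-δ)) (Q₂ ^ (-δ)) := by
      rcases min_choice (Q₁ ^ (-δ)) (Q₂ ^ (-δ)) with h | h <;> rw [h] <;> assumption
    have hQ₁' : 0 ≤ Q₁ ^ (-δ) := by positivity
    have hQ₂' : 0 ≤ Q₂ ^ (-δ) := by positivity
    have hmin : 0 ≤ min (Q₁ ^ (-δ)) (Q₂ ^ (-δ)) := le_min hQ₁' hQ₂'
    calc X ≤ C * q * min (Q₁ ^ (-δ)) (Q₂ ^ (-δ)) := hm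
      _ ≤ C * (M * (Q₁⁻¹ + v⁻¹)) * min (Q₁ ^ (-δ)) (Q₂ ^ (-δ)) := by gcongr
      _ = C * M * (Q₁⁻¹ * min (Q₁ ^ (-δ)) (Q₂ ^ (-δ)) + v⁻¹ * min (Q₁ ^ (-δ)) (Q₂ ^ (-δ))) := by
          ring
      _ ≤ _ := by
          gcongr
          · exact min_le_left _ _
          · exact min_le_right _ _
  have hi : Integrable (fun t => toL2 (realMul (fun x => V t x - orbitPotential V E s (v • w) t)
      (freeSolution E s (v • w) f t))) :=
    hint.mono' (continuous_gauged_potential hδ hV (continuous_orbitPotential hE hV s _)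
      (hasACDeriv_freeSolution hE s _ f).continuous).aestronglyMeasurable
      (Eventually.of_forall hbound)
  refine ⟨hi, (integral_mono hi.norm hint hbound).trans ?_⟩
  rw [integral_const_mul, integral_add (integrable_one_add_mul_abs_sub_rpow (by linarith) hv0 s)
    ((integrable_one_add_abs_sub_pow_rpow haδ s).const_mul _), integral_const_mul,
    integral_one_add_mul_abs_sub_rpow hv0]
  apply le_of_eq
  rw [← hI₁, ← hI₂]
  ring

end HighVelocity

/-! ### The commutator with the momentum. -/

section MomentumCommutator

variable {n : ℕ}

theorem abs_gradComponent_le {V : ℝ → Space n → ℝ} (j : Fin n) (t : ℝ) (x : Space n) :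
    |gradComponent V j t x| ≤ ‖fderiv ℝ (V t) x‖ := by
  have := (fderiv ℝ (V t) x).le_opNorm (EuclideanSpace.single j 1)
  simpa [gradComponent] using this

/-- The gradient gains one power, so its exponent exceeds 1 for every δ > 0; the cap at 2 is the
range of the propagation estimate. -/
theorem IsPotential.exists_gradComponent_bound {δ : ℝ} (hδ : 0 < δ) {V : ℝ → Space n → ℝ}
    (hV : IsPotential δ V) : ∃ D μ : ℝ, 0 ≤ D ∧ 1 < μ ∧ μ ≤ 2 ∧
      ∀ j t x, |gradComponent V j t x| ≤ D * bracket x ^ (-μ) := by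
  obtain ⟨D, hD0, hD⟩ := hV.exists_fderiv_bound
  refine ⟨D, min (1 + δ) 2, hD0, lt_min (by linarith) one_lt_two, min_le_right _ _,
    fun j t x => ?_⟩
  refine (abs_gradComponent_le j t x).trans ((hD t x).trans ?_)
  gcongr
  · exact one_le_bracket x
  · linarith [min_le_left (1 + δ) 2]

theorem IsPotential.hasTemperateGrowth_gradComponent {δ : ℝ} (hδ : 0 < δ) {V : ℝ → Space n → ℝ}
    (hV : IsPotential δ V) (j : Fin n) (t : ℝ) :
    Function.HasTemperateGrowth (fun x : Space n => ((gradComponent V j t x : ℝ) : ℂ)) := by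
  have hd : ContDiff ℝ ((⊤ : ℕ∞) : WithTop ℕ∞) (fderiv ℝ (V t)) :=
    (hV.contDiff_slice t).fderiv_right (by simp)
  have h1 : Function.HasTemperateGrowth (fderiv ℝ (V t)) := by
    refine ⟨hd, fun m => ?_⟩
    obtain ⟨C, hC⟩ := hV.decay 0 (m + 1)
    refine ⟨0, |C|, fun x => ?_⟩
    have h := hC t x
    simp only [iteratedDeriv_zero] at h
    rw [norm_iteratedFDeriv_fderiv, pow_zero, mul_one]
    refine h.trans ?_
    have hb1 : bracket x ^ (-δ - ((m + 1 : ℕ) : ℝ)) ≤ 1 :=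
      Real.rpow_le_one_of_one_le_of_nonpos (one_le_bracket x) (by
        have : (0 : ℝ) ≤ ((m + 1 : ℕ) : ℝ) := Nat.cast_nonneg _
        linarith)
    have hb0 := Real.rpow_nonneg (bracket_pos x).le (-δ - ((m + 1 : ℕ) : ℝ))
    calc C * bracket x ^ (-δ - ((m + 1 : ℕ) : ℝ)) ≤ |C| * bracket x ^ (-δ - ((m + 1 : ℕ) : ℝ)) := by
          gcongr
          exact le_abs_self C
      _ ≤ |C| * 1 := by gcongr
      _ = _ := mul_one _
  exact Function.HasTemperateGrowth.comp
    (g := fun L : Space n →L[ℝ] ℝ => ((L (EuclideanSpace.single j 1) : ℝ) : ℂ))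
    ((Complex.ofRealCLM.comp (ContinuousLinearMap.apply ℝ ℝ
      (EuclideanSpace.single j (1 : ℝ) : Space n))).hasTemperateGrowth) h1

/-- The symbol of the `j`-th component of the momentum. -/
def momentumSymbol (j : Fin n) (f : 𝓢(Space n, ℂ)) : 𝓢(Space n, ℂ) :=
  (2 * Real.pi : ℂ) • coordMul (EuclideanSpace.single j (1 : ℝ)) f

theorem momentum_twist_fourierInv (j : Fin n) (b : Space n) (f : 𝓢(Space n, ℂ)) :
    momentum j (twist (fun x => momentumPhase x b) (𝓕⁻ f))
      = twist (fun x => momentumPhase x b) (𝓕⁻ (momentumSymbol j f))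
        + ((inner ℝ b (EuclideanSpace.single j (1 : ℝ)) : ℝ) : ℂ) •
          twist (fun x => momentumPhase x b) (𝓕⁻ f) := by
  rw [momentum, lineDeriv_twist_fourierInv, fourierInv_smul', twist_smul, smul_smul,
    fourierInv_add', twist_add, fourierInv_smul' _ f, twist_smul]
  simp [momentumSymbol]

theorem momentum_fourierInv (j : Fin n) (f : 𝓢(Space n, ℂ)) :
    momentum j (𝓕⁻ f) = 𝓕⁻ (momentumSymbol j f) := by
  have := momentum_twist_fourierInv j 0 f
  simp only [twist_momentumPhase_zero, inner_zero_left, Complex.ofReal_zero, zero_smul,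
    add_zero] at this
  exact this

theorem coordMul_twist {a : Space n → ℝ} (ha : Function.HasTemperateGrowth a) (m : Space n)
    (f : 𝓢(Space n, ℂ)) : coordMul m (twist a f) = twist a (coordMul m f) := by
  ext x
  rw [coordMul_apply, twist_apply ha, twist_apply ha, coordMul_apply]
  ring

theorem momentum_freeEvol (j : Fin n) (z : ℝ × Space n × ℝ) (f : 𝓢(Space n, ℂ)) :
    momentum j (freeEvol z f) = freeEvol z (momentumSymbol j f) := by
  rw [freeEvol, momentum_fourierInv, momentumSymbol, momentumSymbol,
    coordMul_twist (isPhaseFamily_freePhase.temperate z), freeEvol, twist_smul]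

theorem hasCompactSupport_momentumSymbol (j : Fin n) {f : 𝓢(Space n, ℂ)}
    (hf : HasCompactSupport f) : HasCompactSupport (momentumSymbol j f) := by
  refine hf.of_isClosed_subset (isClosed_tsupport _) (closure_mono fun x hx hx' => hx ?_)
  rw [momentumSymbol, smul_apply, coordMul_apply, hx', mul_zero, smul_zero]

theorem inner_toL2_momentum (j : Fin n) (φ ψ : 𝓢(Space n, ℂ)) :
    inner ℂ (toL2 (momentum j φ)) (toL2 ψ) = inner ℂ (toL2 φ) (toL2 (momentum j ψ)) := by
  rw [momentum, momentum, toL2_smul, toL2_smul, inner_smul_left, inner_smul_right,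
    inner_toL2_lineDeriv]
  simp

theorem realMul_momentum_sub {g g' : Space n → ℝ} {j : Fin n}
    (hg : Function.HasTemperateGrowth (fun x : Space n => ((g x : ℝ) : ℂ)))
    (hg' : Function.HasTemperateGrowth (fun x : Space n => ((g' x : ℝ) : ℂ)))
    (hd : Differentiable ℝ g) (h : ∀ x, g' x = fderiv ℝ g x (EuclideanSpace.single j 1))
    (φ : 𝓢(Space n, ℂ)) :
    realMul g (momentum j φ) - momentum j (realMul g φ) = Complex.I • realMul g' φ := by
  ext x
  rw [sub_apply, smul_apply, realMul_apply hg, realMul_apply hg', momentum, momentum, smul_apply,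
    smul_apply, SchwartzMap.lineDerivOp_apply_eq_fderiv, SchwartzMap.lineDerivOp_apply_eq_fderiv]
  have h0 : ⇑(realMul g φ) = (fun x => ((g x : ℝ) : ℂ)) * ⇑φ := funext fun x => realMul_apply hg φ x
  have h1 : HasFDerivAt (fun x : Space n => ((g x : ℝ) : ℂ))
      (Complex.ofRealCLM.comp (fderiv ℝ g x)) x :=
    Complex.ofRealCLM.hasFDerivAt.comp x (hd x).hasFDerivAt
  rw [h0, (h1.mul (φ.hasFDerivAt x)).fderiv, h x]
  simp
  ring

theorem inner_toL2_realMul_momentum_sub {g g' : Space n → ℝ} {j : Fin n}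
    (hg : Function.HasTemperateGrowth (fun x : Space n => ((g x : ℝ) : ℂ)))
    (hg' : Function.HasTemperateGrowth (fun x : Space n => ((g' x : ℝ) : ℂ)))
    (hd : Differentiable ℝ g) (h : ∀ x, g' x = fderiv ℝ g x (EuclideanSpace.single j 1))
    (φ ψ : 𝓢(Space n, ℂ)) :
    inner ℂ (toL2 ψ) (toL2 (realMul g (momentum j φ)))
      - inner ℂ (toL2 (momentum j ψ)) (toL2 (realMul g φ))
      = Complex.I * inner ℂ (toL2 ψ) (toL2 (realMul g' φ)) := by
  rw [inner_toL2_momentum, ← inner_sub_right, ← toL2_sub, realMul_momentum_sub hg hg' hd h,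
    toL2_smul, inner_smul_right]

theorem boost_eq_twist (lam : ℝ) (w : Space n) (Φ : 𝓢(Space n, ℂ)) :
    boost lam w Φ = twist (fun x => momentumPhase x (Real.sqrt lam • w)) Φ := by
  ext x
  rw [boost_apply, twist_apply (hasTemperateGrowth_momentumPhase _), planeWave, momentumPhase_apply,
    real_inner_smul_right, real_inner_comm]

/-- The boost adds the real scalar b_j to the momentum on both sides, and these large terms cancel
exactly. -/
theorem commutatorForm_boost (Wp Wm : L2 n →L[ℂ] L2 n) (j : Fin n) (b : Space n)
    (f g : 𝓢(Space n, ℂ)) :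
    commutatorForm (scatteringOperator Wp Wm) j (twist (fun x => momentumPhase x b) (𝓕⁻ f))
        (twist (fun x => momentumPhase x b) (𝓕⁻ g))
      = inner ℂ (Wp (toL2 (twist (fun x => momentumPhase x b) (𝓕⁻ g))))
          (Wm (toL2 (twist (fun x => momentumPhase x b) (𝓕⁻ (momentumSymbol j f)))))
        - inner ℂ (Wp (toL2 (twist (fun x => momentumPhase x b) (𝓕⁻ (momentumSymbol j g)))))
          (Wm (toL2 (twist (fun x => momentumPhase x b) (𝓕⁻ f)))) := by
  simp only [commutatorForm, scatteringOperator, ContinuousLinearMap.comp_apply,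
    ContinuousLinearMap.adjoint_inner_right, momentum_twist_fourierInv, toL2_add, toL2_smul,
    map_add, map_smul, inner_add_left, inner_add_right, inner_smul_left, inner_smul_right,
    Complex.conj_ofReal]
  ring

/-- The matrix element of the commutator of the potential with the momentum, at time `t`. -/
def forceElement (V : ℝ → Space n → ℝ) (j : Fin n) (f g : 𝓢(Space n, ℂ)) (t : ℝ)
    (z : ℝ × Space n × ℝ) : ℂ :=
  inner ℂ (toL2 (freeEvol z g)) (toL2 (realMul (gradComponent V j t) (freeEvol z f)))

/-- The commutator of V - c with p_j is i∂_jV for every constant c, so the function of time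
subtracted from the potential does not enter the main term. -/
theorem forceElement_eq {δ : ℝ} (hδ : 0 < δ) {V : ℝ → Space n → ℝ} (hV : IsPotential δ V)
    (j : Fin n) (f g : 𝓢(Space n, ℂ)) (t c : ℝ) (z : ℝ × Space n × ℝ) :
    Complex.I * forceElement V j f g t z
      = inner ℂ (toL2 (freeEvol z g))
          (toL2 (realMul (fun x => V t x - c) (freeEvol z (momentumSymbol j f))))
        - inner ℂ (toL2 (freeEvol z (momentumSymbol j g)))
          (toL2 (realMul (fun x => V t x - c) (freeEvol z f))) := by
  rw [forceElement, ← momentum_freeEvol, ← momentum_freeEvol]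
  refine (inner_toL2_realMul_momentum_sub (hasTemperateGrowth_sub_const (hV.hasTemperateGrowth hδ t)
    c) (hV.hasTemperateGrowth_gradComponent hδ j t) ?_ (fun x => ?_) _ _).symm
  · exact ((hV.contDiff_slice t).differentiable (by simp)).sub_const c
  · rw [fderiv_sub_const]
    rfl

theorem inner_toL2_realMul_twist {g : Space n → ℝ}
    (hg : Function.HasTemperateGrowth (fun x : Space n => ((g x : ℝ) : ℂ))) {b : Space n → ℝ}
    (hb : Function.HasTemperateGrowth b) (φ ψ : 𝓢(Space n, ℂ)) :
    inner ℂ (toL2 (twist b ψ)) (toL2 (realMul g (twist b φ)))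
      = inner ℂ (toL2 ψ) (toL2 (realMul g φ)) := by
  have : realMul g (twist b φ) = twist b (realMul g φ) := by
    ext x
    rw [realMul_apply hg, twist_apply hb, twist_apply hb, realMul_apply hg]
    ring
  rw [this, inner_toL2_twist hb]

end MomentumCommutator

/-! ### The leading term and its limit at high velocity. -/

section MainTerm

variable {n : ℕ}

theorem continuous_forceElement {δ : ℝ} (hδ : 0 < δ) {V : ℝ → Space n → ℝ} (hV : IsPotential δ V)
    (j : Fin n) (f g : 𝓢(Space n, ℂ)) {z : ℝ → ℝ × Space n × ℝ} (hz : Continuous z) :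
    Continuous fun t => forceElement V j f g t (z t) := by
  have hc : ∀ h : 𝓢(Space n, ℂ), Continuous fun t => toL2 (freeEvol (z t) h) := fun h =>
    (continuous_toL2_freeEvol h).comp hz
  have h1 : (fun t => forceElement V j f g t (z t)) = fun t => -Complex.I *
      (inner ℂ (toL2 (freeEvol (z t) g))
          (toL2 (realMul (fun x => V t x - 0) (freeEvol (z t) (momentumSymbol j f))))
        - inner ℂ (toL2 (freeEvol (z t) (momentumSymbol j g)))
          (toL2 (realMul (fun x => V t x - 0) (freeEvol (z t) f)))) := by
    funext t
    rw [← forceElement_eq hδ hV j f g t 0 (z t), ← mul_assoc]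
    simp
  rw [h1]
  exact continuous_const.mul
    (((hc g).inner (continuous_gauged_potential hδ hV continuous_const (hc _))).sub
      ((hc _).inner (continuous_gauged_potential hδ hV continuous_const (hc f))))

/-- The action enters as a scalar phase and cancels. It has to be removed before the limit: on the
time scale 1/v the action itself grows like v. -/
theorem forceElement_action (V : ℝ → Space n → ℝ) (j : Fin n) (f g : 𝓢(Space n, ℂ)) (t : ℝ)
    (z : ℝ × Space n × ℝ) :
    forceElement V j f g t z = forceElement V j f g t (z.1, z.2.1, 0) := by
  have h : ∀ h : 𝓢(Space n, ℂ), freeEvol z h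
      = Complex.exp (-(Complex.I * (z.2.2 : ℂ))) • freeEvol (z.1, z.2.1, 0) h := by
    intro h
    rw [freeEvol, freeEvol, ← fourierInv_smul']
    congr 1
    ext ξ
    rw [smul_apply, twist_apply (isPhaseFamily_freePhase.temperate _),
      twist_apply (isPhaseFamily_freePhase.temperate _), smul_eq_mul, ← mul_assoc, ← Complex.exp_add,
      freePhase_apply, freePhase_apply]
    congr 2
    push_cast
    ring
  have hm : ∀ (φ : 𝓢(Space n, ℂ)) (c : ℂ), realMul (gradComponent V j t) (c • φ)
      = c • realMul (gradComponent V j t) φ := fun φ c => map_smul _ _ _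
  rw [forceElement, forceElement, h f, h g, hm, toL2_smul, toL2_smul, inner_smul_left,
    inner_smul_right, ← mul_assoc]
  have h1 : starRingEnd ℂ (Complex.exp (-(Complex.I * (z.2.2 : ℂ))))
      * Complex.exp (-(Complex.I * (z.2.2 : ℂ))) = 1 := by
    rw [← Complex.exp_conj, ← Complex.exp_add]
    simp
  rw [h1, one_mul]

/-- The first-order expansion is applied to (p_j f, g) and to (f, p_j g). The zeroth order terms
agree by symmetry of p_j, the first order terms combine into a commutator by `forceElement_eq`, and
each remainder is a product of two O(1/v) integrals. -/
theorem exists_commutatorForm_first_order {δ : ℝ} (hδ : 0 < δ) (hδ2 : δ ≤ 2) {E : ℝ → Space n}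
    (hE : IsPeriodicField E) {V : ℝ → Space n → ℝ} (hV : IsPotential δ V)
    {U₀ U : ℝ → ℝ → (L2 n ≃ₗᵢ[ℂ] L2 n)} (hU₀ : IsPropagator (freeHamiltonian E) U₀)
    (hU : IsPropagator (hamiltonian E V) U) (s : ℝ) {Wp Wm : L2 n →L[ℂ] L2 n}
    (hp : IsWaveOperator U U₀ s atTop Wp) (hm : IsWaveOperator U U₀ s atBot Wm)
    {w : Space n} (hw : ‖w‖ = 1) (hwE : inner ℝ w (meanField E) = 0) {a : ℕ}
    (ha : a = 1 ∨ a = 2 ∧ meanField E ≠ 0) (haδ : 1 < a * δ) (j : Fin n) {f g : 𝓢(Space n, ℂ)}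
    (hf : HasCompactSupport f) (hg : HasCompactSupport g) :
    ∃ C v₀, 0 ≤ C ∧ 1 ≤ v₀ ∧ ∀ v, v₀ ≤ v →
      ‖Complex.exp (Complex.I * ((∫ t, orbitPotential V E s (v • w) t : ℝ) : ℂ)) *
          commutatorForm (scatteringOperator Wp Wm) j
            (twist (fun x => momentumPhase x (v • w)) (𝓕⁻ f))
            (twist (fun x => momentumPhase x (v • w)) (𝓕⁻ g))
        - ∫ t, forceElement V j f g t (fieldOrbit E s (v • w) t)‖ ≤ C / v ^ 2 := by
  have hf' := hasCompactSupport_momentumSymbol j hf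
  have hg' := hasCompactSupport_momentumSymbol j hg
  obtain ⟨C₁, v₁, hC₁, hv₁, h₁⟩ :=
    exists_integral_gauged_potential_le hδ hδ2 hE hV s hw hwE ha haδ hf
  obtain ⟨C₂, v₂, hC₂, hv₂, h₂⟩ :=
    exists_integral_gauged_potential_le hδ hδ2 hE hV s hw hwE ha haδ hg
  obtain ⟨C₃, v₃, hC₃, hv₃, h₃⟩ :=
    exists_integral_gauged_potential_le hδ hδ2 hE hV s hw hwE ha haδ hf'
  obtain ⟨C₄, v₄, hC₄, hv₄, h₄⟩ :=
    exists_integral_gauged_potential_le hδ hδ2 hE hV s hw hwE ha haδ hg'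
  obtain ⟨C₅, v₅, hC₅, hv₅, h₅⟩ := exists_orbitPotential_bound hδ hE hV s hw hwE ha
  refine ⟨C₃ * C₂ + C₁ * C₄, v₁ + v₂ + v₃ + v₄ + v₅, by positivity, by linarith, fun v hv => ?_⟩
  have hv0 : 0 < v := by linarith
  obtain ⟨i₁, b₁⟩ := h₁ v (by linarith)
  obtain ⟨i₂, b₂⟩ := h₂ v (by linarith)
  obtain ⟨i₃, b₃⟩ := h₃ v (by linarith)
  obtain ⟨i₄, b₄⟩ := h₄ v (by linarith)
  have hυ := continuous_orbitPotential hE hV s (v • w)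
  have hυi := integrable_orbitPotential hE hV haδ fun t => (h₅ v (by linarith) t).1
  have n₁ := norm_inner_waveOperator_sub_le hδ hE hV hU₀ hU s hp hm (v • w) hυ hυi
    (momentumSymbol j f) g i₃ i₂
  have n₂ := norm_inner_waveOperator_sub_le hδ hE hV hU₀ hU s hp hm (v • w) hυ hυi
    f (momentumSymbol j g) i₁ i₄
  have hii : ∀ F G : 𝓢(Space n, ℂ),
      Integrable (fun t => toL2 (realMul (fun x => V t x - orbitPotential V E s (v • w) t)
        (freeSolution E s (v • w) F t))) →
      Integrable fun t => inner ℂ (toL2 (freeSolution E s (v • w) G t))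
        (toL2 (realMul (fun x => V t x - orbitPotential V E s (v • w) t)
          (freeSolution E s (v • w) F t))) := by
    intro F G hi
    refine (hi.norm.const_mul ‖toL2 G‖).mono'
      ((hasACDeriv_freeSolution hE s _ G).continuous.aestronglyMeasurable.inner
        hi.aestronglyMeasurable) (Eventually.of_forall fun t => ?_)
    refine (norm_inner_le_norm _ _).trans (le_of_eq ?_)
    rw [freeSolution, norm_toL2_twist (hasTemperateGrowth_momentumPhase _), norm_toL2_freeEvol]
  have hsym : inner ℂ (toL2 (𝓕⁻ g)) (toL2 (𝓕⁻ (momentumSymbol j f)))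
      = inner ℂ (toL2 (𝓕⁻ (momentumSymbol j g))) (toL2 (𝓕⁻ f)) := by
    rw [← momentum_fourierInv, ← momentum_fourierInv, inner_toL2_momentum]
  have hforce : Complex.I * ∫ t, forceElement V j f g t (fieldOrbit E s (v • w) t)
      = (∫ t, inner ℂ (toL2 (freeSolution E s (v • w) g t))
          (toL2 (realMul (fun x => V t x - orbitPotential V E s (v • w) t)
            (freeSolution E s (v • w) (momentumSymbol j f) t))))
        - ∫ t, inner ℂ (toL2 (freeSolution E s (v • w) (momentumSymbol j g) t))
          (toL2 (realMul (fun x => V t x - orbitPotential V E s (v • w) t)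
            (freeSolution E s (v • w) f t))) := by
    rw [← integral_sub (hii _ _ i₃) (hii _ _ i₁), ← integral_const_mul]
    congr 1
    funext t
    have ht := hasTemperateGrowth_sub_const (hV.hasTemperateGrowth hδ t)
      (orbitPotential V E s (v • w) t)
    rw [forceElement_eq hδ hV j f g t (orbitPotential V E s (v • w) t)]
    simp only [freeSolution, inner_toL2_realMul_twist ht (hasTemperateGrowth_momentumPhase _)]
  rw [commutatorForm_boost]
  have hfin := norm_sub_le_of_le (n₁.trans (mul_le_mul b₃ b₂ (integral_nonneg fun _ => norm_nonneg _)
    (by positivity))) (n₂.trans (mul_le_mul b₁ b₄ (integral_nonneg fun _ => norm_nonneg _)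
    (by positivity)))
  refine le_trans (le_of_eq ?_) (hfin.trans (le_of_eq ?_))
  · congr 1
    rw [hsym]
    linear_combination Complex.I * hforce
      - (∫ t, forceElement V j f g t (fieldOrbit E s (v • w) t)) * Complex.I_sq
  · field_simp

theorem displacement_continuous {E : ℝ → Space n} (hE : IsPeriodicField E) (s : ℝ) :
    Continuous (displacement E s) := by
  have h : displacement E s = fun t => (fieldOrbit E s 0 t).2.1 := by
    funext t
    rw [fieldOrbit_position hE]
    simp
  rw [h]
  exact continuous_fst.comp (continuous_snd.comp (continuous_fieldOrbit hE s 0))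

theorem displacement_self (E : ℝ → Space n) (s : ℝ) : displacement E s s = 0 :=
  intervalIntegral.integral_same

theorem exists_forceElement_bound {δ : ℝ} (hδ : 0 < δ) {V : ℝ → Space n → ℝ} (hV : IsPotential δ V)
    {f : 𝓢(Space n, ℂ)} (hf : HasCompactSupport f) (g : 𝓢(Space n, ℂ)) {M : ℝ} (hM : 1 ≤ M)
    {K : Set (Space n)} (hK : tsupport f ⊆ K) :
    ∃ C μ : ℝ, 0 ≤ C ∧ 1 < μ ∧ ∀ j t z Q, 1 ≤ Q → IsFar K M z Q →
      ‖forceElement V j f g t z‖ ≤ C * Q ^ (-μ) := by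
  obtain ⟨D, μ, hD0, hμ, hμ2, hD⟩ := hV.exists_gradComponent_bound hδ
  obtain ⟨C, hC0, hC⟩ := IsFar.norm_toL2_realMul_freeEvol_le hf hM hK
  refine ⟨‖toL2 g‖ * (C * D), μ, by positivity, hμ, fun j t z Q hQ hfar => ?_⟩
  refine (norm_inner_le_norm _ _).trans ?_
  rw [norm_toL2_freeEvol, mul_assoc]
  gcongr
  exact hC z Q hQ hfar _ D μ (hV.hasTemperateGrowth_gradComponent hδ j t) hD0 (by linarith) hμ2
    (hD j t)

/-- Under t = s + r/v the orbit point becomes rw plus a displacement that vanishes in the limit, and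
t → s. Since 1 + v|t-s| = 1 + |r|, the propagation estimate for ∂_jV supplies a majorant independent
of v. -/
theorem tendsto_integral_forceElement {δ : ℝ} (hδ : 0 < δ) {E : ℝ → Space n}
    (hE : IsPeriodicField E) {V : ℝ → Space n → ℝ} (hV : IsPotential δ V) (s : ℝ)
    {w : Space n} (hw : ‖w‖ = 1) (hwE : inner ℝ w (meanField E) = 0) (j : Fin n)
    {f : 𝓢(Space n, ℂ)} (hf : HasCompactSupport f) (g : 𝓢(Space n, ℂ)) :
    Tendsto (fun v : ℝ => (v : ℂ) * ∫ t, forceElement V j f g t (fieldOrbit E s (v • w) t)) atTop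
      (𝓝 (∫ r : ℝ, forceElement V j f g s (0, r • w, 0))) := by
  obtain ⟨R, hR⟩ := exists_tsupport_subset_closedBall hf
  -- Only the bound by 1 + v|t-s| is used, so a = 1 suffices whatever the mean field.
  obtain ⟨M, v₀, hM, hv₀, hfar⟩ := exists_isFar_highVelocity hE s hw hwE (a := 1) (Or.inl rfl) R
  obtain ⟨C, μ, hC0, hμ, hC⟩ := exists_forceElement_bound hδ hV hf g hM hR
  set F : ℝ → ℝ → ℂ := fun v t => forceElement V j f g t (fieldOrbit E s (v • w) t) with hF
  have hFc : ∀ v, Continuous (F v) := fun v =>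
    continuous_forceElement hδ hV j f g (continuous_fieldOrbit hE s _)
  have hlim : Tendsto (fun v : ℝ => ∫ r : ℝ, F v (v⁻¹ * r + s)) atTop
      (𝓝 (∫ r : ℝ, forceElement V j f g s (0, r • w, 0))) := by
    refine tendsto_integral_filter_of_dominated_convergence (fun r => C * (1 + |r|) ^ (-μ))
      (Eventually.of_forall fun v => ?_) ?_ ((integrable_one_add_abs_rpow hμ).const_mul C)
      (Eventually.of_forall fun r => ?_)
    · exact ((hFc v).comp (by fun_prop)).aestronglyMeasurable
    · filter_upwards [eventually_ge_atTop v₀] with v hv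
      have hv0 : 0 < v := by linarith
      refine Eventually.of_forall fun r => ?_
      have h1 := (hfar v hv (v⁻¹ * r + s)).1
      rw [add_sub_cancel_right, abs_mul, abs_of_pos (inv_pos.2 hv0), mul_inv_cancel_left₀ hv0.ne']
        at h1
      exact hC j _ _ _ (by linarith [abs_nonneg r]) h1
    · have hc : Continuous fun t =>
          forceElement V j f g t (t - s, r • w + displacement E s t, 0) := by
        refine continuous_forceElement hδ hV j f g ?_
        have := displacement_continuous hE s
        fun_prop
      have h1 : Tendsto (fun v : ℝ => v⁻¹ * r + s) atTop (𝓝 s) := by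
        have := (tendsto_inv_atTop_zero (𝕜 := ℝ)).mul_const r |>.add_const s
        rwa [zero_mul, zero_add] at this
      have h2 := (hc.tendsto s).comp h1
      simp only [sub_self, displacement_self, add_zero] at h2
      refine h2.congr' ?_
      filter_upwards [eventually_gt_atTop 0] with v hv
      simp only [hF, Function.comp_apply]
      rw [forceElement_action _ _ _ _ _ (fieldOrbit _ _ _ _), fieldOrbit_position hE,
        add_sub_cancel_right, smul_smul, mul_right_comm, inv_mul_cancel₀ hv.ne', one_mul]
      congr 2
      simp [fieldOrbit]
  refine hlim.congr' ?_
  filter_upwards [eventually_gt_atTop 0] with v hv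
  have h1 := Measure.integral_comp_mul_left (fun t => F v (t + s)) v⁻¹
  rw [h1, integral_add_right_eq_self (F v) s, inv_inv, abs_of_pos hv, Complex.real_smul]

end MainTerm

/-! ### The limit as an X-ray transform. -/

section XRay

variable {n : ℕ}

/-- Two Fourier transforms make a reflection, which preserves compact support. -/
theorem exists_fourierInv_of_isFourierOfTestFunction {Φ : 𝓢(Space n, ℂ)}
    (hΦ : IsFourierOfTestFunction Φ) :
    ∃ f : 𝓢(Space n, ℂ), HasCompactSupport f ∧ Φ = 𝓕⁻ f := by
  obtain ⟨f, hf, rfl⟩ := hΦ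
  refine ⟨𝓕 (𝓕 f), ?_, (FourierTransform.fourierInv_fourier_eq _).symm⟩
  have h : ⇑(𝓕 (𝓕 f) : 𝓢(Space n, ℂ)) = f ∘ Homeomorph.neg (Space n) := by
    funext ξ
    have h1 : (𝓕⁻ (𝓕 f)) (-ξ) = f (-ξ) := by rw [FourierTransform.fourierInv_fourier_eq]
    rw [SchwartzMap.fourierInv_coe, Real.fourierInv_eq_fourier_neg, neg_neg] at h1
    rw [SchwartzMap.fourier_coe]
    exact h1
  rw [h]
  exact hf.comp_homeomorph _

theorem freeEvol_translation (y x : Space n) (f : 𝓢(Space n, ℂ)) :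
    freeEvol (0, y, 0) f x = (𝓕⁻ f) (x - y) := by
  rw [freeEvol, SchwartzMap.fourierInv_coe, SchwartzMap.fourierInv_coe, Real.fourierInv_eq',
    Real.fourierInv_eq']
  congr 1
  funext ξ
  rw [twist_apply (isPhaseFamily_freePhase.temperate _), smul_eq_mul, smul_eq_mul, ← mul_assoc,
    ← Complex.exp_add, freePhase_apply, inner_sub_right]
  congr 2
  push_cast
  ring

theorem forceElement_translation {δ : ℝ} (hδ : 0 < δ) {V : ℝ → Space n → ℝ} (hV : IsPotential δ V)
    (j : Fin n) (f g : 𝓢(Space n, ℂ)) (s : ℝ) (y : Space n) :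
    forceElement V j f g s (0, y, 0)
      = ∫ x, (gradComponent V j s (x + y) : ℂ) * (𝓕⁻ f) x * star ((𝓕⁻ g) x) := by
  rw [forceElement, inner_toL2, ← integral_add_right_eq_self _ y]
  congr 1
  funext x
  rw [realMul_apply (hV.hasTemperateGrowth_gradComponent hδ j s), freeEvol_translation,
    freeEvol_translation, add_sub_cancel_right]

/-- The component of x + rw along w is r + x·w. The majorant is thus a translate of a fixed
integrable function, whose integral in r does not depend on x; this is what makes Fubini work. -/
theorem exists_gradComponent_line_bound {δ : ℝ} (hδ : 0 < δ) {V : ℝ → Space n → ℝ}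
    (hV : IsPotential δ V) {w : Space n} (hw : ‖w‖ = 1) :
    ∃ D μ : ℝ, 0 ≤ D ∧ 1 < μ ∧ ∀ j t x (r : ℝ),
      |gradComponent V j t (x + r • w)| ≤ D * (1 + |r + inner ℝ x w|) ^ (-μ) := by
  obtain ⟨D, μ, hD0, hμ, -, hD⟩ := hV.exists_gradComponent_bound hδ
  refine ⟨D * 2 ^ μ, μ, by positivity, hμ, fun j t x r => (hD j t _).trans ?_⟩
  have h1 : |r + inner ℝ x w| ≤ ‖x + r • w‖ := by
    have := abs_real_inner_le_norm (x + r • w) w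
    rw [inner_add_left, real_inner_smul_left, real_inner_self_eq_norm_sq, hw, one_pow, mul_one,
      mul_one, add_comm] at this
    exact this
  have h2 : (1 + |r + inner ℝ x w|) / 2 ≤ bracket (x + r • w) := by
    linarith [one_le_bracket (x + r • w), norm_le_bracket (x + r • w)]
  have h3 := Real.rpow_le_rpow_of_nonpos (by positivity) h2 (by linarith : -μ ≤ 0)
  rw [Real.div_rpow (by positivity) zero_le_two, Real.rpow_neg zero_le_two, div_inv_eq_mul] at h3
  rw [mul_assoc, mul_comm (2 ^ μ)]
  gcongr

theorem IsPotential.continuous_gradComponent {δ : ℝ} {V : ℝ → Space n → ℝ}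
    (hV : IsPotential δ V) (j : Fin n) (t : ℝ) : Continuous (gradComponent V j t) :=
  ((hV.contDiff_slice t).continuous_fderiv (by simp)).clm_apply continuous_const

theorem integrable_gradComponent_line {δ : ℝ} (hδ : 0 < δ) {V : ℝ → Space n → ℝ}
    (hV : IsPotential δ V) {w : Space n} (hw : ‖w‖ = 1) (j : Fin n) (s : ℝ) (x : Space n) :
    Integrable fun r : ℝ => gradComponent V j s (x + r • w) := by
  obtain ⟨D, μ, hD0, hμ, hD⟩ := exists_gradComponent_line_bound hδ hV hw
  refine (((integrable_one_add_abs_rpow hμ).comp_add_right (inner ℝ x w)).const_mul D).mono'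
    ((hV.continuous_gradComponent j s).comp (by fun_prop)).aestronglyMeasurable
    (Eventually.of_forall fun r => hD j s x r)

theorem integrable_gradComponent_prod {δ : ℝ} (hδ : 0 < δ) {V : ℝ → Space n → ℝ}
    (hV : IsPotential δ V) {w : Space n} (hw : ‖w‖ = 1) (j : Fin n) (s : ℝ)
    (Φ Ψ : 𝓢(Space n, ℂ)) :
    Integrable (Function.uncurry fun (r : ℝ) (x : Space n) =>
      (gradComponent V j s (x + r • w) : ℂ) * Φ x * star (Ψ x)) (volume.prod volume) := by
  obtain ⟨D, μ, hD0, hμ, hD⟩ := exists_gradComponent_line_bound hδ hV hw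
  have hi : Integrable fun r : ℝ => (1 + |r|) ^ (-μ) := integrable_one_add_abs_rpow hμ
  have hΦΨ : Integrable fun x => ‖Φ x * star (Ψ x)‖ := by
    have h := L2.integrable_inner (𝕜 := ℂ) (toL2 Ψ) (toL2 Φ)
    refine (h.congr ?_).norm
    filter_upwards [Φ.coeFn_toLp 2 volume, Ψ.coeFn_toLp 2 volume] with x h1 h2
    rw [h1, h2]
    rfl
  have hc : Continuous (Function.uncurry fun (r : ℝ) (x : Space n) =>
      (gradComponent V j s (x + r • w) : ℂ) * Φ x * star (Ψ x)) := by
    have h1 := hV.continuous_gradComponent j s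
    have h2 := Φ.continuous
    have h3 := Ψ.continuous
    unfold Function.uncurry
    exact ((Complex.continuous_ofReal.comp (h1.comp (by fun_prop))).mul (h2.comp continuous_snd)).mul
      (continuous_star.comp (h3.comp continuous_snd))
  have hle : ∀ (r : ℝ) (x : Space n), ‖(gradComponent V j s (x + r • w) : ℂ) * Φ x * star (Ψ x)‖
      ≤ D * (1 + |r + inner ℝ x w|) ^ (-μ) * ‖Φ x * star (Ψ x)‖ := fun r x => by
    rw [mul_assoc, norm_mul, Complex.norm_real, Real.norm_eq_abs]
    gcongr
    exact hD j s x r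
  have hi' : ∀ x : Space n, Integrable fun r : ℝ =>
      D * (1 + |r + inner ℝ x w|) ^ (-μ) * ‖Φ x * star (Ψ x)‖ := fun x =>
    ((hi.comp_add_right (inner ℝ x w)).const_mul D).mul_const _
  have hmeas : ∀ x : Space n, AEStronglyMeasurable (fun r : ℝ =>
      (gradComponent V j s (x + r • w) : ℂ) * Φ x * star (Ψ x)) volume := fun x =>
    (hc.comp (continuous_id.prodMk continuous_const)).aestronglyMeasurable
  have hint : ∀ x : Space n, Integrable fun r : ℝ =>
      (gradComponent V j s (x + r • w) : ℂ) * Φ x * star (Ψ x) := fun x =>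
    (hi' x).mono' (hmeas x) (Eventually.of_forall fun r => hle r x)
  rw [integrable_prod_iff' hc.aestronglyMeasurable]
  refine ⟨Eventually.of_forall hint, ?_⟩
  refine (hΦΨ.const_mul (D * ∫ r : ℝ, (1 + |r|) ^ (-μ))).mono'
    hc.norm.aestronglyMeasurable.prod_swap.integral_prod_right' (Eventually.of_forall fun x => ?_)
  rw [Real.norm_of_nonneg (integral_nonneg fun _ => norm_nonneg _)]
  refine (integral_mono (hint x).norm (hi' x) fun r => hle r x).trans (le_of_eq ?_)
  rw [integral_mul_const, integral_const_mul,
    integral_add_right_eq_self (fun r : ℝ => (1 + |r|) ^ (-μ))]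

theorem integral_gradComponent_line (V : ℝ → Space n → ℝ) (j : Fin n) (s : ℝ) (w x : Space n)
    (a b : ℂ) : ∫ r : ℝ, (gradComponent V j s (x + r • w) : ℂ) * a * b
      = (xrayGrad V j s w x : ℂ) * a * b := by
  rw [integral_mul_const, integral_mul_const, xrayGrad, integral_complex_ofReal]

theorem integrable_xrayGrad {δ : ℝ} (hδ : 0 < δ) {V : ℝ → Space n → ℝ}
    (hV : IsPotential δ V) {w : Space n} (hw : ‖w‖ = 1) (j : Fin n) (s : ℝ)
    (Φ Ψ : 𝓢(Space n, ℂ)) :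
    Integrable fun x => (xrayGrad V j s w x : ℂ) * Φ x * star (Ψ x) := by
  have h := (integrable_gradComponent_prod hδ hV hw j s Φ Ψ).integral_prod_right
  simpa only [Function.uncurry, integral_gradComponent_line] using h

theorem integral_forceElement_translation {δ : ℝ} (hδ : 0 < δ) {V : ℝ → Space n → ℝ}
    (hV : IsPotential δ V) {w : Space n} (hw : ‖w‖ = 1) (j : Fin n) (s : ℝ)
    (f g : 𝓢(Space n, ℂ)) :
    ∫ r : ℝ, forceElement V j f g s (0, r • w, 0)
      = ∫ x, (xrayGrad V j s w x : ℂ) * (𝓕⁻ f) x * star ((𝓕⁻ g) x) := by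
  simp only [forceElement_translation hδ hV]
  rw [integral_integral_swap (integrable_gradComponent_prod hδ hV hw j s _ _)]
  simp only [integral_gradComponent_line]

end XRay

/-! ### The high-energy limit. -/

section HighEnergyLimit

variable {n : ℕ}

/-- After multiplication by v the error O(v⁻²) still vanishes. The phase tends to 1 and can be
divided out at the end. -/
theorem tendsto_mul_commutatorForm {δ : ℝ} (hδ : 0 < δ) (hδ2 : δ ≤ 2) {E : ℝ → Space n}
    (hE : IsPeriodicField E) {V : ℝ → Space n → ℝ} (hV : IsPotential δ V)
    {U₀ U : ℝ → ℝ → (L2 n ≃ₗᵢ[ℂ] L2 n)} (hU₀ : IsPropagator (freeHamiltonian E) U₀)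
    (hU : IsPropagator (hamiltonian E V) U) (s : ℝ) {Wp Wm : L2 n →L[ℂ] L2 n}
    (hp : IsWaveOperator U U₀ s atTop Wp) (hm : IsWaveOperator U U₀ s atBot Wm)
    {w : Space n} (hw : ‖w‖ = 1) (hwE : inner ℝ w (meanField E) = 0) {a : ℕ}
    (ha : a = 1 ∨ a = 2 ∧ meanField E ≠ 0) (haδ : 1 < a * δ) (j : Fin n) {f g : 𝓢(Space n, ℂ)}
    (hf : HasCompactSupport f) (hg : HasCompactSupport g) :
    Tendsto (fun v : ℝ => (v : ℂ) * commutatorForm (scatteringOperator Wp Wm) j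
        (twist (fun x => momentumPhase x (v • w)) (𝓕⁻ f))
        (twist (fun x => momentumPhase x (v • w)) (𝓕⁻ g))) atTop
      (𝓝 (∫ x, (xrayGrad V j s w x : ℂ) * (𝓕⁻ f) x * star ((𝓕⁻ g) x))) := by
  obtain ⟨C, v₀, hC0, hv₀, hC⟩ := exists_commutatorForm_first_order hδ hδ2 hE hV hU₀ hU s hp hm hw
    hwE ha haδ j hf hg
  have hM := tendsto_integral_forceElement hδ hE hV s hw hwE j hf g
  rw [integral_forceElement_translation hδ hV hw] at hM
  set κ : ℝ → ℂ := fun v =>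
    Complex.exp (Complex.I * ((∫ t, orbitPotential V E s (v • w) t : ℝ) : ℂ)) with hκ
  set X : ℝ → ℂ := fun v => commutatorForm (scatteringOperator Wp Wm) j
    (twist (fun x => momentumPhase x (v • w)) (𝓕⁻ f))
    (twist (fun x => momentumPhase x (v • w)) (𝓕⁻ g)) with hX
  have hκ1 : Tendsto κ atTop (𝓝 1) := by
    have h1 : Continuous fun r : ℝ => Complex.exp (Complex.I * (r : ℂ)) := by fun_prop
    have h2 := (h1.tendsto 0).comp (tendsto_integral_orbitPotential hδ hE hV s hw hwE ha haδ)
    simp only [Complex.ofReal_zero, mul_zero, Complex.exp_zero] at h2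
    exact h2
  have hκX : Tendsto (fun v : ℝ => κ v * ((v : ℂ) * X v)) atTop
      (𝓝 (∫ x, (xrayGrad V j s w x : ℂ) * (𝓕⁻ f) x * star ((𝓕⁻ g) x))) := by
    have h1 : Tendsto (fun v : ℝ => κ v * ((v : ℂ) * X v)
        - (v : ℂ) * ∫ t, forceElement V j f g t (fieldOrbit E s (v • w) t)) atTop (𝓝 0) := by
      refine squeeze_zero_norm' (a := fun v : ℝ => C * v⁻¹) ?_ ?_
      · filter_upwards [eventually_ge_atTop v₀] with v hv
        have hv0 : 0 < v := by linarith
        have h2 := hC v hv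
        have h3 : κ v * ((v : ℂ) * X v)
            - (v : ℂ) * ∫ t, forceElement V j f g t (fieldOrbit E s (v • w) t)
            = (v : ℂ) * (κ v * X v
              - ∫ t, forceElement V j f g t (fieldOrbit E s (v • w) t)) := by ring
        rw [h3, norm_mul, Complex.norm_real, Real.norm_of_nonneg hv0.le]
        calc v * _ ≤ v * (C / v ^ 2) := by gcongr
          _ = C * v⁻¹ := by field_simp
      · simpa using (tendsto_inv_atTop_zero (𝕜 := ℝ)).const_mul C
    simpa using h1.add hM
  have h4 := (hκ1.inv₀ one_ne_zero).mul hκX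
  rw [inv_one, one_mul] at h4
  refine h4.congr fun v => ?_
  rw [inv_mul_cancel_left₀ (Complex.exp_ne_zero _)]

/-- A unit vector orthogonal to a nonzero one exists only if n ≥ 2, so the two dimensional
hypotheses cover all cases. -/
theorem half_lt_of_meanField_ne_zero {δ : ℝ} {E₀ w : Space n} (hw : ‖w‖ = 1)
    (hwE : inner ℝ w E₀ = 0) (h0 : E₀ ≠ 0) (h_three : 3 ≤ n → 1 / 2 < δ)
    (h_two : n = 2 → 3 / 4 < δ) : 1 / 2 < δ := by
  have hn : 2 ≤ n := by
    by_contra! hn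
    have hd : Module.finrank ℝ (Space n) ≤ 1 := by
      rw [finrank_euclideanSpace_fin]
      omega
    have hw0 : w ≠ 0 := by
      rintro rfl
      simp at hw
    rcases lt_or_eq_of_le hd with h | h
    · have : Subsingleton (Space n) := Module.finrank_zero_iff.1 (Nat.lt_one_iff.1 h)
      exact h0 (Subsingleton.elim _ _)
    · obtain ⟨c, rfl⟩ := exists_smul_eq_of_finrank_eq_one h hw0 E₀
      rw [real_inner_smul_right, real_inner_self_eq_norm_sq, hw, one_pow, mul_one] at hwE
      simp [hwE] at h0
  rcases hn.lt_or_eq with h | h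
  · exact h_three h
  · linarith [h_two h.symm]

theorem isLittleO_of_tendsto_mul {X : ℝ → ℂ} {L : ℂ}
    (h : Tendsto (fun v : ℝ => (v : ℂ) * X v) atTop (𝓝 L)) :
    (fun lam : ℝ => X (Real.sqrt lam) - ((lam ^ (-(1 / 2) : ℝ) : ℝ) : ℂ) * L)
      =o[atTop] fun lam : ℝ => lam ^ (-(1 / 2) : ℝ) := by
  have h1 : Tendsto (fun lam : ℝ => (Real.sqrt lam : ℂ) * X (Real.sqrt lam) - L) atTop (𝓝 0) := by
    have := (h.comp Real.tendsto_sqrt_atTop).sub_const L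
    rwa [sub_self] at this
  have h2 := (Asymptotics.isBigO_refl (fun lam : ℝ => ((lam ^ (-(1 / 2) : ℝ) : ℝ) : ℂ))
    atTop).mul_isLittleO ((Asymptotics.isLittleO_one_iff ℂ).2 h1)
  have h3 : (fun lam : ℝ => ((lam ^ (-(1 / 2) : ℝ) : ℝ) : ℂ) * (1 : ℂ))
      =O[atTop] fun lam : ℝ => lam ^ (-(1 / 2) : ℝ) :=
    Asymptotics.isBigO_of_le _ fun lam => by simp
  refine (h2.trans_isBigO h3).congr' ?_ EventuallyEq.rfl
  filter_upwards [eventually_gt_atTop 0] with lam hlam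
  have h4 : lam ^ (-(1 / 2) : ℝ) * Real.sqrt lam = 1 := by
    rw [Real.sqrt_eq_rpow, ← Real.rpow_add hlam]
    norm_num
  have h5 : ((lam ^ (-(1 / 2) : ℝ) : ℝ) : ℂ) * (Real.sqrt lam : ℂ) = 1 := by exact_mod_cast h4
  rw [mul_sub, ← mul_assoc, h5, one_mul]

end HighEnergyLimit

end StarkScattering

end

/-! ### Assembly of the theorem. -/

theorem proposition5 (n : ℕ) (δ : ℝ) (hδ : 0 < δ)
    (E : ℝ → StarkScattering.Space n) (hE : StarkScattering.IsPeriodicField E)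
    (V : ℝ → StarkScattering.Space n → ℝ) (hV : StarkScattering.IsPotential δ V)
    (h_zero : StarkScattering.meanField E = 0 → 1 < δ)
    (h_three : StarkScattering.meanField E ≠ 0 → 3 ≤ n → 1 / 2 < δ)
    (h_two : StarkScattering.meanField E ≠ 0 → n = 2 → 3 / 4 < δ)
    (U₀ U : ℝ → ℝ → (StarkScattering.L2 n ≃ₗᵢ[ℂ] StarkScattering.L2 n))
    (hU₀ : StarkScattering.IsPropagator (StarkScattering.freeHamiltonian E) U₀)
    (hU : StarkScattering.IsPropagator (StarkScattering.hamiltonian E V) U)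
    (w : StarkScattering.Space n) (hw : ‖w‖ = 1)
    (hwE : inner ℝ w (StarkScattering.meanField E) = 0)
    (s : ℝ) :
    ∃ Wp Wm : StarkScattering.L2 n →L[ℂ] StarkScattering.L2 n,
      StarkScattering.IsWaveOperator U U₀ s atTop Wp ∧
      StarkScattering.IsWaveOperator U U₀ s atBot Wm ∧
      ∀ Φ Ψ : 𝓢(StarkScattering.Space n, ℂ),
        StarkScattering.IsFourierOfTestFunction Φ →
        StarkScattering.IsFourierOfTestFunction Ψ →
        ∀ j : Fin n,
          (∀ x, Integrable (fun t : ℝ => StarkScattering.gradComponent V j s (x + t • w))) ∧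
          Integrable (fun x => (StarkScattering.xrayGrad V j s w x : ℂ) * Φ x * star (Ψ x)) ∧
          (fun lam : ℝ =>
            StarkScattering.commutatorForm (StarkScattering.scatteringOperator Wp Wm) j
                (StarkScattering.boost lam w Φ) (StarkScattering.boost lam w Ψ)
              - ((lam ^ (-(1 / 2) : ℝ) : ℝ) : ℂ) *
                ∫ x, (StarkScattering.xrayGrad V j s w x : ℂ) * Φ x * star (Ψ x))
            =o[atTop] (fun lam : ℝ => lam ^ (-(1 / 2) : ℝ)) := by
  -- The exponent is capped at 2, the range of the propagation estimate. The thresholds 1 and 1/2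
  -- lie below 2 and survive the cap.
  obtain ⟨δ', hδ', hδ2, hδδ', hlt⟩ : ∃ δ' : ℝ, 0 < δ' ∧ δ' ≤ 2 ∧ δ' ≤ δ ∧
      ∀ c : ℝ, c < 2 → c < δ → c < δ' :=
    ⟨min δ 2, lt_min hδ two_pos, min_le_right _ _, min_le_left _ _, fun c h2 h => lt_min h h2⟩
  have hV' := hV.mono hδδ'
  -- Linear escape off a null hyperplane of momenta if E₀ = 0, quadratic escape for all momenta
  -- otherwise; in both cases aδ' > 1.
  obtain ⟨a, ha, haδ, O, hO, hO', hfar⟩ : ∃ a : ℕ,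
      (a = 1 ∨ a = 2 ∧ StarkScattering.meanField E ≠ 0) ∧ 1 < a * δ' ∧
      ∃ O : Set (StarkScattering.Space n), IsOpen O ∧ volume Oᶜ = 0 ∧
        ∀ K, IsCompact K → K ⊆ O → ∃ M, 1 ≤ M ∧ ∀ t,
          StarkScattering.IsFar K M (StarkScattering.fieldOrbit E s 0 t) ((1 + |t - s|) ^ a) := by
    by_cases h0 : StarkScattering.meanField E = 0
    · obtain ⟨c, hc⟩ := StarkScattering.exists_isFar_of_meanField_eq_zero hE h0 s hw
      refine ⟨1, Or.inl rfl, ?_, _, ?_, StarkScattering.volume_hyperplane_eq_zero hw _, hc⟩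
      · rw [Nat.cast_one, one_mul]
        exact hlt 1 one_lt_two (h_zero h0)
      · exact isOpen_ne_fun (by fun_prop) continuous_const
    · refine ⟨2, Or.inr ⟨rfl, h0⟩, ?_, Set.univ, isOpen_univ, by simp, fun K hK _ =>
        StarkScattering.exists_isFar_of_meanField_ne_zero hE h0 s K hK⟩
      have := hlt (1 / 2) (by norm_num) (StarkScattering.half_lt_of_meanField_ne_zero hw hwE h0
        (h_three h0) (h_two h0))
      push_cast
      linarith
  obtain ⟨Wp, Wm, hp, hm⟩ :=
    StarkScattering.exists_waveOperators hδ' hδ2 hE hV' hU₀ hU s haδ hO hO' hfar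
  refine ⟨Wp, Wm, hp, hm, fun Φ Ψ hΦ hΨ j => ⟨fun x =>
    StarkScattering.integrable_gradComponent_line hδ' hV' hw j s x,
    StarkScattering.integrable_xrayGrad hδ' hV' hw j s Φ Ψ, ?_⟩⟩
  obtain ⟨f, hf, rfl⟩ := StarkScattering.exists_fourierInv_of_isFourierOfTestFunction hΦ
  obtain ⟨g, hg, rfl⟩ := StarkScattering.exists_fourierInv_of_isFourierOfTestFunction hΨ
  simp only [StarkScattering.boost_eq_twist]
  exact StarkScattering.isLittleO_of_tendsto_mul (StarkScattering.tendsto_mul_commutatorForm hδ' hδ2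
    hE hV' hU₀ hU s hp hm hw hwE ha haδ j hf hg)
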